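/- Let $G$ be a second-countable locally compact (Hausdorff) group, let $A$ and $B$ be separable C*-algebras, and let $\alpha: G\curvearrowright A$ and $\beta: G\curvearrowright B$ be point-norm continuous actions. Assume that $\beta$ is strongly stable, i.e. $(B,\beta)$ is conjugate to $(B\otimes\mathcal K,\beta\otimes\mathrm{id}_{\mathcal K})$, where $\mathcal K$ is the algebra of compact operators on $\ell^2(\mathbb N)$. The action on $\mathcal M(B)$ that extends $\beta$ is also denoted by $\beta$. A *cocycle representation* $(\phi,\mathbf u):(A,\alpha)\to(\mathcal M(B),\beta)$ is a $*$-homomorphism $\phi:A\to\mathcal M(B)$ together with a strictly continuous map $\mathbf u:G\to\mathcal U(\mathcal M(B))$ such that $\mathbf u_{gh}=\mathbf u_g\beta_g(\mathbf u_h)$ and $\mathbf u_g\beta_g(\phi(a))\mathbf u_g^*=\phi(\alpha_g(a))$ for all $g,h\in G$, $a\in A$. For isometries $t_1,t_2\in\mathcal M(B)^\beta$ with $t_1t_1^*+t_2t_2^*=1$, the Cuntz sum is defined by $x\oplus y=t_1xt_1^*+t_2yt_2^*$ for $x,y\in\mathcal M(B)$, and pointwise for cocycle representations; up to conjugation by a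 unitary in $\mathcal M(B)^\beta$ it does not depend on $t_1,t_2$. Write $(\phi,\mathbf u)\sim_{\mathrm{asymp}}(\psi,\mathbf v)$ if there is a norm-continuous path of unitaries $w:[1,\infty)\to\mathcal U(\mathcal M(B))$ such that $w_t\phi(a)w_t^*\to\psi(a)$ in norm as $t\to\infty$ for all $a\in A$, $w_t\mathbf u_g\beta_g(w_t)^*\to\mathbf v_g$ in norm as $t\to\infty$, uniformly for $g$ in compact subsets of $G$, and all the differences $\psi(a)-w_t\phi(a)w_t^*$ and $\mathbf v_g-w_t\mathbf u_g\beta_g(w_t)^*$ lie in $B$. A cocycle representation $(\theta,\mathbf y)$ is *absorbing* if $(\theta\oplus\phi,\mathbf y\oplus\mathbf u)\sim_{\mathrm{asymp}}(\theta,\mathbf y)$ for every cocycle representation $(\phi,\mathbf u)$. An $(\alpha,\beta)$-*Cuntz pair* is a pair of cocycle representations $\big((\phi,\mathbf u),(\psi,\mathbf v)\big)$ with $\phi(a)-\psi(a)\in B$ and $\mathbf u_g-\mathbf v_g\in B$ for all $a\in A$, $g\in G$; it is a *cocycle pair* if $\phi=\psi=0$. Cuntz sums of Cuntz pairs are taken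 componentwise. Let $\mathbb E^G(\alpha,\beta)$ be the set of Cuntz pairs. Two Cuntz pairs are *homotopic*, $x_0\sim_h x_1$, if some $(\alpha,\beta[0,1])$-Cuntz pair, where $\beta[0,1]$ is the pointwise action on $B[0,1]=C([0,1],B)$, restricts to $x_0$ and $x_1$ under evaluation at $0$ and $1$. The group $KK^G(\alpha,\beta)$ is (in the Cuntz–Thomsen picture) $\mathbb E^G(\alpha,\beta)/{\sim}$, where $x\sim y$ if $x\oplus d_1\sim_h y\oplus d_2$ for some cocycle pairs $d_1,d_2$. A Cuntz pair $\big((\phi,\mathbf u),(\psi,\mathbf v)\big)$ is *anchored* if $\big((0,\mathbf u),(0,\mathbf v)\big)\sim_h\big((0,1),(0,1)\big)$. Let $(\theta,\mathbf y):(A,\alpha)\to(\mathcal M(B),\beta)$ be an absorbing cocycle representation. Then: 1. Every element of $\mathbb E^G(\alpha,\beta)/{\sim_h}$ is the homotopy class of an $(\alpha,\beta)$-Cuntz pair $\big((\phi,\mathbf u),(\theta,\mathbf y)\big)$ for some absorbing cocycle representation $(\phi,\mathbf u):(A,\alpha)\to(\mathcal M(B),\beta)$. 2. Every element of $KK^G(\alpha,\beta)$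 is the class of an anchored $(\alpha,\beta)$-Cuntz pair $\big((\phi,\mathbf u),(\theta,\mathbf y)\big)$ for some absorbing cocycle representation $(\phi,\mathbf u):(A,\alpha)\to(\mathcal M(B),\beta)$. -/

import Mathlib

open scoped MultiplierAlgebra TensorProduct unitInterval
open Filter Topology

noncomputable section

namespace CuntzThomsen

/-! ### The compact operators and actions on C*-algebras -/

/-- The separable infinite-dimensional Hilbert space `ℓ²(ℕ)`. -/
abbrev Hil : Type := lp (fun _ : ℕ => ℂ) 2

/-- On a Hilbert space, the adjoint of a compact operator is compact. -/
theorem isCompactOperator_star {T : Hil →L[ℂ] Hil} (hT : IsCompactOperator T) :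
    IsCompactOperator (star T : Hil →L[ℂ] Hil) := by
  have hTT : IsCompactOperator (T * star T : Hil →L[ℂ] Hil) := hT.comp_clm (star T)
  have hK := (isCompactOperator_iff_isCompact_closure_image_closedBall _ one_pos).1 hTT
  refine (isCompactOperator_iff_isCompact_closure_image_closedBall
    ((star T : Hil →L[ℂ] Hil) : Hil →ₗ[ℂ] Hil) one_pos).2 ?_
  refine TotallyBounded.isCompact_of_isClosed (TotallyBounded.closure ?_) isClosed_closure
  rw [Metric.totallyBounded_iff]
  intro ε hε
  have hS := hK.totallyBounded.subset subset_closure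
  obtain ⟨t, hts, htf, hcov⟩ :=
    totallyBounded_iff_subset.1 hS _ (Metric.dist_mem_uniformity (half_pos (pow_pos hε 2)))
  obtain ⟨u, hu, huf, rfl⟩ := Set.exists_subset_image_finite_and.1 ⟨t, hts, htf, rfl⟩
  refine ⟨_, huf.image (star T : Hil →L[ℂ] Hil), ?_⟩
  rintro _ ⟨x, hx, rfl⟩
  have hx' := hcov (Set.mem_image_of_mem _ hx)
  simp only [Set.mem_iUnion, Set.mem_image, exists_prop, exists_exists_and_eq_and] at hx' ⊢
  obtain ⟨y, hy, hxy⟩ := hx'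
  refine ⟨y, hy, ?_⟩
  have hyb := hu hy
  rw [mem_closedBall_zero_iff] at hx hyb
  have h1 : ‖(T * star T) (x - y)‖ < ε ^ 2 / 2 := by
    rw [map_sub, ← dist_eq_norm]; exact hxy
  have h2 : ‖x - y‖ ≤ 2 := (norm_sub_le x y).trans (by linarith)
  have h3 : ‖star T (x - y)‖ ^ 2 ≤ ‖(T * star T) (x - y)‖ * ‖x - y‖ := by
    have h := ContinuousLinearMap.apply_norm_sq_eq_inner_adjoint_left (star T) (x - y)
    rw [← ContinuousLinearMap.star_eq_adjoint, star_star] at h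
    rw [h]
    exact (RCLike.re_le_norm _).trans (norm_inner_le_norm _ _)
  have h4 : ‖star T (x - y)‖ ^ 2 < ε ^ 2 := by
    nlinarith [norm_nonneg (x - y), norm_nonneg ((T * star T) (x - y))]
  have h5 : ‖star T (x - y)‖ < ε := lt_of_pow_lt_pow_left₀ 2 hε.le h4
  rw [map_sub, ← dist_eq_norm] at h5
  exact h5

/-- The C*-algebra `𝒦` of compact operators on `ℓ²(ℕ)`. -/
def compacts : NonUnitalStarSubalgebra ℂ (Hil →L[ℂ] Hil) where
  carrier := {T | IsCompactOperator T}
  add_mem' := fun ha hb => IsCompactOperator.add ha hb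
  zero_mem' := isCompactOperator_zero
  mul_mem' := fun {_ b} ha _ => IsCompactOperator.comp_clm ha b
  smul_mem' := fun c _ ha => IsCompactOperator.smul ha c
  star_mem' := fun ha => isCompactOperator_star ha

/-- A continuous action `G ↷ A`: a homomorphism `G → Aut(A)` that is continuous in the
topology of pointwise norm convergence. -/
structure CStarAction (G A : Type*) [Group G] [TopologicalSpace G] [NonUnitalCStarAlgebra A] where
  toHom : G →* (A ≃⋆ₐ[ℂ] A)
  continuous_apply : ∀ a : A, Continuous fun g => toHom g a

variable {G A B : Type*} [Group G] [TopologicalSpace G] [NonUnitalCStarAlgebra A]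
  [NonUnitalCStarAlgebra B]

theorem CStarAction.norm_apply (β : CStarAction G B) (g : G) (b : B) : ‖β.toHom g b‖ = ‖b‖ :=
  NonUnitalStarAlgHom.norm_map (β.toHom g) (β.toHom g).injective b

/-- `β` is strongly stable if `(B, β)` is conjugate to `(B ⊗ 𝒦, β ⊗ id)`. Here `B ⊗ 𝒦` is the
C*-algebraic tensor product: the completion of the algebraic tensor product for its C*-norm, which
is unique because `𝒦` is nuclear. A conjugacy `B ⊗ 𝒦 ≅ B` is thus the same as an injective
`*`-homomorphism with dense range from the algebraic tensor product to `B`, intertwining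
`β ⊗ id` and `β`. -/
def StronglyStable (β : CStarAction G B) : Prop :=
  ∃ ι : (B ⊗[ℂ] compacts) →⋆ₙₐ[ℂ] B, Function.Injective ι ∧ DenseRange ι ∧
    ∀ (g : G) (b : B) (k : compacts), β.toHom g (ι (b ⊗ₜ[ℂ] k)) = ι (β.toHom g b ⊗ₜ[ℂ] k)

/-! ### The multiplier algebra -/

/-- The multiplier `m` belongs to the ideal `B` of `M(B)`. -/
def InIdeal (m : 𝓜(ℂ, B)) : Prop := ∃ b : B, m = DoubleCentralizer.coe ℂ b

/-- Strict continuity of a map into `M(B)`: `x ↦ f(x) b` and `x ↦ b f(x)` are norm continuous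
for every `b ∈ B` (note `m.fst b = m b` and `m.snd b = b m`). -/
def StrictlyContinuous {X : Type*} [TopologicalSpace X] (f : X → 𝓜(ℂ, B)) : Prop :=
  (∀ b : B, Continuous fun x => (f x).fst b) ∧ (∀ b : B, Continuous fun x => (f x).snd b)

/-- An automorphism of a C*-algebra as a bounded linear map. -/
def autCLM (e : B ≃⋆ₐ[ℂ] B) : B →L[ℂ] B where
  toFun := e
  map_add' := map_add e
  map_smul' := map_smul e
  cont := (NonUnitalStarAlgHom.isometry e e.injective).continuous

@[simp] theorem autCLM_apply (e : B ≃⋆ₐ[ℂ] B) (b : B) : autCLM e b = e b := rfl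

/-- The canonical extension of an automorphism `e` of `B` to `M(B)`, determined by
`e(m) b = e(m e⁻¹(b))` and `b e(m) = e(e⁻¹(b) m)`. -/
def extendAut (e : B ≃⋆ₐ[ℂ] B) : 𝓜(ℂ, B) →⋆ₐ[ℂ] 𝓜(ℂ, B) where
  toFun m :=
    { fst := ((autCLM e).comp m.fst).comp (autCLM e.symm)
      snd := ((autCLM e).comp m.snd).comp (autCLM e.symm)
      central := fun x y => by
        have := congrArg e (m.central (e.symm x) (e.symm y))
        simpa [map_mul] using this }
  map_one' := by ext <;> simp
  map_mul' m n := by ext <;> simp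
  map_zero' := by ext <;> simp
  map_add' m n := by ext <;> simp
  commutes' c := by ext <;> simp
  map_star' m := by ext <;> simp [map_star]

/-- The (algebraic) action of `G` on `M(B)` that extends `β`. -/
abbrev CStarAction.ext (β : CStarAction G B) (g : G) : 𝓜(ℂ, B) →⋆ₐ[ℂ] 𝓜(ℂ, B) :=
  extendAut (β.toHom g)

theorem InIdeal.add {m n : 𝓜(ℂ, B)} (hm : InIdeal m) (hn : InIdeal n) : InIdeal (m + n) := by
  obtain ⟨b, rfl⟩ := hm
  obtain ⟨c, rfl⟩ := hn
  exact ⟨b + c, (map_add (DoubleCentralizer.coeHom (𝕜 := ℂ) (A := B)) b c).symm⟩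

theorem multiplier_fst_mul (m : 𝓜(ℂ, B)) (b c : B) : m.fst (b * c) = m.fst b * c := by
  have h : ∀ z : B, z * (m.fst (b * c) - m.fst b * c) = 0 := fun z => by
    rw [mul_sub, ← m.central, ← mul_assoc, ← mul_assoc, ← m.central, sub_self]
  exact sub_eq_zero.1 (CStarRing.star_mul_self_eq_zero_iff _ |>.1 (h _))

theorem multiplier_snd_mul (m : 𝓜(ℂ, B)) (b c : B) : m.snd (b * c) = b * m.snd c := by
  have h : ∀ z : B, (m.snd (b * c) - b * m.snd c) * z = 0 := fun z => by
    rw [sub_mul, m.central, mul_assoc, mul_assoc, m.central, sub_self]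
  exact sub_eq_zero.1 (CStarRing.mul_star_self_eq_zero_iff _ |>.1 (h _))

theorem InIdeal.mul_mul {m : 𝓜(ℂ, B)} (hm : InIdeal m) (x y : 𝓜(ℂ, B)) :
    InIdeal (x * m * y) := by
  obtain ⟨b, rfl⟩ := hm
  refine ⟨y.snd (x.fst b), ?_⟩
  ext c
  · change x.fst (b * y.fst c) = y.snd (x.fst b) * c
    rw [multiplier_fst_mul, y.central]
  · change y.snd (x.snd c * b) = c * y.snd (x.fst b)
    rw [x.central, multiplier_snd_mul]

theorem InIdeal.zero : InIdeal (0 : 𝓜(ℂ, B)) :=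
  ⟨0, (map_zero (DoubleCentralizer.coeHom (𝕜 := ℂ) (A := B))).symm⟩

/-! ### Cocycle representations -/

/-- A cocycle representation `(φ, u) : (A, α) → (M(B), β)`. -/
structure CocycleRep (α : CStarAction G A) (β : CStarAction G B) where
  φ : A →⋆ₙₐ[ℂ] 𝓜(ℂ, B)
  u : G → 𝓜(ℂ, B)
  unitary_u : ∀ g, u g ∈ unitary 𝓜(ℂ, B)
  continuous_u : StrictlyContinuous u
  cocycle : ∀ g h, u (g * h) = u g * β.ext g (u h)
  covariant : ∀ g a, u g * β.ext g (φ a) * star (u g) = φ (α.toHom g a)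

variable {α : CStarAction G A} {β : CStarAction G B}

/-- The cocycle representation `(0, u)` obtained from `(φ, u)`. -/
def CocycleRep.zeroPart (x : CocycleRep α β) : CocycleRep α β where
  φ := 0
  u := x.u
  unitary_u := x.unitary_u
  continuous_u := x.continuous_u
  cocycle := x.cocycle
  covariant g a := by simp

/-- The zero representation `(0, 1)`. -/
def CocycleRep.zero (α : CStarAction G A) (β : CStarAction G B) : CocycleRep α β where
  φ := 0
  u := fun _ => 1
  unitary_u := fun _ => one_mem _
  continuous_u := ⟨fun _ => continuous_const, fun _ => continuous_const⟩
  cocycle g h := by simp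
  covariant g a := by simp

/-- Two isometries `t₁, t₂ ∈ M(B)^β` with `t₁ t₁* + t₂ t₂* = 1`. -/
structure CuntzIsometries (β : CStarAction G B) where
  t₁ : 𝓜(ℂ, B)
  t₂ : 𝓜(ℂ, B)
  fixed₁ : ∀ g, β.ext g t₁ = t₁
  fixed₂ : ∀ g, β.ext g t₂ = t₂
  isometry₁ : star t₁ * t₁ = 1
  isometry₂ : star t₂ * t₂ = 1
  sum_eq_one : t₁ * star t₁ + t₂ * star t₂ = 1

namespace CuntzIsometries

variable (t : CuntzIsometries β)

theorem orth₁₂ : star t.t₁ * t.t₂ = 0 := by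
  have h : star t.t₁ * (t.t₁ * star t.t₁ + t.t₂ * star t.t₂) * t.t₂
      = (star t.t₁ * t.t₁) * (star t.t₁ * t.t₂) + (star t.t₁ * t.t₂) * (star t.t₂ * t.t₂) := by
    noncomm_ring
  rw [t.sum_eq_one, t.isometry₁, t.isometry₂, mul_one, one_mul, mul_one] at h
  exact left_eq_add.1 h

theorem orth₂₁ : star t.t₂ * t.t₁ = 0 := by
  simpa using congrArg star t.orth₁₂

/-- The Cuntz sum `b₁ ⊕ b₂ = t₁ b₁ t₁* + t₂ b₂ t₂*`. -/
def sum (b₁ b₂ : 𝓜(ℂ, B)) : 𝓜(ℂ, B) := t.t₁ * b₁ * star t.t₁ + t.t₂ * b₂ * star t.t₂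

theorem sum_mul_sum (a b c d : 𝓜(ℂ, B)) : t.sum a b * t.sum c d = t.sum (a * c) (b * d) := by
  have h : t.sum a b * t.sum c d =
      t.t₁ * a * (star t.t₁ * t.t₁) * c * star t.t₁ + t.t₁ * a * (star t.t₁ * t.t₂) * d * star t.t₂
      + t.t₂ * b * (star t.t₂ * t.t₁) * c * star t.t₁
      + t.t₂ * b * (star t.t₂ * t.t₂) * d * star t.t₂ := by
    unfold sum; noncomm_ring
  rw [h, t.isometry₁, t.isometry₂, t.orth₁₂, t.orth₂₁]
  unfold sum; noncomm_ring

theorem star_sum (a b : 𝓜(ℂ, B)) : star (t.sum a b) = t.sum (star a) (star b) := by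
  simp [sum, mul_assoc]

theorem sum_one_one : t.sum 1 1 = 1 := by
  simpa [sum] using t.sum_eq_one

theorem ext_sum (g : G) (a b : 𝓜(ℂ, B)) :
    β.ext g (t.sum a b) = t.sum (β.ext g a) (β.ext g b) := by
  simp only [sum, map_add, map_mul, map_star, t.fixed₁, t.fixed₂]

theorem sum_sub_sum (a b c d : 𝓜(ℂ, B)) : t.sum a b - t.sum c d = t.sum (a - c) (b - d) := by
  unfold sum; noncomm_ring

theorem inIdeal_sum {a b : 𝓜(ℂ, B)} (ha : InIdeal a) (hb : InIdeal b) : InIdeal (t.sum a b) :=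
  (ha.mul_mul _ _).add (hb.mul_mul _ _)

/-- The pointwise Cuntz sum `(φ, u) ⊕ (ψ, v) = (φ ⊕ ψ, u ⊕ v)` of cocycle representations. -/
def sumRep (x y : CocycleRep α β) : CocycleRep α β where
  φ :=
    { toFun := fun a => t.sum (x.φ a) (y.φ a)
      map_smul' := fun c a => by simp [sum]
      map_zero' := by simp [sum]
      map_add' := fun a b => by simp only [sum, map_add]; noncomm_ring
      map_mul' := fun a b => by rw [sum_mul_sum, map_mul, map_mul]
      map_star' := fun a => by rw [star_sum, map_star, map_star] }
  u := fun g => t.sum (x.u g) (y.u g)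
  unitary_u := fun g => by
    have hx := Unitary.mem_iff.1 (x.unitary_u g)
    have hy := Unitary.mem_iff.1 (y.unitary_u g)
    rw [Unitary.mem_iff, star_sum, sum_mul_sum, sum_mul_sum, hx.1, hx.2, hy.1, hy.2, sum_one_one]
    exact ⟨rfl, rfl⟩
  continuous_u := by
    refine ⟨fun b => ?_, fun b => ?_⟩
    · exact (t.t₁.fst.continuous.comp (x.continuous_u.1 ((star t.t₁).fst b))).add
        (t.t₂.fst.continuous.comp (y.continuous_u.1 ((star t.t₂).fst b)))
    · exact ((star t.t₁).snd.continuous.comp (x.continuous_u.2 (t.t₁.snd b))).add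
        ((star t.t₂).snd.continuous.comp (y.continuous_u.2 (t.t₂.snd b)))
  cocycle g h := by rw [ext_sum, sum_mul_sum, x.cocycle, y.cocycle]
  covariant g a := by
    change t.sum _ _ * β.ext g (t.sum _ _) * star (t.sum _ _) = t.sum _ _
    rw [ext_sum, star_sum, sum_mul_sum, sum_mul_sum, x.covariant, y.covariant]

end CuntzIsometries

/-- The relation `(φ, u) ∼ (ψ, v)` of asymptotic equivalence modulo `B`: there is a norm-continuous
path of unitaries `w : [1, ∞) → U(M(B))` such that `w_t φ(a) w_t* → ψ(a)` in norm for all `a`,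
`w_t u_g β_g(w_t)* → v_g` in norm, uniformly over compact subsets of `G`, and such that all the
differences involved lie in `B`. -/
def AsymptoticEquiv (x y : CocycleRep α β) : Prop :=
  ∃ w : ℝ → 𝓜(ℂ, B), ContinuousOn w (Set.Ici 1) ∧ (∀ t, 1 ≤ t → w t ∈ unitary 𝓜(ℂ, B)) ∧
    (∀ a, Tendsto (fun t => w t * x.φ a * star (w t)) atTop (𝓝 (y.φ a))) ∧
    (∀ a t, 1 ≤ t → InIdeal (y.φ a - w t * x.φ a * star (w t))) ∧
    (∀ K : Set G, IsCompact K →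
      TendstoUniformlyOn (fun t g => w t * x.u g * star (β.ext g (w t))) y.u atTop K) ∧
    (∀ g t, 1 ≤ t → InIdeal (y.u g - w t * x.u g * star (β.ext g (w t))))

/-- `(θ, y)` is absorbing if `(θ ⊕ φ, y ⊕ u) ∼ (θ, y)` for every cocycle representation `(φ, u)`.
The Cuntz sum is formed with some pair of isometries in `M(B)^β`; up to unitary equivalence by a
unitary in `M(B)^β` (which preserves `∼`), it does not depend on this choice. -/
def IsAbsorbing (θ : CocycleRep α β) : Prop :=
  ∀ x : CocycleRep α β, ∃ t : CuntzIsometries β, AsymptoticEquiv (t.sumRep θ x) θ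

/-! ### Cuntz pairs, homotopy and `KK^G` -/

/-- Two cocycle representations form an `(α, β)`-Cuntz pair if their pointwise differences take
values in `B`. -/
def IsCuntzPair (x y : CocycleRep α β) : Prop :=
  (∀ a, InIdeal (x.φ a - y.φ a)) ∧ (∀ g, InIdeal (x.u g - y.u g))

/-- The set `𝔼^G(α, β)` of `(α, β)`-Cuntz pairs, with codomain `(M(B), β)`. -/
structure CuntzPair (α : CStarAction G A) (β : CStarAction G B) where
  fst : CocycleRep α β
  snd : CocycleRep α β
  isCuntzPair : IsCuntzPair fst snd

namespace CuntzPair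

/-- The Cuntz sum of Cuntz pairs. -/
def sum (t : CuntzIsometries β) (x y : CuntzPair α β) : CuntzPair α β where
  fst := t.sumRep x.fst y.fst
  snd := t.sumRep x.snd y.snd
  isCuntzPair := by
    refine ⟨fun a => ?_, fun g => ?_⟩
    · change InIdeal (t.sum _ _ - t.sum _ _)
      rw [t.sum_sub_sum]
      exact t.inIdeal_sum (x.isCuntzPair.1 a) (y.isCuntzPair.1 a)
    · change InIdeal (t.sum _ _ - t.sum _ _)
      rw [t.sum_sub_sum]
      exact t.inIdeal_sum (x.isCuntzPair.2 g) (y.isCuntzPair.2 g)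

/-- A cocycle pair is a Cuntz pair of the form `((0, u), (0, v))`. -/
def IsCocyclePair (x : CuntzPair α β) : Prop := x.fst.φ = 0 ∧ x.snd.φ = 0

/-- The cocycle pair `((0, u), (0, v))` associated to a Cuntz pair `((φ, u), (ψ, v))`. -/
def cocyclePair (x : CuntzPair α β) : CuntzPair α β where
  fst := x.fst.zeroPart
  snd := x.snd.zeroPart
  isCuntzPair := ⟨fun _ => by simpa [CocycleRep.zeroPart] using InIdeal.zero, x.isCuntzPair.2⟩

/-- The trivial Cuntz pair `((0, 1), (0, 1))`. -/
def zero (α : CStarAction G A) (β : CStarAction G B) : CuntzPair α β where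
  fst := CocycleRep.zero α β
  snd := CocycleRep.zero α β
  isCuntzPair := ⟨fun _ => by simpa using InIdeal.zero, fun _ => by simpa using InIdeal.zero⟩

end CuntzPair

/-- The automorphism `f ↦ e ∘ f` of `B[0,1] = C([0,1], B)`. -/
def pathAut (e : B ≃⋆ₐ[ℂ] B) : C(I, B) ≃⋆ₐ[ℂ] C(I, B) where
  toFun f := ⟨fun s => e (f s), (autCLM e).continuous.comp f.continuous⟩
  invFun f := ⟨fun s => e.symm (f s), (autCLM e.symm).continuous.comp f.continuous⟩
  left_inv f := ContinuousMap.ext fun s => e.symm_apply_apply (f s)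
  right_inv f := ContinuousMap.ext fun s => e.apply_symm_apply (f s)
  map_mul' f h := ContinuousMap.ext fun s => map_mul e (f s) (h s)
  map_add' f h := ContinuousMap.ext fun s => map_add e (f s) (h s)
  map_star' f := ContinuousMap.ext fun s => map_star e (f s)
  map_smul' c f := ContinuousMap.ext fun s => map_smul e c (f s)

/-- The action `β[0,1]` of `G` on `B[0,1] = C([0,1], B)`, given by `β` pointwise. -/
def CStarAction.path (β : CStarAction G B) : CStarAction G C(I, B) where
  toHom :=
    { toFun := fun g => pathAut (β.toHom g)
      map_one' := StarAlgEquiv.ext fun f => ContinuousMap.ext fun s =>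
        congrArg (fun e : B ≃⋆ₐ[ℂ] B => e (f s)) (map_one β.toHom)
      map_mul' := fun g h => StarAlgEquiv.ext fun f => ContinuousMap.ext fun s =>
        congrArg (fun e : B ≃⋆ₐ[ℂ] B => e (f s)) (map_mul β.toHom g h) }
  continuous_apply f := by
    refine ContinuousMap.continuous_of_continuous_uncurry _ ?_
    refine continuous_iff_continuousAt.2 fun ⟨g₀, s₀⟩ => ?_
    change ContinuousAt (fun p : G × I => β.toHom p.1 (f p.2)) (g₀, s₀)
    have h1 : Tendsto (fun p : G × I => β.toHom p.1 (f s₀)) (𝓝 (g₀, s₀))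
        (𝓝 (β.toHom g₀ (f s₀))) :=
      ((β.continuous_apply (f s₀)).comp continuous_fst).tendsto (g₀, s₀)
    have h2 : Tendsto (fun p : G × I => β.toHom p.1 (f p.2 - f s₀)) (𝓝 (g₀, s₀)) (𝓝 0) := by
      rw [tendsto_zero_iff_norm_tendsto_zero]
      simp only [β.norm_apply]
      have h3 := ((f.continuous.comp (continuous_snd (X := G))).sub
        (continuous_const (y := f s₀))).norm.tendsto (g₀, s₀)
      simpa using h3
    simpa [ContinuousAt, map_sub] using h1.add h2

/-- Evaluation `M(B[0,1]) → M(B)` at `s ∈ [0,1]`: the extension of the evaluation map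
`B[0,1] → B`, computed on `b ∈ B` by applying the multiplier to the constant function `b`. -/
def evalMultiplier (s : I) (m : 𝓜(ℂ, C(I, B))) : 𝓜(ℂ, B) where
  fst := ((ContinuousMap.evalCLM ℂ s).comp m.fst).comp (ContinuousLinearMap.const ℂ I)
  snd := ((ContinuousMap.evalCLM ℂ s).comp m.snd).comp (ContinuousLinearMap.const ℂ I)
  central x y := by
    have := congrArg (fun f : C(I, B) => f s)
      (m.central (ContinuousMap.const I x) (ContinuousMap.const I y))
    exact this

/-- The Cuntz pair `X` over `β[0,1]` restricts to `x` upon evaluation at `s`. -/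
def RestrictsTo (X : CuntzPair α β.path) (s : I) (x : CuntzPair α β) : Prop :=
  (∀ a, evalMultiplier s (X.fst.φ a) = x.fst.φ a) ∧
  (∀ g, evalMultiplier s (X.fst.u g) = x.fst.u g) ∧
  (∀ a, evalMultiplier s (X.snd.φ a) = x.snd.φ a) ∧
  (∀ g, evalMultiplier s (X.snd.u g) = x.snd.u g)

/-- Homotopy of Cuntz pairs. -/
def Homotopic (x y : CuntzPair α β) : Prop :=
  ∃ X : CuntzPair α β.path, RestrictsTo X 0 x ∧ RestrictsTo X 1 y

/-- A Cuntz pair is anchored if its cocycle pair is homotopic to the trivial one. -/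
def IsAnchored (x : CuntzPair α β) : Prop := Homotopic x.cocyclePair (CuntzPair.zero α β)

/-- `x ⊕ d₁` is homotopic to `y ⊕ d₂` for some cocycle pairs `d₁, d₂`. The Cuntz sum is formed with
some pair of isometries in `M(B)^β`; up to homotopy it does not depend on this choice. -/
def StablyHomotopic (x y : CuntzPair α β) : Prop :=
  ∃ (t : CuntzIsometries β) (d₁ d₂ : CuntzPair α β), d₁.IsCocyclePair ∧ d₂.IsCocyclePair ∧
    Homotopic (CuntzPair.sum t x d₁) (CuntzPair.sum t y d₂)

/-- The set `𝔼^G(α, β)/∼_h` of homotopy classes of Cuntz pairs. -/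
def HomotopyClasses (α : CStarAction G A) (β : CStarAction G B) :=
  Quot (Homotopic : CuntzPair α β → CuntzPair α β → Prop)

/-- The equivariant Kasparov group `KK^G(α, β)` in the Cuntz--Thomsen picture, as a set: Cuntz pairs
modulo homotopy after adding cocycle pairs. -/
def KKG (α : CStarAction G A) (β : CStarAction G B) :=
  Quot (StablyHomotopic : CuntzPair α β → CuntzPair α β → Prop)

/-- The homotopy class of a Cuntz pair. -/
def CuntzPair.homotopyClass (x : CuntzPair α β) : HomotopyClasses α β := Quot.mk _ x

/-- The class of a Cuntz pair in `KK^G(α, β)`. -/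
def CuntzPair.kkClass (x : CuntzPair α β) : KKG α β := Quot.mk _ x

end CuntzThomsen
end

/-! Strong stability supplies invariant Cuntz isometries `t` whose first member is pure: `(t₁*)ⁿ b →
0` in norm for every `b ∈ B` (`StronglyStable.exists_isPure`). They come from isometries of `ℓ²(ℕ)`
acting on the second factor of `B ⊗ 𝒦`. Purity yields two strictly continuous contractions. There is
a path of invariant isometries from `1` to `t₁`, and compressing along it shows that `x` is
homotopic to `x ⊕ 0`. There is also a path of invariant isometries that starts at `1` and
degenerates to `0`. Compressing along the latter makes every pair `(x, x)` null-homotopic; feeding a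
unitary `w` into the corners `X w X* + 1 - X X*` joins `w` to `1`, so that simultaneous conjugation
by `w` does not change a homotopy class.

For statement 1, a Cuntz pair with components `φ, ψ` (cocycles suppressed) is therefore homotopic to
`(φ ⊕ θ, ψ ⊕ θ)`. Absorption gives a norm-continuous path of unitaries `w_t` carrying `ψ ⊕ θ` to `θ`
in the limit, with all differences in `B`. Conjugate both components by the initial unitary, then
keep the first component fixed and let the second follow the path to its limit `θ`
(`AsymptoticEquiv.exists_homotopic`). The first component remains a conjugate of `φ ⊕ θ`, which is
asymptotically equivalent to `θ` and hence absorbing. This is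
`CuntzIsometries.IsPure.exists_absorbing_homotopic`.

For statement 2, a pair with cocycles `u, v` is first replaced by its sum with `((0, v), (0, u))`,
which does not affect the class in `KK^G`. The cocycle pair of the sum is `(u ⊕ v, v ⊕ u)`; rotating
the second entry deforms it to `(u ⊕ v, u ⊕ v)`, which is null-homotopic
(`CuntzIsometries.IsPure.isAnchored_sum`). Since a homotopy of Cuntz pairs restricts to one of their
cocycle pairs, the argument for statement 1 preserves anchoredness. -/

noncomputable section

namespace CuntzThomsen

/-! ### Multiplier algebras and strict continuity -/

section Multipliers

variable {G A B X : Type*} [Group G] [TopologicalSpace G] [NonUnitalCStarAlgebra A]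
  [NonUnitalCStarAlgebra B] [TopologicalSpace X]

theorem star_pow_mul_pow {R : Type*} [Ring R] [StarRing R] {T : R} (hT : star T * T = 1) (n : ℕ) :
    star (T ^ n) * T ^ n = 1 := by
  induction n with
  | zero => simp
  | succ n ih =>
    have h : star (T ^ (n + 1)) * T ^ (n + 1) = star T * (star (T ^ n) * T ^ n) * T := by
      rw [pow_succ, star_mul]; noncomm_ring
    rw [h, ih, mul_one, hT]

/-- Centrality `(b m) z = b (m z)` and nondegeneracy of `B` recover right multiplication from left
multiplication, so later identities are checked on one side only. -/
theorem multiplier_ext {m n : 𝓜(ℂ, B)} (h : ∀ b, m.fst b = n.fst b) : m = n := by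
  have h2 : ∀ b, m.snd b = n.snd b := fun b => by
    have h3 : ∀ z : B, (m.snd b - n.snd b) * z = 0 := fun z => by
      rw [sub_mul, m.central, n.central, h, sub_self]
    exact sub_eq_zero.1 (CStarRing.mul_star_self_eq_zero_iff _ |>.1 (h3 _))
  exact DoubleCentralizer.ext _ _ _ _
    (Prod.ext (ContinuousLinearMap.ext h) (ContinuousLinearMap.ext h2))

theorem norm_fst_apply_le (m : 𝓜(ℂ, B)) (b : B) : ‖m.fst b‖ ≤ ‖m‖ * ‖b‖ := by
  simpa using m.fst.le_opNorm b

theorem norm_snd_apply_le (m : 𝓜(ℂ, B)) (b : B) : ‖m.snd b‖ ≤ ‖m‖ * ‖b‖ := by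
  simpa using m.snd.le_opNorm b

theorem snd_eq_star (m : 𝓜(ℂ, B)) (b : B) : m.snd b = star ((star m).fst (star b)) := by
  simp

/-- An inequality rather than an equality, because `B = 0` is allowed. -/
theorem norm_one_le : ‖(1 : 𝓜(ℂ, B))‖ ≤ 1 := by
  have h := CStarRing.norm_star_mul_self (x := (1 : 𝓜(ℂ, B)))
  rw [star_one, mul_one] at h
  nlinarith [norm_nonneg (1 : 𝓜(ℂ, B))]

theorem norm_le_one_of_isometry {m : 𝓜(ℂ, B)} (h : star m * m = 1) : ‖m‖ ≤ 1 := by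
  have h1 := CStarRing.norm_star_mul_self (x := m)
  rw [h] at h1
  nlinarith [norm_nonneg m, norm_one_le (B := B)]

theorem norm_le_one_of_unitary {m : 𝓜(ℂ, B)} (h : m ∈ unitary 𝓜(ℂ, B)) : ‖m‖ ≤ 1 :=
  norm_le_one_of_isometry (Unitary.mem_iff.1 h).1

theorem norm_coe_multiplier (b : B) : ‖(DoubleCentralizer.coe ℂ b : 𝓜(ℂ, B))‖ = ‖b‖ := by
  rw [← DoubleCentralizer.norm_fst, DoubleCentralizer.coe_fst]
  exact congrArg NNReal.toReal (ContinuousLinearMap.opNNNorm_mul_apply ℂ B b)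

theorem coe_multiplier_sub (b c : B) :
    (DoubleCentralizer.coe ℂ (b - c) : 𝓜(ℂ, B)) =
      DoubleCentralizer.coe ℂ b - DoubleCentralizer.coe ℂ c :=
  map_sub (DoubleCentralizer.coeHom (𝕜 := ℂ) (A := B)) b c

theorem isometry_coe_multiplier : Isometry (DoubleCentralizer.coe ℂ : B → 𝓜(ℂ, B)) :=
  Isometry.of_dist_eq fun b c => by
    rw [dist_eq_norm, dist_eq_norm, ← coe_multiplier_sub, norm_coe_multiplier]

theorem mul_coe_mul (x y : 𝓜(ℂ, B)) (b : B) :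
    x * DoubleCentralizer.coe ℂ b * y = DoubleCentralizer.coe ℂ (y.snd (x.fst b)) := by
  refine multiplier_ext fun c => ?_
  change x.fst (b * y.fst c) = y.snd (x.fst b) * c
  rw [multiplier_fst_mul, y.central]

theorem InIdeal.sub {m n : 𝓜(ℂ, B)} (hm : InIdeal m) (hn : InIdeal n) : InIdeal (m - n) := by
  obtain ⟨b, rfl⟩ := hm
  obtain ⟨c, rfl⟩ := hn
  exact ⟨b - c, (coe_multiplier_sub b c).symm⟩

theorem InIdeal.neg {m : 𝓜(ℂ, B)} (hm : InIdeal m) : InIdeal (-m) := by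
  simpa using InIdeal.zero.sub hm

theorem ext_fst_apply (β : CStarAction G B) (g : G) (m : 𝓜(ℂ, B)) (b : B) :
    (β.ext g m).fst b = β.toHom g (m.fst (β.toHom g⁻¹ b)) := by
  rw [map_inv]
  rfl

theorem ext_snd_apply (β : CStarAction G B) (g : G) (m : 𝓜(ℂ, B)) (b : B) :
    (β.ext g m).snd b = β.toHom g (m.snd (β.toHom g⁻¹ b)) := by
  rw [map_inv]
  rfl

theorem ext_mul_apply (β : CStarAction G B) (g h : G) (m : 𝓜(ℂ, B)) :
    β.ext (g * h) m = β.ext g (β.ext h m) := by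
  refine multiplier_ext fun b => ?_
  rw [ext_fst_apply, ext_fst_apply, ext_fst_apply, mul_inv_rev, map_mul, map_mul]
  rfl

theorem norm_ext_le (β : CStarAction G B) (g : G) (m : 𝓜(ℂ, B)) : ‖β.ext g m‖ ≤ ‖m‖ :=
  NonUnitalStarAlgHom.norm_apply_le (β.ext g) m

theorem continuous_ext_action (β : CStarAction G B) (g : G) : Continuous (β.ext g) :=
  AddMonoidHomClass.continuous_of_bound (β.ext g) 1 fun m => by
    simpa using norm_ext_le β g m

theorem ext_mem_unitary (β : CStarAction G B) (g : G) {m : 𝓜(ℂ, B)} (hm : m ∈ unitary 𝓜(ℂ, B)) :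
    β.ext g m ∈ unitary 𝓜(ℂ, B) := by
  rw [Unitary.mem_iff] at hm ⊢
  rw [← map_star, ← map_mul, ← map_mul, hm.1, hm.2, map_one]
  exact ⟨rfl, rfl⟩

/-- Strict continuity at a point. -/
def StrictlyContinuousAt (f : X → 𝓜(ℂ, B)) (x : X) : Prop :=
  (∀ b : B, ContinuousAt (fun x => (f x).fst b) x) ∧
    ∀ b : B, ContinuousAt (fun x => (f x).snd b) x

theorem strictlyContinuous_iff {f : X → 𝓜(ℂ, B)} :
    StrictlyContinuous f ↔ ∀ x, StrictlyContinuousAt f x :=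
  ⟨fun h _ => ⟨fun b => (h.1 b).continuousAt, fun b => (h.2 b).continuousAt⟩,
    fun h => ⟨fun b => continuous_iff_continuousAt.2 fun x => (h x).1 b,
      fun b => continuous_iff_continuousAt.2 fun x => (h x).2 b⟩⟩

theorem StrictlyContinuous.at {f : X → 𝓜(ℂ, B)} (h : StrictlyContinuous f) (x : X) :
    StrictlyContinuousAt f x :=
  strictlyContinuous_iff.1 h x

/-- The uniform bound controls `f y (c y - c x)`, so only continuity at the single vector `c x` is
needed. This makes products of bounded strictly continuous maps strictly continuous. -/
theorem continuousAt_clm_apply {f : X → B →L[ℂ] B} {c : X → B} {x : X} {C : ℝ}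
    (hC : ∀ x, ‖f x‖ ≤ C) (hf : ContinuousAt (fun y => f y (c x)) x) (hc : ContinuousAt c x) :
    ContinuousAt (fun y => f y (c y)) x := by
  have h1 : Tendsto (fun y => f y (c y - c x)) (𝓝 x) (𝓝 0) := by
    refine squeeze_zero_norm (a := fun y => C * ‖c y - c x‖) (fun y => ?_) ?_
    · exact ((f y).le_opNorm _).trans (mul_le_mul_of_nonneg_right (hC y) (norm_nonneg _))
    · have h2 : Tendsto (fun y => c y - c x) (𝓝 x) (𝓝 0) := by
        simpa using hc.tendsto.sub_const (c x)
      simpa using h2.norm.const_mul C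
  have h3 := h1.add hf.tendsto
  simpa [ContinuousAt, map_sub] using h3

namespace StrictlyContinuousAt

variable {f h : X → 𝓜(ℂ, B)} {x : X}

theorem fst_apply (hf : StrictlyContinuousAt f x) {C : ℝ} (hC : ∀ x, ‖f x‖ ≤ C) {c : X → B}
    (hc : ContinuousAt c x) : ContinuousAt (fun y => (f y).fst (c y)) x :=
  continuousAt_clm_apply (f := fun y => (f y).fst) (by simpa using hC) (hf.1 _) hc

theorem snd_apply (hf : StrictlyContinuousAt f x) {C : ℝ} (hC : ∀ x, ‖f x‖ ≤ C) {c : X → B}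
    (hc : ContinuousAt c x) : ContinuousAt (fun y => (f y).snd (c y)) x :=
  continuousAt_clm_apply (f := fun y => (f y).snd) (by simpa using hC) (hf.2 _) hc

protected theorem const (m : 𝓜(ℂ, B)) : StrictlyContinuousAt (fun _ : X => m) x :=
  ⟨fun _ => continuousAt_const, fun _ => continuousAt_const⟩

protected theorem star (hf : StrictlyContinuousAt f x) :
    StrictlyContinuousAt (fun y => star (f y)) x :=
  ⟨fun b => by simpa using (hf.2 (star b)).star, fun b => by simpa using (hf.1 (star b)).star⟩

protected theorem add (hf : StrictlyContinuousAt f x) (hh : StrictlyContinuousAt h x) :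
    StrictlyContinuousAt (fun y => f y + h y) x :=
  ⟨fun b => (hf.1 b).add (hh.1 b), fun b => (hf.2 b).add (hh.2 b)⟩

protected theorem sub (hf : StrictlyContinuousAt f x) (hh : StrictlyContinuousAt h x) :
    StrictlyContinuousAt (fun y => f y - h y) x :=
  ⟨fun b => (hf.1 b).sub (hh.1 b), fun b => (hf.2 b).sub (hh.2 b)⟩

protected theorem mul (hf : StrictlyContinuousAt f x) (hh : StrictlyContinuousAt h x) {C D : ℝ}
    (hC : ∀ x, ‖f x‖ ≤ C) (hD : ∀ x, ‖h x‖ ≤ D) : StrictlyContinuousAt (fun y => f y * h y) x :=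
  ⟨fun b => hf.fst_apply hC (hh.1 b), fun b => hh.snd_apply hD (hf.2 b)⟩

theorem comp {Y : Type*} [TopologicalSpace Y] {k : Y → X} {y : Y}
    (hf : StrictlyContinuousAt f (k y)) (hk : ContinuousAt k y) :
    StrictlyContinuousAt (fun z => f (k z)) y :=
  ⟨fun b => ContinuousAt.comp (f := k) (hf.1 b) hk, fun b => ContinuousAt.comp (f := k) (hf.2 b) hk⟩

theorem of_continuousAt (hf : ContinuousAt f x) : StrictlyContinuousAt f x := by
  have h0 : Tendsto (fun y => ‖f y - f x‖) (𝓝 x) (𝓝 0) := by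
    have := (hf.tendsto.sub_const (f x)).norm
    simpa using this
  constructor
  · refine fun b => tendsto_iff_norm_sub_tendsto_zero.2
      (squeeze_zero (fun _ => norm_nonneg _) (fun y => ?_) (by simpa using h0.mul_const ‖b‖))
    simpa using norm_fst_apply_le (f y - f x) b
  · refine fun b => tendsto_iff_norm_sub_tendsto_zero.2
      (squeeze_zero (fun _ => norm_nonneg _) (fun y => ?_) (by simpa using h0.mul_const ‖b‖))
    simpa using norm_snd_apply_le (f y - f x) b

theorem congr (hf : StrictlyContinuousAt f x) (hfh : f =ᶠ[𝓝 x] h) : StrictlyContinuousAt h x :=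
  ⟨fun b => (hf.1 b).congr (hfh.mono fun y hy => by simp only [hy]),
    fun b => (hf.2 b).congr (hfh.mono fun y hy => by simp only [hy])⟩

/-- If `k y` stays bounded and `h y b` tends to zero for every `b`, then
`star (h y) * k y * h y` tends strictly to zero. -/
theorem sandwich_of_eq_zero {k : X → 𝓜(ℂ, B)} {C D : ℝ} (hC : ∀ y, ‖k y‖ ≤ C)
    (hD : ∀ y, ‖h y‖ ≤ D) (h0 : h x = 0) (hh : ∀ b, ContinuousAt (fun y => (h y).fst b) x) :
    StrictlyContinuousAt (fun y => star (h y) * k y * h y) x := by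
  have key : ∀ (k : X → 𝓜(ℂ, B)), (∀ y, ‖k y‖ ≤ C) → ∀ b,
      ContinuousAt (fun y => (star (h y) * k y * h y).fst b) x := by
    intro k hC b
    have h1 : Tendsto (fun y => (h y).fst b) (𝓝 x) (𝓝 0) := by
      simpa [ContinuousAt, h0] using hh b
    have h2 : Tendsto (fun y => (star (h y) * k y * h y).fst b) (𝓝 x) (𝓝 0) := by
      refine squeeze_zero_norm (a := fun y => D * C * ‖(h y).fst b‖) (fun y => ?_)
        (by simpa using h1.norm.const_mul (D * C))
      refine (norm_fst_apply_le (star (h y) * k y) ((h y).fst b)).trans ?_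
      refine mul_le_mul_of_nonneg_right ((norm_mul_le _ _).trans ?_) (norm_nonneg _)
      rw [norm_star]
      exact mul_le_mul (hD y) (hC y) (norm_nonneg _) ((norm_nonneg _).trans (hD y))
    simpa [ContinuousAt, h0] using h2
  refine ⟨key k hC, fun b => ?_⟩
  -- The adjoint of the sandwich is the sandwich of `star (k y)`, so right multiplication reduces to
  -- left multiplication.
  have h3 := (key (fun y => star (k y)) (by simpa using hC) (star b)).star
  simpa [mul_assoc] using h3

/-- An element of `B` in the middle turns strict continuity into norm continuity. This is how the
differences in a Cuntz pair stay norm continuous along paths that are merely strictly continuous. -/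
theorem sandwich_coe (hf : StrictlyContinuousAt f x) (hh : StrictlyContinuousAt h x) {D : ℝ}
    (hD : ∀ x, ‖h x‖ ≤ D) (b : B) :
    ContinuousAt (fun y => f y * DoubleCentralizer.coe ℂ b * h y) x := by
  simp only [mul_coe_mul]
  exact ContinuousAt.comp (f := fun y => (h y).snd ((f y).fst b))
    isometry_coe_multiplier.continuous.continuousAt (hh.snd_apply hD (hf.1 b))

end StrictlyContinuousAt

theorem continuousAt_action (β : CStarAction G B) {g : X → G} {c : X → B} {x : X}
    (hg : ContinuousAt g x) (hc : ContinuousAt c x) :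
    ContinuousAt (fun y => β.toHom (g y) (c y)) x := by
  refine continuousAt_clm_apply (f := fun y => autCLM (β.toHom (g y))) (C := 1) (fun y => ?_)
    (ContinuousAt.comp (f := g) (β.continuous_apply (c x)).continuousAt hg) hc
  exact ContinuousLinearMap.opNorm_le_bound _ zero_le_one fun b => by simp [β.norm_apply]

theorem StrictlyContinuousAt.ext [IsTopologicalGroup G] (β : CStarAction G B) {g : X → G}
    {f : X → 𝓜(ℂ, B)} {x : X} {C : ℝ} (hg : ContinuousAt g x) (hf : StrictlyContinuousAt f x)
    (hC : ∀ y, ‖f y‖ ≤ C) : StrictlyContinuousAt (fun y => β.ext (g y) (f y)) x := by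
  constructor
  · intro b
    simp only [ext_fst_apply]
    exact continuousAt_action β hg (hf.fst_apply hC (continuousAt_action β hg.inv
      continuousAt_const))
  · intro b
    simp only [ext_snd_apply]
    exact continuousAt_action β hg (hf.snd_apply hC (continuousAt_action β hg.inv
      continuousAt_const))

end Multipliers

/-! ### Homotopies of Cuntz pairs as paths in `M(B)` -/

section Paths

variable {G A B : Type*} [Group G] [TopologicalSpace G] [NonUnitalCStarAlgebra A]
  [NonUnitalCStarAlgebra B]

/-- If `h s = 0`, then `(m h)* (m h) = h* (m* m h)` vanishes at `s`, hence so does `m h`. Thus `(m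
f) s` depends only on `f s`, which is why testing on constant functions defines a multiplicative
evaluation. -/
theorem eval_fst (s : I) (m : 𝓜(ℂ, C(I, B))) (f : C(I, B)) :
    (evalMultiplier s m).fst (f s) = (m.fst f) s := by
  have hvan : ∀ h : C(I, B), h s = 0 → (m.fst h) s = 0 := fun h hs => by
    have h1 : star (m.fst h) * m.fst h = star h * (star m).fst (m.fst h) := by
      have h2 : star (m.fst h) = (star m).snd (star h) := by simp
      rw [h2, (star m).central]
    have h3 := congrArg (fun k : C(I, B) => k s) h1
    simp only [ContinuousMap.mul_apply, ContinuousMap.star_apply, hs, star_zero, zero_mul] at h3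
    exact CStarRing.star_mul_self_eq_zero_iff _ |>.1 h3
  have h4 := hvan (ContinuousMap.const I (f s) - f) (by simp)
  rw [map_sub, ContinuousMap.sub_apply, sub_eq_zero] at h4
  exact h4

/-- Reduces every algebraic identity over `C([0,1], B)` to its fibres. -/
theorem eval_ext {m n : 𝓜(ℂ, C(I, B))} (h : ∀ s, evalMultiplier s m = evalMultiplier s n) :
    m = n := by
  refine multiplier_ext fun f => ContinuousMap.ext fun s => ?_
  rw [← eval_fst, ← eval_fst, h]

theorem eval_mul (s : I) (m n : 𝓜(ℂ, C(I, B))) :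
    evalMultiplier s (m * n) = evalMultiplier s m * evalMultiplier s n := by
  refine multiplier_ext fun b => ?_
  change (m.fst (n.fst (ContinuousMap.const I b))) s =
    (evalMultiplier s m).fst ((n.fst (ContinuousMap.const I b)) s)
  rw [eval_fst]

theorem eval_star (s : I) (m : 𝓜(ℂ, C(I, B))) :
    evalMultiplier s (star m) = star (evalMultiplier s m) := by
  refine multiplier_ext fun b => ?_
  rw [DoubleCentralizer.star_fst]
  change ((star m).fst (ContinuousMap.const I b)) s = star ((m.snd (ContinuousMap.const I (star b))) s)
  rw [DoubleCentralizer.star_fst]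
  rfl

theorem eval_add (s : I) (m n : 𝓜(ℂ, C(I, B))) :
    evalMultiplier s (m + n) = evalMultiplier s m + evalMultiplier s n :=
  multiplier_ext fun _ => rfl

theorem eval_sub (s : I) (m n : 𝓜(ℂ, C(I, B))) :
    evalMultiplier s (m - n) = evalMultiplier s m - evalMultiplier s n :=
  multiplier_ext fun _ => rfl

theorem eval_smul (s : I) (c : ℂ) (m : 𝓜(ℂ, C(I, B))) :
    evalMultiplier s (c • m) = c • evalMultiplier s m :=
  multiplier_ext fun _ => rfl

theorem eval_one (s : I) : evalMultiplier s (1 : 𝓜(ℂ, C(I, B))) = 1 :=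
  multiplier_ext fun _ => rfl

theorem eval_zero (s : I) : evalMultiplier s (0 : 𝓜(ℂ, C(I, B))) = 0 :=
  multiplier_ext fun _ => rfl

theorem eval_coe (s : I) (f : C(I, B)) :
    evalMultiplier s (DoubleCentralizer.coe ℂ f) = DoubleCentralizer.coe ℂ (f s) :=
  multiplier_ext fun _ => rfl

theorem eval_extAction (β : CStarAction G B) (s : I) (g : G) (m : 𝓜(ℂ, C(I, B))) :
    evalMultiplier s (β.path.ext g m) = β.ext g (evalMultiplier s m) := by
  refine multiplier_ext fun b => ?_
  rw [ext_fst_apply]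
  change ((β.path.ext g m).fst (ContinuousMap.const I b)) s = _
  rw [ext_fst_apply]
  change β.toHom g ((m.fst (β.path.toHom g⁻¹ (ContinuousMap.const I b))) s) = _
  rw [← eval_fst]
  rfl

/-- The multiplier of `C([0,1], B)` given by a bounded strictly continuous path in `M(B)`. -/
def pathMultiplier (F : I → 𝓜(ℂ, B)) (hF : StrictlyContinuous F) (C : ℝ) (hC : ∀ s, ‖F s‖ ≤ C) :
    𝓜(ℂ, C(I, B)) where
  fst := LinearMap.mkContinuous
    { toFun := fun f => ⟨fun s => (F s).fst (f s), continuous_iff_continuousAt.2 fun s =>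
        (hF.at s).fst_apply hC f.continuous.continuousAt⟩
      map_add' := fun f h => ContinuousMap.ext fun s => map_add (F s).fst (f s) (h s)
      map_smul' := fun c f => ContinuousMap.ext fun s => map_smul (F s).fst c (f s) } C
    fun f => (ContinuousMap.norm_le _ (mul_nonneg ((norm_nonneg _).trans (hC 0))
      (norm_nonneg f))).2 fun s => (norm_fst_apply_le _ _).trans
        (mul_le_mul (hC s) (f.norm_coe_le_norm s) (norm_nonneg _)
          ((norm_nonneg _).trans (hC 0)))
  snd := LinearMap.mkContinuous
    { toFun := fun f => ⟨fun s => (F s).snd (f s), continuous_iff_continuousAt.2 fun s =>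
        (hF.at s).snd_apply hC f.continuous.continuousAt⟩
      map_add' := fun f h => ContinuousMap.ext fun s => map_add (F s).snd (f s) (h s)
      map_smul' := fun c f => ContinuousMap.ext fun s => map_smul (F s).snd c (f s) } C
    fun f => (ContinuousMap.norm_le _ (mul_nonneg ((norm_nonneg _).trans (hC 0))
      (norm_nonneg f))).2 fun s => (norm_snd_apply_le _ _).trans
        (mul_le_mul (hC s) (f.norm_coe_le_norm s) (norm_nonneg _)
          ((norm_nonneg _).trans (hC 0)))
  central f h := ContinuousMap.ext fun s => (F s).central (f s) (h s)

theorem eval_pathMultiplier (F : I → 𝓜(ℂ, B)) (hF : StrictlyContinuous F) (C : ℝ)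
    (hC : ∀ s, ‖F s‖ ≤ C) (s : I) : evalMultiplier s (pathMultiplier F hF C hC) = F s :=
  multiplier_ext fun _ => rfl

variable {α : CStarAction G A} {β : CStarAction G B}

theorem CocycleRep.ext_iff' {x y : CocycleRep α β} : x = y ↔ (∀ a, x.φ a = y.φ a) ∧
    ∀ g, x.u g = y.u g := by
  refine ⟨fun h => by subst h; exact ⟨fun _ => rfl, fun _ => rfl⟩, fun h => ?_⟩
  obtain ⟨φ, u, _, _, _, _⟩ := x
  obtain ⟨ψ, v, _, _, _, _⟩ := y
  obtain rfl : φ = ψ := NonUnitalStarAlgHom.ext h.1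
  obtain rfl : u = v := funext h.2
  rfl

theorem CocycleRep.norm_φ_le (x : CocycleRep α β) (a : A) : ‖x.φ a‖ ≤ ‖a‖ :=
  NonUnitalStarAlgHom.norm_apply_le x.φ a

theorem CocycleRep.norm_u_le (x : CocycleRep α β) (g : G) : ‖x.u g‖ ≤ 1 :=
  norm_le_one_of_unitary (x.unitary_u g)

/-- A strictly continuous path of cocycle representations. -/
def IsRepPath (P : I → CocycleRep α β) : Prop :=
  (∀ a, StrictlyContinuous fun s => (P s).φ a) ∧
    StrictlyContinuous fun p : G × I => (P p.2).u p.1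

/-- A pair of paths of cocycle representations that defines a homotopy of Cuntz pairs. -/
structure IsHomotopy (P Q : I → CocycleRep α β) : Prop where
  left : IsRepPath P
  right : IsRepPath Q
  isCuntzPair : ∀ s, IsCuntzPair (P s) (Q s)
  continuous_φ : ∀ a, Continuous fun s => (P s).φ a - (Q s).φ a
  continuous_u : ∀ g, Continuous fun s => (P s).u g - (Q s).u g

theorem IsRepPath.strict_u {P : I → CocycleRep α β} (hP : IsRepPath P) (g : G) :
    StrictlyContinuous fun s => (P s).u g :=
  strictlyContinuous_iff.2 fun s =>
    (hP.2.at (g, s)).comp (k := fun s => (g, s)) (by fun_prop)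

/-- The cocycle representation over `β[0,1]` given by a path. -/
def IsRepPath.toRep {P : I → CocycleRep α β} (hP : IsRepPath P) : CocycleRep α β.path where
  φ :=
    { toFun := fun a => pathMultiplier (fun s => (P s).φ a) (hP.1 a) ‖a‖ fun s => (P s).norm_φ_le a
      map_smul' := fun c a => eval_ext fun s => by
        simp only [eval_pathMultiplier, MonoidHom.id_apply, eval_smul, map_smul]
      map_zero' := eval_ext fun s => by simp only [eval_pathMultiplier, eval_zero, map_zero]
      map_add' := fun a b => eval_ext fun s => by simp only [eval_pathMultiplier, eval_add, map_add]
      map_mul' := fun a b => eval_ext fun s => by simp only [eval_pathMultiplier, eval_mul, map_mul]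
      map_star' := fun a => eval_ext fun s => by
        simp only [eval_pathMultiplier, eval_star, map_star] }
  u g := pathMultiplier (fun s => (P s).u g) (hP.strict_u g) 1 fun s => (P s).norm_u_le g
  unitary_u g := by
    rw [Unitary.mem_iff]
    constructor <;> refine eval_ext fun s => ?_
    · rw [eval_mul, eval_star, eval_pathMultiplier, eval_one]
      exact (Unitary.mem_iff.1 ((P s).unitary_u g)).1
    · rw [eval_mul, eval_star, eval_pathMultiplier, eval_one]
      exact (Unitary.mem_iff.1 ((P s).unitary_u g)).2
  continuous_u := by
    constructor
    -- Norm continuity of `g ↦ u_g f` in `C([0,1], B)` follows from joint continuity in `(g, s)`;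
    -- for this reason `IsRepPath` asks for strict continuity on `G × I`.
    · refine fun f => ContinuousMap.continuous_of_continuous_uncurry _ ?_
      refine continuous_iff_continuousAt.2 fun p => ?_
      exact (hP.2.at p).fst_apply (fun p => (P p.2).norm_u_le p.1)
        (f.continuous.comp continuous_snd).continuousAt
    · refine fun f => ContinuousMap.continuous_of_continuous_uncurry _ ?_
      refine continuous_iff_continuousAt.2 fun p => ?_
      exact (hP.2.at p).snd_apply (fun p => (P p.2).norm_u_le p.1)
        (f.continuous.comp continuous_snd).continuousAt
  cocycle g h := eval_ext fun s => by
    simp only [eval_mul, eval_extAction, eval_pathMultiplier, (P s).cocycle]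
  covariant g a := eval_ext fun s => by
    simp only [eval_mul, eval_extAction, eval_star]
    exact (P s).covariant g a

theorem IsRepPath.eval_φ {P : I → CocycleRep α β} (hP : IsRepPath P) (s : I) (a : A) :
    evalMultiplier s (hP.toRep.φ a) = (P s).φ a :=
  multiplier_ext fun _ => rfl

theorem IsRepPath.eval_u {P : I → CocycleRep α β} (hP : IsRepPath P) (s : I) (g : G) :
    evalMultiplier s (hP.toRep.u g) = (P s).u g :=
  multiplier_ext fun _ => rfl

/-- As `B` sits isometrically in `M(B)`, a norm-continuous family of multipliers lying in `B` is an
element of `C([0,1], B)`. -/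
theorem inIdeal_of_eval {m : 𝓜(ℂ, C(I, B))} (h : ∀ s, InIdeal (evalMultiplier s m))
    (hc : Continuous fun s => evalMultiplier s m) : InIdeal m := by
  choose b hb using h
  have hbc : Continuous b := by
    refine isometry_coe_multiplier.isEmbedding.continuous_iff.2 ?_
    exact hc.congr hb
  refine ⟨⟨b, hbc⟩, eval_ext fun s => ?_⟩
  rw [eval_coe, hb]
  rfl

theorem IsHomotopy.homotopic {P Q : I → CocycleRep α β} (h : IsHomotopy P Q) {x y : CuntzPair α β}
    (h0 : P 0 = x.fst) (h0' : Q 0 = x.snd) (h1 : P 1 = y.fst) (h1' : Q 1 = y.snd) :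
    Homotopic x y := by
  refine ⟨⟨h.left.toRep, h.right.toRep, fun a => ?_, fun g => ?_⟩, ?_, ?_⟩
  · refine inIdeal_of_eval (fun s => ?_) ?_
    · rw [eval_sub, h.left.eval_φ, h.right.eval_φ]
      exact (h.isCuntzPair s).1 a
    · simpa only [eval_sub, h.left.eval_φ, h.right.eval_φ] using h.continuous_φ a
  · refine inIdeal_of_eval (fun s => ?_) ?_
    · rw [eval_sub, h.left.eval_u, h.right.eval_u]
      exact (h.isCuntzPair s).2 g
    · simpa only [eval_sub, h.left.eval_u, h.right.eval_u] using h.continuous_u g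
  · simp only [RestrictsTo, h.left.eval_φ, h.right.eval_φ, h.left.eval_u, h.right.eval_u, h0, h0',
      implies_true, and_self]
  · simp only [RestrictsTo, h.left.eval_φ, h.right.eval_φ, h.left.eval_u, h.right.eval_u, h1, h1',
      implies_true, and_self]

/-- The evaluation at `s` of a cocycle representation over `β[0,1]`. -/
def CocycleRep.evalAt (x : CocycleRep α β.path) (s : I) : CocycleRep α β where
  φ :=
    { toFun := fun a => evalMultiplier s (x.φ a)
      map_smul' := fun c a => by simp only [eval_smul, map_smul, MonoidHom.id_apply]
      map_zero' := by simp only [eval_zero, map_zero]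
      map_add' := fun a b => by simp only [eval_add, map_add]
      map_mul' := fun a b => by simp only [eval_mul, map_mul]
      map_star' := fun a => by simp only [eval_star, map_star] }
  u g := evalMultiplier s (x.u g)
  unitary_u g := by
    have h := Unitary.mem_iff.1 (x.unitary_u g)
    rw [Unitary.mem_iff, ← eval_star, ← eval_mul, ← eval_mul, h.1, h.2, eval_one]
    exact ⟨rfl, rfl⟩
  continuous_u := ⟨fun b => (ContinuousMap.evalCLM ℂ s).continuous.comp (x.continuous_u.1 _),
    fun b => (ContinuousMap.evalCLM ℂ s).continuous.comp (x.continuous_u.2 _)⟩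
  cocycle g h := by rw [x.cocycle, eval_mul, eval_extAction]
  covariant g a := by
    change _ * β.ext g (evalMultiplier s (x.φ a)) * _ = evalMultiplier s (x.φ _)
    rw [← x.covariant, eval_mul, eval_mul, eval_extAction, eval_star]

theorem CocycleRep.isRepPath_evalAt (x : CocycleRep α β.path) : IsRepPath x.evalAt := by
  refine ⟨fun a => ⟨fun b => ?_, fun b => ?_⟩, fun b => ?_, fun b => ?_⟩
  · exact ((x.φ a).fst (ContinuousMap.const I b)).continuous
  · exact ((x.φ a).snd (ContinuousMap.const I b)).continuous
  · have h := x.continuous_u.1 (ContinuousMap.const I b)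
    exact ContinuousEval.continuous_eval.comp ((h.comp continuous_fst).prodMk continuous_snd)
  · have h := x.continuous_u.2 (ContinuousMap.const I b)
    exact ContinuousEval.continuous_eval.comp ((h.comp continuous_fst).prodMk continuous_snd)

/-- Converse to `IsHomotopy.homotopic`. With both directions available, homotopies can be reversed,
concatenated and added as paths. -/
theorem Homotopic.exists_isHomotopy {x y : CuntzPair α β} (h : Homotopic x y) :
    ∃ P Q : I → CocycleRep α β, IsHomotopy P Q ∧ P 0 = x.fst ∧ Q 0 = x.snd ∧ P 1 = y.fst ∧
      Q 1 = y.snd := by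
  obtain ⟨X, h0, h1⟩ := h
  have key : ∀ m : 𝓜(ℂ, C(I, B)), InIdeal m → (∀ s, InIdeal (evalMultiplier s m)) ∧
      Continuous fun s => evalMultiplier s m := by
    rintro _ ⟨f, rfl⟩
    simp only [eval_coe]
    exact ⟨fun s => ⟨_, rfl⟩, isometry_coe_multiplier.continuous.comp f.continuous⟩
  refine ⟨X.fst.evalAt, X.snd.evalAt, ⟨X.fst.isRepPath_evalAt, X.snd.isRepPath_evalAt,
    fun s => ⟨fun a => (key _ (X.isCuntzPair.1 a)).1 s, fun g => (key _ (X.isCuntzPair.2 g)).1 s⟩,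
    fun a => (key _ (X.isCuntzPair.1 a)).2, fun g => (key _ (X.isCuntzPair.2 g)).2⟩, ?_, ?_, ?_, ?_⟩
  · exact CocycleRep.ext_iff'.2 ⟨h0.1, h0.2.1⟩
  · exact CocycleRep.ext_iff'.2 ⟨h0.2.2.1, h0.2.2.2⟩
  · exact CocycleRep.ext_iff'.2 ⟨h1.1, h1.2.1⟩
  · exact CocycleRep.ext_iff'.2 ⟨h1.2.2.1, h1.2.2.2⟩

theorem StrictlyContinuous.comp {X Y : Type*} [TopologicalSpace X] [TopologicalSpace Y]
    {f : X → 𝓜(ℂ, B)} (hf : StrictlyContinuous f) {k : Y → X} (hk : Continuous k) :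
    StrictlyContinuous fun y => f (k y) :=
  ⟨fun b => (hf.1 b).comp hk, fun b => (hf.2 b).comp hk⟩

theorem IsHomotopy.comp {P Q : I → CocycleRep α β} (h : IsHomotopy P Q) {k : I → I}
    (hk : Continuous k) : IsHomotopy (fun s => P (k s)) fun s => Q (k s) where
  left := ⟨fun a => (h.left.1 a).comp hk, h.left.2.comp (k := fun p : G × I => (p.1, k p.2))
    (by fun_prop)⟩
  right := ⟨fun a => (h.right.1 a).comp hk, h.right.2.comp (k := fun p : G × I => (p.1, k p.2))
    (by fun_prop)⟩
  isCuntzPair s := h.isCuntzPair _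
  continuous_φ a := (h.continuous_φ a).comp hk
  continuous_u g := (h.continuous_u g).comp hk

theorem Homotopic.symm {x y : CuntzPair α β} (h : Homotopic x y) : Homotopic y x := by
  obtain ⟨P, Q, hPQ, h0, h0', h1, h1'⟩ := h.exists_isHomotopy
  exact (hPQ.comp unitInterval.continuous_symm).homotopic (by simpa using h1) (by simpa using h1')
    (by simpa using h0) (by simpa using h0')

theorem continuous_ite_half {X Y : Type*} [TopologicalSpace X] [TopologicalSpace Y] {f h : X → Y}
    {r : X → I} (hr : Continuous r) (hf : Continuous f) (hh : Continuous h)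
    (he : ∀ x, (r x : ℝ) = 1 / 2 → f x = h x) :
    Continuous fun x => if (r x : ℝ) ≤ 1 / 2 then f x else h x :=
  Continuous.if_le hf hh (by fun_prop) continuous_const he

/-- The reparametrization of the first half of a concatenation. -/
def firstHalf (s : I) : I := Set.projIcc 0 1 zero_le_one (2 * (s : ℝ))

/-- The reparametrization of the second half of a concatenation. -/
def secondHalf (s : I) : I := Set.projIcc 0 1 zero_le_one (2 * (s : ℝ) - 1)

theorem continuous_firstHalf : Continuous firstHalf :=
  continuous_projIcc.comp (by fun_prop)

theorem continuous_secondHalf : Continuous secondHalf :=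
  continuous_projIcc.comp (by fun_prop)

theorem firstHalf_of_eq {s : I} (hs : (s : ℝ) = 1 / 2) : firstHalf s = 1 :=
  Set.projIcc_of_right_le _ (by rw [hs]; norm_num)

theorem secondHalf_of_eq {s : I} (hs : (s : ℝ) = 1 / 2) : secondHalf s = 0 :=
  Set.projIcc_of_le_left _ (by rw [hs]; norm_num)

theorem IsRepPath.concat {P P' : I → CocycleRep α β} (h : IsRepPath P) (h' : IsRepPath P')
    (hPP' : P 1 = P' 0) :
    IsRepPath fun s => if (s : ℝ) ≤ 1 / 2 then P (firstHalf s) else P' (secondHalf s) := by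
  have c1 := continuous_firstHalf
  have c2 := continuous_secondHalf
  refine ⟨fun a => ⟨fun b => ?_, fun b => ?_⟩, fun b => ?_, fun b => ?_⟩
  · refine (continuous_ite_half (r := fun s => s) continuous_id (((h.1 a).comp c1).1 b)
      (((h'.1 a).comp c2).1 b) fun s hs => ?_).congr fun s => by beta_reduce; split_ifs <;> rfl
    simp only [firstHalf_of_eq (s := s) hs, secondHalf_of_eq (s := s) hs, hPP']
  · refine (continuous_ite_half (r := fun s => s) continuous_id (((h.1 a).comp c1).2 b)
      (((h'.1 a).comp c2).2 b) fun s hs => ?_).congr fun s => by beta_reduce; split_ifs <;> rfl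
    simp only [firstHalf_of_eq (s := s) hs, secondHalf_of_eq (s := s) hs, hPP']
  · refine (continuous_ite_half (r := fun p : G × I => p.2) continuous_snd
      ((h.2.comp (k := fun p : G × I => (p.1, firstHalf p.2)) (by fun_prop)).1 b)
      ((h'.2.comp (k := fun p : G × I => (p.1, secondHalf p.2)) (by fun_prop)).1 b)
      fun s hs => ?_).congr fun s => by beta_reduce; split_ifs <;> rfl
    simp only [firstHalf_of_eq (s := s.2) hs, secondHalf_of_eq (s := s.2) hs, hPP']
  · refine (continuous_ite_half (r := fun p : G × I => p.2) continuous_snd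
      ((h.2.comp (k := fun p : G × I => (p.1, firstHalf p.2)) (by fun_prop)).2 b)
      ((h'.2.comp (k := fun p : G × I => (p.1, secondHalf p.2)) (by fun_prop)).2 b)
      fun s hs => ?_).congr fun s => by beta_reduce; split_ifs <;> rfl
    simp only [firstHalf_of_eq (s := s.2) hs, secondHalf_of_eq (s := s.2) hs, hPP']

theorem Homotopic.trans {x y z : CuntzPair α β} (hxy : Homotopic x y) (hyz : Homotopic y z) :
    Homotopic x z := by
  obtain ⟨P, Q, h, h0, h0', h1, h1'⟩ := hxy.exists_isHomotopy
  obtain ⟨P', Q', k, k0, k0', k1, k1'⟩ := hyz.exists_isHomotopy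
  have hP : P 1 = P' 0 := h1.trans k0.symm
  have hQ : Q 1 = Q' 0 := h1'.trans k0'.symm
  refine IsHomotopy.homotopic ⟨h.left.concat k.left hP, h.right.concat k.right hQ,
    fun s => ?_, fun a => ?_, fun g => ?_⟩ ?_ ?_ ?_ ?_
  · split_ifs
    exacts [h.isCuntzPair _, k.isCuntzPair _]
  · refine (continuous_ite_half (r := fun s => s) continuous_id ((h.continuous_φ a).comp continuous_firstHalf)
      ((k.continuous_φ a).comp continuous_secondHalf) fun s hs => ?_).congr fun s => by
        split_ifs <;> rfl
    simp only [Function.comp, firstHalf_of_eq (s := s) hs, secondHalf_of_eq (s := s) hs, hP, hQ]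
  · refine (continuous_ite_half (r := fun s => s) continuous_id ((h.continuous_u g).comp continuous_firstHalf)
      ((k.continuous_u g).comp continuous_secondHalf) fun s hs => ?_).congr fun s => by
        split_ifs <;> rfl
    simp only [Function.comp, firstHalf_of_eq (s := s) hs, secondHalf_of_eq (s := s) hs, hP, hQ]
  all_goals
    norm_num [firstHalf, secondHalf]
    assumption

theorem IsRepPath.const (x : CocycleRep α β) : IsRepPath fun _ => x :=
  ⟨fun _ => ⟨fun _ => continuous_const, fun _ => continuous_const⟩, x.continuous_u.comp continuous_fst⟩

theorem IsHomotopy.const {x y : CocycleRep α β} (h : IsCuntzPair x y) :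
    IsHomotopy (fun _ => x) fun _ => y :=
  ⟨.const x, .const y, fun _ => h, fun _ => continuous_const, fun _ => continuous_const⟩

theorem Homotopic.refl (x : CuntzPair α β) : Homotopic x x :=
  (IsHomotopy.const x.isCuntzPair).homotopic rfl rfl rfl rfl

theorem IsRepPath.zeroPart {P : I → CocycleRep α β} (h : IsRepPath P) :
    IsRepPath fun s => (P s).zeroPart :=
  ⟨fun _ => ⟨fun _ => continuous_const, fun _ => continuous_const⟩, h.2⟩

/-- Hence being anchored is a homotopy invariant. -/
theorem Homotopic.cocyclePair {x y : CuntzPair α β} (h : Homotopic x y) :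
    Homotopic x.cocyclePair y.cocyclePair := by
  obtain ⟨P, Q, h, h0, h0', h1, h1'⟩ := h.exists_isHomotopy
  refine IsHomotopy.homotopic (P := fun s => (P s).zeroPart) (Q := fun s => (Q s).zeroPart)
    ⟨h.left.zeroPart, h.right.zeroPart, fun s => ⟨fun a => ?_, (h.isCuntzPair s).2⟩,
      fun a => ?_, h.continuous_u⟩
    (congrArg CocycleRep.zeroPart h0) (congrArg CocycleRep.zeroPart h0')
    (congrArg CocycleRep.zeroPart h1) (congrArg CocycleRep.zeroPart h1')
  · simpa [CocycleRep.zeroPart] using InIdeal.zero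
  · simpa [CocycleRep.zeroPart] using continuous_const

theorem IsRepPath.sumRep (t : CuntzIsometries β) {P P' : I → CocycleRep α β} (h : IsRepPath P)
    (h' : IsRepPath P') : IsRepPath fun s => t.sumRep (P s) (P' s) := by
  refine ⟨fun a => ⟨fun b => ?_, fun b => ?_⟩, fun b => ?_, fun b => ?_⟩
  · exact (t.t₁.fst.continuous.comp ((h.1 a).1 _)).add (t.t₂.fst.continuous.comp ((h'.1 a).1 _))
  · exact ((star t.t₁).snd.continuous.comp ((h.1 a).2 _)).add
      ((star t.t₂).snd.continuous.comp ((h'.1 a).2 _))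
  · exact (t.t₁.fst.continuous.comp (h.2.1 _)).add (t.t₂.fst.continuous.comp (h'.2.1 _))
  · exact ((star t.t₁).snd.continuous.comp (h.2.2 _)).add
      ((star t.t₂).snd.continuous.comp (h'.2.2 _))

theorem CuntzIsometries.continuous_sum (t : CuntzIsometries β) {X : Type*} [TopologicalSpace X]
    {f h : X → 𝓜(ℂ, B)} (hf : Continuous f) (hh : Continuous h) :
    Continuous fun x => t.sum (f x) (h x) := by
  unfold CuntzIsometries.sum
  fun_prop

theorem Homotopic.sum (t : CuntzIsometries β) {x y x' y' : CuntzPair α β} (h : Homotopic x y)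
    (h' : Homotopic x' y') : Homotopic (CuntzPair.sum t x x') (CuntzPair.sum t y y') := by
  obtain ⟨P, Q, h, h0, h0', h1, h1'⟩ := h.exists_isHomotopy
  obtain ⟨P', Q', k, k0, k0', k1, k1'⟩ := h'.exists_isHomotopy
  refine IsHomotopy.homotopic (P := fun s => t.sumRep (P s) (P' s))
    (Q := fun s => t.sumRep (Q s) (Q' s))
    ⟨h.left.sumRep t k.left, h.right.sumRep t k.right, fun s =>
      (CuntzPair.sum t ⟨P s, Q s, h.isCuntzPair s⟩ ⟨P' s, Q' s, k.isCuntzPair s⟩).isCuntzPair,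
      fun a => ?_, fun g => ?_⟩
    (by rw [h0, k0]; rfl) (by rw [h0', k0']; rfl) (by rw [h1, k1]; rfl) (by rw [h1', k1']; rfl)
  · exact (t.continuous_sum (h.continuous_φ a) (k.continuous_φ a)).congr fun s =>
      (t.sum_sub_sum _ _ _ _).symm
  · exact (t.continuous_sum (h.continuous_u g) (k.continuous_u g)).congr fun s =>
      (t.sum_sub_sum _ _ _ _).symm

end Paths

/-! ### Conjugation and asymptotic equivalence -/

section AsymptoticEquivalence

variable {G A B : Type*} [Group G] [TopologicalSpace G] [NonUnitalCStarAlgebra A]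
  [NonUnitalCStarAlgebra B] {α : CStarAction G A} {β : CStarAction G B}

theorem norm_mul_mul_le {x y : 𝓜(ℂ, B)} (hx : ‖x‖ ≤ 1) (hy : ‖y‖ ≤ 1) (m : 𝓜(ℂ, B)) :
    ‖x * m * y‖ ≤ ‖m‖ := by
  refine (norm_mul_le _ _).trans ?_
  refine (mul_le_of_le_one_right (norm_nonneg _) hy).trans ((norm_mul_le _ _).trans ?_)
  exact mul_le_of_le_one_left (norm_nonneg _) hx

theorem StrictlyContinuousAt.sandwich {X : Type*} [TopologicalSpace X] {w f v : X → 𝓜(ℂ, B)}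
    {x : X} {C D E : ℝ} (hw : StrictlyContinuousAt w x) (hf : StrictlyContinuousAt f x)
    (hv : StrictlyContinuousAt v x) (hC : ∀ y, ‖w y‖ ≤ C) (hD : ∀ y, ‖f y‖ ≤ D)
    (hE : ∀ y, ‖v y‖ ≤ E) : StrictlyContinuousAt (fun y => w y * f y * star (v y)) x :=
  (hw.mul hf hC hD).mul hv.star (C := C * D) (D := E)
    (fun y => (norm_mul_le _ _).trans
      (mul_le_mul (hC y) (hD y) (norm_nonneg _) ((norm_nonneg _).trans (hC y))))
    (fun y => by rw [norm_star]; exact hE y)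

section Conj

variable [IsTopologicalGroup G]

/-- The conjugate of a cocycle representation by a unitary multiplier. -/
def CocycleRep.conj (x : CocycleRep α β) (w : 𝓜(ℂ, B)) (hw : w ∈ unitary 𝓜(ℂ, B)) :
    CocycleRep α β where
  φ :=
    { toFun := fun a => w * x.φ a * star w
      map_smul' := fun c a => by simp
      map_zero' := by simp
      map_add' := fun a b => by rw [map_add, mul_add, add_mul]
      map_mul' := fun a b => by
        have h : w * x.φ a * star w * (w * x.φ b * star w) =
            w * x.φ a * (star w * w) * x.φ b * star w := by noncomm_ring
        rw [h, (Unitary.mem_iff.1 hw).1, map_mul, mul_one, ← mul_assoc w]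
      map_star' := fun a => by simp [mul_assoc, map_star] }
  u g := w * x.u g * star (β.ext g w)
  unitary_u g := mul_mem (mul_mem hw (x.unitary_u g)) (Unitary.star_mem (ext_mem_unitary β g hw))
  continuous_u := strictlyContinuous_iff.2 fun g => by
    have hw1 := norm_le_one_of_unitary hw
    exact (StrictlyContinuousAt.const w).sandwich (x.continuous_u.at g)
      ((StrictlyContinuousAt.const w).ext β continuousAt_id fun _ => le_rfl)
      (fun _ => hw1) x.norm_u_le (fun g => (norm_ext_le β g w).trans hw1)
  cocycle g h := by
    have h1 : star (β.ext g w) * β.ext g w = 1 :=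
      (Unitary.mem_iff.1 (ext_mem_unitary β g hw)).1
    have h2 : w * x.u g * star (β.ext g w) * β.ext g (w * x.u h * star (β.ext h w)) =
        w * x.u g * (star (β.ext g w) * β.ext g w) * β.ext g (x.u h) *
          star (β.ext g (β.ext h w)) := by
      simp only [map_mul, map_star]; noncomm_ring
    rw [h2, h1, x.cocycle, ext_mul_apply, mul_one, ← mul_assoc w]
  covariant g a := by
    change w * x.u g * star (β.ext g w) * β.ext g (w * x.φ a * star w) *
      star (w * x.u g * star (β.ext g w)) = w * x.φ (α.toHom g a) * star w
    have h1 : star (β.ext g w) * β.ext g w = 1 :=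
      (Unitary.mem_iff.1 (ext_mem_unitary β g hw)).1
    have h2 : w * x.u g * star (β.ext g w) * β.ext g (w * x.φ a * star w) *
        star (w * x.u g * star (β.ext g w)) = w * x.u g * (star (β.ext g w) * β.ext g w) *
          β.ext g (x.φ a) * (star (β.ext g w) * β.ext g w) * star (x.u g) * star w := by
      simp only [map_mul, map_star, star_mul, star_star]; noncomm_ring
    rw [h2, h1, ← x.covariant]
    noncomm_ring

theorem CocycleRep.conj_φ (x : CocycleRep α β) {w : 𝓜(ℂ, B)} (hw : w ∈ unitary 𝓜(ℂ, B)) (a : A) :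
    (x.conj w hw).φ a = w * x.φ a * star w :=
  rfl

theorem CocycleRep.conj_u (x : CocycleRep α β) {w : 𝓜(ℂ, B)} (hw : w ∈ unitary 𝓜(ℂ, B)) (g : G) :
    (x.conj w hw).u g = w * x.u g * star (β.ext g w) :=
  rfl

theorem IsCuntzPair.conj {x y : CocycleRep α β} (h : IsCuntzPair x y) {w : 𝓜(ℂ, B)}
    (hw : w ∈ unitary 𝓜(ℂ, B)) : IsCuntzPair (x.conj w hw) (y.conj w hw) := by
  constructor
  · intro a
    rw [CocycleRep.conj_φ, CocycleRep.conj_φ, ← sub_mul, ← mul_sub]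
    exact (h.1 a).mul_mul _ _
  · intro g
    rw [CocycleRep.conj_u, CocycleRep.conj_u, ← sub_mul, ← mul_sub]
    exact (h.2 g).mul_mul _ _

theorem CocycleRep.asymptoticEquiv_conj (x : CocycleRep α β) {w : 𝓜(ℂ, B)}
    (hw : w ∈ unitary 𝓜(ℂ, B)) : AsymptoticEquiv x (x.conj w hw) := by
  refine ⟨fun _ => w, continuousOn_const, fun _ _ => hw, fun a => tendsto_const_nhds,
    fun a t _ => ?_, fun K _ => ?_, fun g t _ => ?_⟩
  · rw [CocycleRep.conj_φ, sub_self]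
    exact InIdeal.zero
  · refine Metric.tendstoUniformlyOn_iff.2 fun ε hε => Eventually.of_forall fun t g _ => ?_
    rw [CocycleRep.conj_u, dist_self]
    exact hε
  · rw [CocycleRep.conj_u, sub_self]
    exact InIdeal.zero

end Conj

theorem asymptoticEquiv_iff {x y : CocycleRep α β} : AsymptoticEquiv x y ↔
    ∃ w : ℝ → 𝓜(ℂ, B), ContinuousOn w (Set.Ici 1) ∧ (∀ t, 1 ≤ t → w t ∈ unitary 𝓜(ℂ, B)) ∧
    (∀ a, ∀ ε > 0, ∀ᶠ t in atTop, ‖y.φ a - w t * x.φ a * star (w t)‖ < ε) ∧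
    (∀ a t, 1 ≤ t → InIdeal (y.φ a - w t * x.φ a * star (w t))) ∧
    (∀ K : Set G, IsCompact K → ∀ ε > 0, ∀ᶠ t in atTop, ∀ g ∈ K,
      ‖y.u g - w t * x.u g * star (β.ext g (w t))‖ < ε) ∧
    (∀ g t, 1 ≤ t → InIdeal (y.u g - w t * x.u g * star (β.ext g (w t)))) := by
  simp only [AsymptoticEquiv, Metric.tendstoUniformlyOn_iff, Metric.tendsto_nhds, dist_eq_norm]
  simp only [norm_sub_rev (_ * _)]

theorem AsymptoticEquiv.symm {x y : CocycleRep α β} (h : AsymptoticEquiv x y) :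
    AsymptoticEquiv y x := by
  obtain ⟨w, hc, hw, h1, h2, h3, h4⟩ := asymptoticEquiv_iff.1 h
  -- Here `v` stands for `w` in the statements about `φ` and for `β_g(w)` in those about the
  -- cocycle, so one identity serves both.
  have key : ∀ m n w v : 𝓜(ℂ, B), w ∈ unitary 𝓜(ℂ, B) → v ∈ unitary 𝓜(ℂ, B) →
      m - star w * n * star (star v) = -(star w * (n - w * m * star v) * v) := by
    intro m n w v hw hv
    have e : -(star w * (n - w * m * star v) * v) =
        star w * w * m * (star v * v) - star w * n * v := by noncomm_ring
    rw [e, (Unitary.mem_iff.1 hw).1, (Unitary.mem_iff.1 hv).1, star_star, one_mul, mul_one]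
  have hn : ∀ t, 1 ≤ t → ‖star (w t)‖ ≤ 1 := fun t ht => by
    rw [norm_star]; exact norm_le_one_of_unitary (hw t ht)
  refine asymptoticEquiv_iff.2 ⟨fun t => star (w t), hc.star, fun t ht =>
    Unitary.star_mem (hw t ht), fun a ε hε => ?_, fun a t ht => ?_, fun K hK ε hε => ?_,
    fun g t ht => ?_⟩
  · filter_upwards [h1 a ε hε, eventually_ge_atTop 1] with t ht ht1
    rw [key _ _ _ _ (hw t ht1) (hw t ht1), norm_neg]
    exact (norm_mul_mul_le (hn t ht1) (norm_le_one_of_unitary (hw t ht1)) _).trans_lt ht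
  · rw [key _ _ _ _ (hw t ht) (hw t ht)]
    exact ((h2 a t ht).mul_mul _ _).neg
  · filter_upwards [h3 K hK ε hε, eventually_ge_atTop 1] with t ht ht1 g hg
    rw [map_star, key _ _ _ _ (hw t ht1) (ext_mem_unitary β g (hw t ht1)), norm_neg]
    exact (norm_mul_mul_le (hn t ht1) (norm_le_one_of_unitary
      (ext_mem_unitary β g (hw t ht1))) _).trans_lt (ht g hg)
  · rw [map_star, key _ _ _ _ (hw t ht) (ext_mem_unitary β g (hw t ht))]
    exact ((h4 g t ht).mul_mul _ _).neg

theorem AsymptoticEquiv.trans {x y z : CocycleRep α β} (h : AsymptoticEquiv x y)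
    (h' : AsymptoticEquiv y z) : AsymptoticEquiv x z := by
  obtain ⟨w, hc, hw, h1, h2, h3, h4⟩ := asymptoticEquiv_iff.1 h
  obtain ⟨w', hc', hw', h1', h2', h3', h4'⟩ := asymptoticEquiv_iff.1 h'
  -- The error of the composed path is the second error plus the first one multiplied by unitaries:
  -- small when both are, and in `B` when both are.
  have key : ∀ m n k w v w' v' : 𝓜(ℂ, B), k - w' * w * m * star (v' * v) =
      (k - w' * n * star v') + w' * (n - w * m * star v) * star v' := by
    intro m n k w v w' v'
    rw [star_mul]
    noncomm_ring
  refine asymptoticEquiv_iff.2 ⟨fun t => w' t * w t, hc'.mul hc, fun t ht =>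
    mul_mem (hw' t ht) (hw t ht), fun a ε hε => ?_, fun a t ht => ?_, fun K hK ε hε => ?_,
    fun g t ht => ?_⟩
  · filter_upwards [h1 a _ (half_pos hε), h1' a _ (half_pos hε), eventually_ge_atTop 1]
      with t ht ht' ht1
    rw [key (x.φ a) (y.φ a)]
    have hn := norm_le_one_of_unitary (hw' t ht1)
    have := norm_mul_mul_le hn ((norm_star _).trans_le hn) (y.φ a - w t * x.φ a * star (w t))
    exact (norm_add_le _ _).trans_lt (by linarith)
  · rw [key (x.φ a) (y.φ a)]
    exact (h2' a t ht).add ((h2 a t ht).mul_mul _ _)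
  · filter_upwards [h3 K hK _ (half_pos hε), h3' K hK _ (half_pos hε), eventually_ge_atTop 1]
      with t ht ht' ht1 g hg
    rw [map_mul, key (x.u g) (y.u g)]
    have hn := norm_le_one_of_unitary (hw' t ht1)
    have hn' := norm_le_one_of_unitary (ext_mem_unitary β g (hw' t ht1))
    have := norm_mul_mul_le hn ((norm_star _).trans_le hn')
      (y.u g - w t * x.u g * star (β.ext g (w t)))
    have := ht g hg
    have := ht' g hg
    exact (norm_add_le _ _).trans_lt (by linarith)
  · rw [map_mul, key (x.u g) (y.u g)]
    exact (h4' g t ht).add ((h4 g t ht).mul_mul _ _)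

namespace CuntzIsometries

variable (t : CuntzIsometries β)

theorem sumRep_φ (x y : CocycleRep α β) (a : A) : (t.sumRep x y).φ a = t.sum (x.φ a) (y.φ a) :=
  rfl

theorem sumRep_u (x y : CocycleRep α β) (g : G) : (t.sumRep x y).u g = t.sum (x.u g) (y.u g) :=
  rfl

theorem sum_mem_unitary {x y : 𝓜(ℂ, B)} (hx : x ∈ unitary 𝓜(ℂ, B)) (hy : y ∈ unitary 𝓜(ℂ, B)) :
    t.sum x y ∈ unitary 𝓜(ℂ, B) := by
  rw [Unitary.mem_iff] at *
  rw [star_sum, sum_mul_sum, sum_mul_sum, hx.1, hx.2, hy.1, hy.2, sum_one_one]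
  exact ⟨rfl, rfl⟩

theorem norm_sum_zero_le (x : 𝓜(ℂ, B)) : ‖t.sum x 0‖ ≤ ‖x‖ := by
  have h := norm_le_one_of_isometry t.isometry₁
  simpa [sum] using norm_mul_mul_le h ((norm_star _).trans_le h) x

end CuntzIsometries

/-- The path `w_t ⊕ 1` does it; its error is `(error of w_t) ⊕ 0`. -/
theorem AsymptoticEquiv.sumRep_right {x y : CocycleRep α β} (h : AsymptoticEquiv x y)
    (t : CuntzIsometries β) (z : CocycleRep α β) :
    AsymptoticEquiv (t.sumRep x z) (t.sumRep y z) := by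
  obtain ⟨w, hc, hw, h1, h2, h3, h4⟩ := asymptoticEquiv_iff.1 h
  have key : ∀ m n k w v : 𝓜(ℂ, B), t.sum n k - t.sum w 1 * t.sum m k * star (t.sum v 1) =
      t.sum (n - w * m * star v) 0 := by
    intro m n k w v
    rw [t.star_sum, t.sum_mul_sum, t.sum_mul_sum, t.sum_sub_sum]
    simp
  have hext : ∀ g m, β.ext g (t.sum m 1) = t.sum (β.ext g m) 1 := fun g m => by
    rw [t.ext_sum, map_one]
  refine asymptoticEquiv_iff.2 ⟨fun r => t.sum (w r) 1, ?_, fun r hr =>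
    t.sum_mem_unitary (hw r hr) (one_mem _), fun a ε hε => ?_, fun a r hr => ?_,
    fun K hK ε hε => ?_, fun g r hr => ?_⟩
  · unfold CuntzIsometries.sum
    exact ((continuousOn_const.mul hc).mul continuousOn_const).add continuousOn_const
  · filter_upwards [h1 a ε hε] with r hr
    rw [t.sumRep_φ, t.sumRep_φ, key]
    exact (t.norm_sum_zero_le _).trans_lt hr
  · rw [t.sumRep_φ, t.sumRep_φ, key]
    exact t.inIdeal_sum (h2 a r hr) InIdeal.zero
  · filter_upwards [h3 K hK ε hε] with r hr g hg
    rw [t.sumRep_u, t.sumRep_u, hext, key]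
    exact (t.norm_sum_zero_le _).trans_lt (hr g hg)
  · rw [t.sumRep_u, t.sumRep_u, hext, key]
    exact t.inIdeal_sum (h4 g r hr) InIdeal.zero

/-- Because `y ⊕ z ∼ x ⊕ z ∼ x ∼ y`. -/
theorem IsAbsorbing.of_asymptoticEquiv {x y : CocycleRep α β} (hx : IsAbsorbing x)
    (h : AsymptoticEquiv x y) : IsAbsorbing y := fun z => by
  obtain ⟨t, ht⟩ := hx z
  exact ⟨t, ((h.symm.sumRep_right t z).trans ht).trans h⟩

namespace CuntzIsometries

variable (s t : CuntzIsometries β)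

/-- The unitary that exchanges the summands of two Cuntz sums. -/
def swap : 𝓜(ℂ, B) := t.t₁ * star s.t₂ + t.t₂ * star s.t₁

theorem swap_mul_sum (x y : 𝓜(ℂ, B)) :
    swap s t * s.sum y x = t.t₁ * x * star s.t₂ + t.t₂ * y * star s.t₁ := by
  have h : swap s t * s.sum y x = t.t₁ * (star s.t₂ * s.t₁) * y * star s.t₁ +
      t.t₁ * (star s.t₂ * s.t₂) * x * star s.t₂ + t.t₂ * (star s.t₁ * s.t₁) * y * star s.t₁ +
      t.t₂ * (star s.t₁ * s.t₂) * x * star s.t₂ := by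
    unfold swap sum; noncomm_ring
  rw [h, s.isometry₁, s.isometry₂, s.orth₁₂, s.orth₂₁]
  noncomm_ring

theorem swap_conj (x y : 𝓜(ℂ, B)) :
    swap s t * s.sum y x * star (swap s t) = t.sum x y := by
  have h : (t.t₁ * x * star s.t₂ + t.t₂ * y * star s.t₁) * star (swap s t) =
      t.t₁ * x * (star s.t₂ * s.t₂) * star t.t₁ + t.t₁ * x * (star s.t₂ * s.t₁) * star t.t₂ +
      t.t₂ * y * (star s.t₁ * s.t₂) * star t.t₁ + t.t₂ * y * (star s.t₁ * s.t₁) * star t.t₂ := by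
    simp only [swap, star_add, star_mul, star_star]; noncomm_ring
  rw [swap_mul_sum, h, s.isometry₁, s.isometry₂, s.orth₁₂, s.orth₂₁]
  unfold sum
  noncomm_ring

theorem star_swap : star (swap s t) = swap t s := by
  simp only [swap, star_add, star_mul, star_star]
  exact add_comm _ _

theorem swap_mem_unitary : swap s t ∈ unitary 𝓜(ℂ, B) := by
  rw [Unitary.mem_iff]
  have h1 := swap_conj s t 1 1
  have h2 := swap_conj t s 1 1
  rw [sum_one_one, sum_one_one, mul_one, star_swap] at h1 h2
  rw [star_swap]
  exact ⟨h2, h1⟩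

theorem ext_swap (g : G) : β.ext g (swap s t) = swap s t := by
  simp only [swap, map_add, map_mul, map_star, s.fixed₁, s.fixed₂, t.fixed₁, t.fixed₂]

/-- The swap unitary is `β`-invariant, so it conjugates one sum exactly into the other. Allowing
different isometries on the two sides makes the result independent of the pair that absorption
happens to provide. -/
theorem asymptoticEquiv_sumRep_comm [IsTopologicalGroup G] (x y : CocycleRep α β) :
    AsymptoticEquiv (t.sumRep x y) (s.sumRep y x) := by
  have h : t.sumRep x y = (s.sumRep y x).conj (swap s t) (swap_mem_unitary s t) := by
    refine CocycleRep.ext_iff'.2 ⟨fun a => ?_, fun g => ?_⟩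
    · rw [CocycleRep.conj_φ, sumRep_φ, sumRep_φ, swap_conj]
    · rw [CocycleRep.conj_u, sumRep_u, sumRep_u, ext_swap, swap_conj]
  rw [h]
  exact (CocycleRep.asymptoticEquiv_conj _ _).symm

end CuntzIsometries

end AsymptoticEquivalence

/-! ### Compression along paths of invariant isometries -/

section IsometryPaths

variable {G A B : Type*} [Group G] [TopologicalSpace G] [NonUnitalCStarAlgebra A]
  [NonUnitalCStarAlgebra B] {α : CStarAction G A} {β : CStarAction G B}

/-- For an isometry `X`, the element `X m X* + (1 - X X*)`. -/
def corner (X m : 𝓜(ℂ, B)) : 𝓜(ℂ, B) := X * m * star X + (1 - X * star X)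

theorem corner_zero_left (m : 𝓜(ℂ, B)) : corner 0 m = 1 := by simp [corner]

theorem corner_one_left (m : 𝓜(ℂ, B)) : corner 1 m = m := by simp [corner]

theorem corner_one_right (X : 𝓜(ℂ, B)) : corner X 1 = 1 := by simp [corner]

theorem star_corner (X m : 𝓜(ℂ, B)) : star (corner X m) = corner X (star m) := by
  simp [corner, mul_assoc]

theorem corner_sub_corner (X m n : 𝓜(ℂ, B)) : corner X m - corner X n = X * (m - n) * star X := by
  unfold corner; noncomm_ring

/-- The case `X = 0` is admitted because one of the paths below ends there; compression then gives
the representation `(0, 1)`. -/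
theorem sandwich_mul_sandwich {X : 𝓜(ℂ, B)} (hX : star X * X = 1 ∨ X = 0) (m n : 𝓜(ℂ, B)) :
    X * m * star X * (X * n * star X) = X * (m * n) * star X := by
  obtain hX | rfl := hX
  · have h : X * m * star X * (X * n * star X) = X * m * (star X * X) * n * star X := by
      noncomm_ring
    rw [h, hX, mul_one, ← mul_assoc X]
  · simp

theorem corner_mul_sandwich {X : 𝓜(ℂ, B)} (hX : star X * X = 1 ∨ X = 0) (m n : 𝓜(ℂ, B)) :
    corner X m * (X * n * star X) = X * (m * n) * star X := by
  have h : corner X m * (X * n * star X) = X * m * star X * (X * n * star X) +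
      X * n * star X - X * 1 * star X * (X * n * star X) := by unfold corner; noncomm_ring
  rw [h, sandwich_mul_sandwich hX, sandwich_mul_sandwich hX, one_mul, add_sub_cancel_right]

theorem corner_mul_corner {X : 𝓜(ℂ, B)} (hX : star X * X = 1 ∨ X = 0) (m n : 𝓜(ℂ, B)) :
    corner X m * corner X n = corner X (m * n) := by
  have h : corner X m * corner X n = corner X m * (X * n * star X) +
      corner X m - corner X m * (X * 1 * star X) := by
    conv_lhs => rw [corner.eq_def X n]
    noncomm_ring
  rw [h, corner_mul_sandwich hX, corner_mul_sandwich hX]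
  unfold corner; noncomm_ring

theorem corner_mem_unitary {X : 𝓜(ℂ, B)} (hX : star X * X = 1 ∨ X = 0) {m : 𝓜(ℂ, B)}
    (hm : m ∈ unitary 𝓜(ℂ, B)) : corner X m ∈ unitary 𝓜(ℂ, B) := by
  rw [Unitary.mem_iff] at *
  rw [star_corner, corner_mul_corner hX, corner_mul_corner hX, hm.1, hm.2, corner_one_right]
  exact ⟨rfl, rfl⟩

theorem ext_corner {X : 𝓜(ℂ, B)} {g : G} (hX : β.ext g X = X) (m : 𝓜(ℂ, B)) :
    β.ext g (corner X m) = corner X (β.ext g m) := by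
  simp only [corner, map_add, map_sub, map_mul, map_star, map_one, hX]

/-- The compression `(X φ X*, X u X* + (1 - X X*))` of `(φ, u)` by an invariant isometry `X`
(or by `X = 0`). -/
def CocycleRep.compress (x : CocycleRep α β) (X : 𝓜(ℂ, B)) (hX : star X * X = 1 ∨ X = 0)
    (hfix : ∀ g, β.ext g X = X) : CocycleRep α β where
  φ :=
    { toFun := fun a => X * x.φ a * star X
      map_smul' := fun c a => by simp
      map_zero' := by simp
      map_add' := fun a b => by rw [map_add, mul_add, add_mul]
      map_mul' := fun a b => by rw [sandwich_mul_sandwich hX, map_mul]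
      map_star' := fun a => by simp [mul_assoc, map_star] }
  u g := corner X (x.u g)
  unitary_u g := corner_mem_unitary hX (x.unitary_u g)
  continuous_u := by
    refine ⟨fun b => ?_, fun b => ?_⟩
    · exact (X.fst.continuous.comp (x.continuous_u.1 ((star X).fst b))).add continuous_const
    · exact ((star X).snd.continuous.comp (x.continuous_u.2 (X.snd b))).add continuous_const
  cocycle g h := by rw [ext_corner (hfix g), corner_mul_corner hX, x.cocycle]
  covariant g a := by
    change corner X (x.u g) * β.ext g (X * x.φ a * star X) * star (corner X (x.u g)) =
      X * x.φ (α.toHom g a) * star X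
    have h : ∀ m, X * m * star X * corner X (star (x.u g)) = X * (m * star (x.u g)) * star X := by
      intro m
      simpa [star_corner, mul_assoc] using congrArg star (corner_mul_sandwich hX (x.u g) (star m))
    rw [map_mul, map_mul, map_star, hfix, corner_mul_sandwich hX, star_corner, h, x.covariant]

theorem norm_le_one_of_isometry_or_zero {X : 𝓜(ℂ, B)} (hX : star X * X = 1 ∨ X = 0) :
    ‖X‖ ≤ 1 := by
  obtain hX | rfl := hX
  · exact norm_le_one_of_isometry hX
  · simp

theorem isRepPath_conj [IsTopologicalGroup G] (x : CocycleRep α β) {W : I → 𝓜(ℂ, B)}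
    (hW : StrictlyContinuous W) (hu : ∀ s, W s ∈ unitary 𝓜(ℂ, B)) :
    IsRepPath fun s => x.conj (W s) (hu s) := by
  have hn : ∀ s, ‖W s‖ ≤ 1 := fun s => norm_le_one_of_unitary (hu s)
  have hW' : ∀ p : G × I, StrictlyContinuousAt (fun p : G × I => W p.2) p :=
    fun p => (hW.at p.2).comp (k := fun p : G × I => p.2) continuousAt_snd
  exact ⟨fun a => strictlyContinuous_iff.2 fun s =>
      (hW.at s).sandwich (StrictlyContinuousAt.const (x.φ a)) (hW.at s) hn (fun _ => le_rfl) hn,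
    strictlyContinuous_iff.2 fun p =>
      (hW' p).sandwich ((x.continuous_u.at p.1).comp continuousAt_fst)
        ((hW' p).ext β continuousAt_fst fun p => hn p.2) (fun p => hn p.2)
        (fun p => x.norm_u_le p.1) fun p => (norm_ext_le _ _ _).trans (hn p.2)⟩

/-- A path in `M(B)^β` of isometries, that may degenerate to zero, for a topology that makes all
compressions strictly continuous. -/
structure IsometryPath (β : CStarAction G B) where
  toFun : I → 𝓜(ℂ, B)
  fixed : ∀ s g, β.ext g (toFun s) = toFun s
  isometry_or_zero : ∀ s, star (toFun s) * toFun s = 1 ∨ toFun s = 0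
  continuous_star : ∀ s b, ContinuousAt (fun s => (star (toFun s)).fst b) s
  continuousAt_of_ne : ∀ s, toFun s ≠ 0 → StrictlyContinuousAt toFun s

namespace IsometryPath

variable (X : IsometryPath β)

theorem norm_le (s : I) : ‖X.toFun s‖ ≤ 1 := norm_le_one_of_isometry_or_zero (X.isometry_or_zero s)

/-- Where the path hits `0` it need not be strictly continuous, since nearby isometries preserve
`‖b‖`. But `X* b → 0` there, and as `X*` stands on the right of `f`, this is enough for `X f X*` to
tend strictly to `0`. -/
theorem sandwich {Y : Type*} [TopologicalSpace Y] {k : Y → I} {f : Y → 𝓜(ℂ, B)} {y : Y} {C : ℝ}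
    (hk : ContinuousAt k y) (hf : StrictlyContinuousAt f y) (hC : ∀ y, ‖f y‖ ≤ C) :
    StrictlyContinuousAt (fun y => X.toFun (k y) * f y * star (X.toFun (k y))) y := by
  by_cases h0 : X.toFun (k y) = 0
  · have h := StrictlyContinuousAt.sandwich_of_eq_zero (h := fun y => star (X.toFun (k y)))
      (x := y) (D := 1) hC (fun y => by rw [norm_star]; exact X.norm_le _)
      (by rw [h0, star_zero])
      (fun b => ContinuousAt.comp (f := k) (X.continuous_star (k y) b) hk)
    simpa only [star_star] using h
  · have h := (X.continuousAt_of_ne _ h0).comp hk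
    exact h.sandwich hf h (fun _ => X.norm_le _) hC fun _ => X.norm_le _

theorem corner_continuousAt {Y : Type*} [TopologicalSpace Y] {k : Y → I} {f : Y → 𝓜(ℂ, B)}
    {y : Y} {C : ℝ} (hk : ContinuousAt k y) (hf : StrictlyContinuousAt f y)
    (hC : ∀ y, ‖f y‖ ≤ C) : StrictlyContinuousAt (fun y => corner (X.toFun (k y)) (f y)) y := by
  have h1 := X.sandwich hk (StrictlyContinuousAt.const 1) (fun _ => le_rfl)
  simp only [mul_one] at h1
  exact (X.sandwich hk hf hC).add ((StrictlyContinuousAt.const 1).sub h1)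

/-- The path of compressions of a cocycle representation. -/
def compress (x : CocycleRep α β) (s : I) : CocycleRep α β :=
  x.compress (X.toFun s) (X.isometry_or_zero s) (X.fixed s)

theorem isRepPath_compress (x : CocycleRep α β) : IsRepPath (X.compress x) :=
  ⟨fun a => strictlyContinuous_iff.2 fun _ =>
      X.sandwich continuousAt_id (StrictlyContinuousAt.const (x.φ a)) fun _ => le_rfl,
    strictlyContinuous_iff.2 fun p => X.corner_continuousAt (k := fun p : G × I => p.2)
      continuousAt_snd ((x.continuous_u.at p.1).comp continuousAt_fst) fun p => x.norm_u_le p.1⟩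

theorem compress_of_eq_one (x : CocycleRep α β) {s : I} (h : X.toFun s = 1) :
    X.compress x s = x := by
  refine CocycleRep.ext_iff'.2 ⟨fun a => ?_, fun g => ?_⟩
  · change X.toFun s * x.φ a * star (X.toFun s) = x.φ a
    simp [h]
  · change corner (X.toFun s) (x.u g) = x.u g
    rw [h, corner_one_left]

theorem compress_of_eq_zero (x : CocycleRep α β) {s : I} (h : X.toFun s = 0) :
    X.compress x s = CocycleRep.zero α β := by
  refine CocycleRep.ext_iff'.2 ⟨fun a => ?_, fun g => ?_⟩
  · change X.toFun s * x.φ a * star (X.toFun s) = 0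
    simp [h]
  · change corner (X.toFun s) (x.u g) = 1
    rw [h, corner_zero_left]

theorem compress_of_eq_cuntz (x : CocycleRep α β) {s : I} (t : CuntzIsometries β)
    (h : X.toFun s = t.t₁) : X.compress x s = t.sumRep x (CocycleRep.zero α β) := by
  refine CocycleRep.ext_iff'.2 ⟨fun a => ?_, fun g => ?_⟩
  · change X.toFun s * x.φ a * star (X.toFun s) = t.sum (x.φ a) 0
    simp [h, CuntzIsometries.sum]
  · change corner (X.toFun s) (x.u g) = t.sum (x.u g) 1
    rw [h, corner, CuntzIsometries.sum, mul_one, ← t.sum_eq_one, add_sub_cancel_left]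

/-- Compression by `t₁` is the sum with the zero representation, as `1 - t₁ t₁* = t₂ t₂*`. Strict
continuity at all times is required so that the differences `X m X*`, `m ∈ B`, move norm
continuously. -/
theorem homotopic_sum_zero (h0 : X.toFun 0 = 1) (t : CuntzIsometries β) (h1 : X.toFun 1 = t.t₁)
    (hX : ∀ s, StrictlyContinuousAt X.toFun s) (x : CuntzPair α β) :
    Homotopic x (CuntzPair.sum t x (CuntzPair.zero α β)) := by
  have hc : ∀ m : 𝓜(ℂ, B), InIdeal m →
      Continuous fun s => X.toFun s * m * star (X.toFun s) := by
    rintro _ ⟨b, rfl⟩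
    refine continuous_iff_continuousAt.2 fun s => ?_
    have h := hX s
    exact h.sandwich_coe h.star (fun s => by rw [norm_star]; exact X.norm_le s) b
  refine IsHomotopy.homotopic (P := X.compress x.fst) (Q := X.compress x.snd)
    ⟨X.isRepPath_compress _, X.isRepPath_compress _, fun s => ⟨fun a => ?_, fun g => ?_⟩,
      fun a => ?_, fun g => ?_⟩ (X.compress_of_eq_one _ h0) (X.compress_of_eq_one _ h0)
    (X.compress_of_eq_cuntz _ t h1) (X.compress_of_eq_cuntz _ t h1)
  · change InIdeal (X.toFun s * x.fst.φ a * star (X.toFun s) -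
      X.toFun s * x.snd.φ a * star (X.toFun s))
    rw [← sub_mul, ← mul_sub]
    exact (x.isCuntzPair.1 a).mul_mul _ _
  · change InIdeal (corner (X.toFun s) (x.fst.u g) - corner (X.toFun s) (x.snd.u g))
    rw [corner_sub_corner]
    exact (x.isCuntzPair.2 g).mul_mul _ _
  · refine (hc _ (x.isCuntzPair.1 a)).congr fun s => ?_
    rw [mul_sub, sub_mul]
    rfl
  · exact (hc _ (x.isCuntzPair.2 g)).congr fun s => (corner_sub_corner _ _ _).symm

/-- Both components are equal throughout, so the differences vanish and a path that degenerates at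
`0` suffices. -/
theorem homotopic_zero (h0 : X.toFun 0 = 0) (h1 : X.toFun 1 = 1) (x : CocycleRep α β)
    (h : IsCuntzPair x x) : Homotopic ⟨x, x, h⟩ (CuntzPair.zero α β) := by
  refine Homotopic.symm (IsHomotopy.homotopic (P := X.compress x) (Q := X.compress x)
    ⟨X.isRepPath_compress _, X.isRepPath_compress _, fun s => ⟨fun a => ?_, fun g => ?_⟩,
      fun a => ?_, fun g => ?_⟩ (X.compress_of_eq_zero _ h0) (X.compress_of_eq_zero _ h0)
    (X.compress_of_eq_one _ h1) (X.compress_of_eq_one _ h1))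
  · rw [sub_self]; exact InIdeal.zero
  · rw [sub_self]; exact InIdeal.zero
  · simpa only [sub_self] using continuous_const
  · simpa only [sub_self] using continuous_const

variable [IsTopologicalGroup G]

/-- The unitaries `corner (X s) w` join `1` to `w` strictly continuously. Neither `w` nor this path
has to be `β`-invariant, since `conj` adjusts the cocycle. -/
theorem homotopic_conj (h0 : X.toFun 0 = 0) (h1 : X.toFun 1 = 1) (x : CuntzPair α β)
    {w : 𝓜(ℂ, B)} (hw : w ∈ unitary 𝓜(ℂ, B)) :
    Homotopic x ⟨x.fst.conj w hw, x.snd.conj w hw, x.isCuntzPair.conj hw⟩ := by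
  have hu : ∀ s, corner (X.toFun s) w ∈ unitary 𝓜(ℂ, B) := fun s =>
    corner_mem_unitary (X.isometry_or_zero s) hw
  have hn : ∀ s, ‖corner (X.toFun s) w‖ ≤ 1 := fun s => norm_le_one_of_unitary (hu s)
  have hn' : ∀ g s, ‖β.ext g (corner (X.toFun s) w)‖ ≤ 1 := fun g s =>
    (norm_ext_le _ _ _).trans (hn s)
  have hW : ∀ s, StrictlyContinuousAt (fun s => corner (X.toFun s) w) s := fun s =>
    X.corner_continuousAt continuousAt_id (StrictlyContinuousAt.const w) fun _ => le_rfl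
  have hpath := fun y : CocycleRep α β => isRepPath_conj y (strictlyContinuous_iff.2 hW) hu
  have hend0 : ∀ y : CocycleRep α β, y.conj _ (hu 0) = y := fun y => by
    refine CocycleRep.ext_iff'.2 ⟨fun a => ?_, fun g => ?_⟩
    · rw [CocycleRep.conj_φ, h0, corner_zero_left, star_one, one_mul, mul_one]
    · rw [CocycleRep.conj_u, h0, corner_zero_left, map_one, star_one, one_mul, mul_one]
  have hend1 : ∀ y : CocycleRep α β, y.conj _ (hu 1) = y.conj w hw := fun y => by
    refine CocycleRep.ext_iff'.2 ⟨fun a => ?_, fun g => ?_⟩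
    · rw [CocycleRep.conj_φ, CocycleRep.conj_φ, h1, corner_one_left]
    · rw [CocycleRep.conj_u, CocycleRep.conj_u, h1, corner_one_left]
  refine IsHomotopy.homotopic ⟨hpath x.fst, hpath x.snd, fun s => x.isCuntzPair.conj (hu s),
    fun a => ?_, fun g => ?_⟩ (hend0 _) (hend0 _) (hend1 _) (hend1 _)
  · obtain ⟨b, hb⟩ := x.isCuntzPair.1 a
    have h : Continuous fun s => corner (X.toFun s) w * DoubleCentralizer.coe ℂ b *
        star (corner (X.toFun s) w) := continuous_iff_continuousAt.2 fun s =>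
      (hW s).sandwich_coe (hW s).star (fun s => by rw [norm_star]; exact hn s) b
    refine h.congr fun s => ?_
    rw [← hb, CocycleRep.conj_φ, CocycleRep.conj_φ, mul_sub, sub_mul]
  · obtain ⟨b, hb⟩ := x.isCuntzPair.2 g
    have h : Continuous fun s => corner (X.toFun s) w * DoubleCentralizer.coe ℂ b *
        star (β.ext g (corner (X.toFun s) w)) := continuous_iff_continuousAt.2 fun s =>
      (hW s).sandwich_coe ((hW s).ext β continuousAt_const hn).star
        (fun s => by rw [norm_star]; exact hn' g s) b
    refine h.congr fun s => ?_
    rw [← hb, CocycleRep.conj_u, CocycleRep.conj_u, mul_sub, sub_mul]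

end IsometryPath

end IsometryPaths

/-! ### Gluing infinitely many paths and adding a point at infinity -/

section Reparametrization

theorem continuous_floor_concat {E : Type*} [TopologicalSpace E] {F : ℕ → ℝ → E}
    (hF : ∀ n, Continuous (F n)) (h : ∀ n, F n 1 = F (n + 1) 0) :
    Continuous fun r : ℝ => F ⌊r⌋₊ (r - ⌊r⌋₊) := by
  -- Near any point only finitely many pieces matter. The finite gluing `g` prolongs its last piece
  -- beyond `N + 1`, so that the value at `N + 1` is available for attaching the next one.
  have key : ∀ N : ℕ, ∃ g : ℝ → E, Continuous g ∧ (∀ r < (N + 1 : ℝ), g r = F ⌊r⌋₊ (r - ⌊r⌋₊)) ∧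
      ∀ r, (N : ℝ) ≤ r → g r = F N (r - N) := by
    intro N
    induction N with
    | zero =>
      refine ⟨F 0, hF 0, fun r hr => ?_, fun r _ => by simp⟩
      have : ⌊r⌋₊ = 0 := Nat.floor_eq_zero.2 (by simpa using hr)
      simp [this]
    | succ N ih =>
      obtain ⟨g, hg, h1, h2⟩ := ih
      have hsucc : ((N + 1 : ℕ) : ℝ) = N + 1 := by push_cast; rfl
      refine ⟨fun r => if r ≤ (N + 1 : ℝ) then g r else F (N + 1) (r - (N + 1)), ?_, ?_, ?_⟩
      · refine Continuous.if_le hg ((hF _).comp (by fun_prop)) continuous_id continuous_const ?_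
        rintro r hr
        rw [h2 r (by linarith [hr]), hr, sub_self, add_sub_cancel_left, h]
      · intro r hr
        rw [hsucc] at hr
        dsimp only
        split_ifs with hle
        · rcases hle.lt_or_eq with hlt | heq
          · exact h1 r hlt
          · have hfl : ⌊r⌋₊ = N + 1 := by rw [heq, ← hsucc, Nat.floor_natCast]
            rw [h2 r (by linarith), hfl, hsucc, heq, sub_self, add_sub_cancel_left, h]
        · have hfl : ⌊r⌋₊ = N + 1 := by
            rw [Nat.floor_eq_iff (by linarith [Nat.cast_nonneg (α := ℝ) N])]
            rw [hsucc]
            constructor <;> linarith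
          rw [hfl, hsucc]
      · intro r hr
        rw [hsucc] at hr ⊢
        dsimp only
        split_ifs with hle
        · have heq : r = N + 1 := le_antisymm hle hr
          rw [h2 r (by linarith), heq, sub_self, add_sub_cancel_left, h]
        · rfl
  refine continuous_iff_continuousAt.2 fun r => ?_
  obtain ⟨N, hN⟩ := exists_nat_gt r
  obtain ⟨g, hg, h1, -⟩ := key N
  refine hg.continuousAt.congr ?_
  filter_upwards [Iio_mem_nhds (show r < N + 1 by linarith)] with r hr using h1 r hr

/-- The reparametrization of a path on `[0, ∞)`, with a value at infinity, by the unit interval;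
infinity corresponds to `0`. -/
def reparam {E : Type*} (l : E) (f : ℝ → E) (s : I) : E :=
  if s = 0 then l else f ((s : ℝ)⁻¹ - 1)

theorem reparam_zero {E : Type*} (l : E) (f : ℝ → E) : reparam l f 0 = l := if_pos rfl

theorem reparam_one {E : Type*} (l : E) (f : ℝ → E) : reparam l f 1 = f 0 := by
  simp [reparam]

theorem reparam_of_ne {E : Type*} (l : E) (f : ℝ → E) {s : I} (hs : s ≠ 0) :
    reparam l f s = f ((s : ℝ)⁻¹ - 1) := if_neg hs

theorem apply_reparam {E E' : Type*} (k : E → E') (l : E) (f : ℝ → E) (s : I) :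
    k (reparam l f s) = reparam (k l) (fun r => k (f r)) s :=
  apply_ite k _ _ _

theorem continuousAt_reparam_arg {s : I} (hs : s ≠ 0) :
    ContinuousAt (fun s : I => (s : ℝ)⁻¹ - 1) s := by
  have h : (s : ℝ) ≠ 0 := fun h => hs (Subtype.ext h)
  exact (continuousAt_subtype_val.inv₀ h).sub continuousAt_const

theorem reparam_eventuallyEq {E : Type*} (l : E) (f : ℝ → E) {s : I} (hs : s ≠ 0) :
    (fun s : I => f ((s : ℝ)⁻¹ - 1)) =ᶠ[𝓝 s] reparam l f := by
  filter_upwards [isOpen_ne.mem_nhds hs] with r hr using (reparam_of_ne l f hr).symm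

theorem eventually_reparam_arg {p : ℝ → Prop} (h : ∀ᶠ r in atTop, p r) :
    ∀ᶠ s : I in 𝓝 0, s ≠ 0 → p ((s : ℝ)⁻¹ - 1) := by
  have h1 : Tendsto (fun x : ℝ => x⁻¹ - 1) (𝓝[>] 0) atTop :=
    tendsto_atTop_add_const_right _ _ tendsto_inv_nhdsGT_zero
  have h2 := eventually_nhdsWithin_iff.1 (h1.eventually h)
  have h3 : Tendsto (fun s : I => (s : ℝ)) (𝓝 0) (𝓝 0) :=
    continuous_subtype_val.tendsto (0 : I)
  filter_upwards [h3.eventually h2] with s hs hne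
  exact hs (lt_of_le_of_ne s.2.1 fun h => hne (Subtype.ext h.symm))

theorem continuousAt_reparam_of_ne {E : Type*} [TopologicalSpace E] (l : E) {f : ℝ → E}
    (hf : Continuous f) {s : I} (hs : s ≠ 0) : ContinuousAt (reparam l f) s :=
  (ContinuousAt.comp (f := fun s : I => (s : ℝ)⁻¹ - 1) hf.continuousAt
    (continuousAt_reparam_arg hs)).congr (reparam_eventuallyEq l f hs)

theorem continuous_reparam {E : Type*} [TopologicalSpace E] {l : E} {f : ℝ → E}
    (hf : Continuous f) (hl : Tendsto f atTop (𝓝 l)) : Continuous (reparam l f) := by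
  refine continuous_iff_continuousAt.2 fun s => ?_
  by_cases hs : s = 0
  · subst hs
    rw [ContinuousAt, reparam_zero]
    intro V hV
    refine mem_map.2 ?_
    filter_upwards [eventually_reparam_arg (hl hV)] with s h
    by_cases hs : s = 0
    · subst hs
      rw [Set.mem_preimage, reparam_zero]
      exact mem_of_mem_nhds hV
    · rw [Set.mem_preimage, reparam_of_ne _ _ hs]
      exact h hs
  · exact continuousAt_reparam_of_ne l hf hs

end Reparametrization

/-! ### From asymptotic equivalence to homotopy -/

section AsymptoticHomotopy

variable {G A B : Type*} [Group G] [TopologicalSpace G] [IsTopologicalGroup G]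
  [LocallyCompactSpace G] [NonUnitalCStarAlgebra A] [NonUnitalCStarAlgebra B]
  {α : CStarAction G A} {β : CStarAction G B}

/-- With `w` the initial unitary of the path, the first component is frozen at `x.conj w` while the
second follows the conjugates of `y` to their limit `z`. Each conjugate differs from `z` by elements
of `B`, so the Cuntz pair condition persists. -/
theorem AsymptoticEquiv.exists_homotopic {x y z : CocycleRep α β} (h : AsymptoticEquiv y z)
    (hxy : IsCuntzPair x y) : ∃ (w : 𝓜(ℂ, B)) (hw : w ∈ unitary 𝓜(ℂ, B))
      (hxz : IsCuntzPair (x.conj w hw) z),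
      Homotopic ⟨x.conj w hw, y.conj w hw, hxy.conj hw⟩ ⟨x.conj w hw, z, hxz⟩ := by
  obtain ⟨w₀, hc, hw₀, h1, h2, h3, h4⟩ := asymptoticEquiv_iff.1 h
  -- Time `0` corresponds to time `1` of the given path; the truncation makes the shifted path
  -- continuous on all of `ℝ`.
  set k : ℝ → ℝ := fun r => max 1 (r + 1) with hk
  have hk1 : ∀ r, 1 ≤ k r := fun r => le_max_left _ _
  have hkt : Tendsto k atTop atTop :=
    tendsto_atTop_mono (fun r => le_max_right _ _) (tendsto_atTop_add_const_right _ _ tendsto_id)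
  set w : ℝ → 𝓜(ℂ, B) := fun r => w₀ (k r) with hwdef
  have hwc : Continuous w := hc.comp_continuous (by fun_prop) hk1
  have hw : ∀ r, w r ∈ unitary 𝓜(ℂ, B) := fun r => hw₀ _ (hk1 r)
  have hn : ∀ r, ‖w r‖ ≤ 1 := fun r => norm_le_one_of_unitary (hw r)
  set Q : I → CocycleRep α β := reparam z fun r => y.conj (w r) (hw r) with hQ
  have hQ0 : Q 0 = z := reparam_zero _ _
  have hQφ : ∀ a, Continuous fun s => (Q s).φ a := by
    intro a
    have hf : Continuous fun r => w r * y.φ a * star (w r) := by fun_prop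
    refine (continuous_reparam (l := z.φ a) hf ?_).congr fun s =>
      (apply_reparam (fun q : CocycleRep α β => q.φ a) z (fun r => y.conj (w r) (hw r)) s).symm
    refine Metric.tendsto_nhds.2 fun ε hε => ?_
    filter_upwards [hkt.eventually (h1 a ε hε)] with r hr
    rwa [dist_comm, dist_eq_norm]
  have hQu : ∀ g, Continuous fun s => (Q s).u g := by
    intro g
    have hf : Continuous fun r => w r * y.u g * star (β.ext g (w r)) := by
      have := (continuous_ext_action β g).comp hwc
      exact (hwc.mul continuous_const).mul this.star
    refine (continuous_reparam (l := z.u g) hf ?_).congr fun s =>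
      (apply_reparam (fun q : CocycleRep α β => q.u g) z (fun r => y.conj (w r) (hw r)) s).symm
    refine Metric.tendsto_nhds.2 fun ε hε => ?_
    filter_upwards [hkt.eventually (h3 {g} isCompact_singleton ε hε)] with r hr
    rw [dist_comm, dist_eq_norm]
    exact hr g rfl
  have hideal : ∀ s, IsCuntzPair z (Q s) := by
    intro s
    by_cases hs : s = 0
    · rw [hs, hQ0]
      exact ⟨fun a => by rw [sub_self]; exact InIdeal.zero,
        fun g => by rw [sub_self]; exact InIdeal.zero⟩
    · rw [hQ, reparam_of_ne _ _ hs]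
      exact ⟨fun a => h2 a _ (hk1 _), fun g => h4 g _ (hk1 _)⟩
  have hpath : IsRepPath Q := by
    refine ⟨fun a => strictlyContinuous_iff.2 fun s =>
      .of_continuousAt (hQφ a).continuousAt, strictlyContinuous_iff.2 ?_⟩
    rintro ⟨g₀, s₀⟩
    by_cases hs : s₀ = 0
    · subst hs
      have hd : ContinuousAt (fun p : G × I => (Q p.2).u p.1 - z.u p.1) (g₀, 0) := by
        rw [ContinuousAt, hQ0, sub_self]
        refine Metric.tendsto_nhds.2 fun ε hε => ?_
        -- Joint continuity at the limit point comes from uniform convergence of the cocycles on a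
        -- compact neighbourhood of `g₀`.
        obtain ⟨K, hK, hgK⟩ := exists_compact_mem_nhds g₀
        have hev := eventually_reparam_arg (hkt.eventually (h3 K hK ε hε))
        have hK' : ∀ᶠ p : G × I in 𝓝 (g₀, 0), p.1 ∈ K :=
          (continuous_fst.tendsto (g₀, (0 : I))).eventually hgK
        have hev' : ∀ᶠ p : G × I in 𝓝 (g₀, 0), p.2 ≠ 0 → ∀ g ∈ K,
            ‖z.u g - w ((p.2 : ℝ)⁻¹ - 1) * y.u g * star (β.ext g (w ((p.2 : ℝ)⁻¹ - 1)))‖ < ε :=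
          (continuous_snd.tendsto (g₀, (0 : I))).eventually hev
        filter_upwards [hK', hev'] with p hp1 hp2
        rw [dist_zero_right]
        by_cases hp : p.2 = 0
        · rw [hp, hQ0, sub_self, norm_zero]
          exact hε
        · rw [hQ, reparam_of_ne _ _ hp, norm_sub_rev]
          exact hp2 hp _ hp1
      have hz : StrictlyContinuousAt (fun p : G × I => z.u p.1) (g₀, 0) :=
        (z.continuous_u.at g₀).comp (k := fun p : G × I => p.1) continuousAt_fst
      simpa only [sub_add_cancel] using (StrictlyContinuousAt.of_continuousAt hd).add hz
    · have hws : ContinuousAt (fun p : G × I => w ((p.2 : ℝ)⁻¹ - 1)) (g₀, s₀) :=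
        ContinuousAt.comp (f := fun p : G × I => p.2) (g := fun s : I => w ((s : ℝ)⁻¹ - 1))
          (ContinuousAt.comp (f := fun s : I => (s : ℝ)⁻¹ - 1) hwc.continuousAt
            (continuousAt_reparam_arg hs)) continuousAt_snd
      have hws' := StrictlyContinuousAt.of_continuousAt hws
      refine (hws'.sandwich ((y.continuous_u.at g₀).comp (k := fun p : G × I => p.1)
        continuousAt_fst) (hws'.ext β continuousAt_fst fun p => hn _) (fun p => hn _)
        (fun p => y.norm_u_le p.1) fun p => (norm_ext_le _ _ _).trans (hn _)).congr ?_
      have hne : ∀ᶠ p : G × I in 𝓝 (g₀, s₀), p.2 ≠ 0 :=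
        (continuous_snd.tendsto (g₀, s₀)).eventually (isOpen_ne.mem_nhds hs)
      filter_upwards [hne] with p hp
      rw [hQ, reparam_of_ne _ _ hp]
      rfl
  have hQ1 : Q 1 = y.conj (w 0) (hw 0) := reparam_one _ _
  have hpair : ∀ s, IsCuntzPair (x.conj (w 0) (hw 0)) (Q s) := by
    intro s
    have e1 := hxy.conj (hw 0)
    have e2 := hideal 1
    have e3 := hideal s
    rw [hQ1] at e2
    constructor
    · intro a
      -- With `x'`, `y'` the conjugates by `w 0`: `x' - Q s = (x' - y') - (z - y') + (z - Q s)`.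
      have := ((e1.1 a).sub (e2.1 a)).add (e3.1 a)
      rwa [sub_sub_sub_cancel_right, sub_add_sub_cancel] at this
    · intro g
      have := ((e1.2 g).sub (e2.2 g)).add (e3.2 g)
      rwa [sub_sub_sub_cancel_right, sub_add_sub_cancel] at this
  refine ⟨w 0, hw 0, hQ0 ▸ hpair 0, Homotopic.symm (IsHomotopy.homotopic
    (P := fun _ => x.conj (w 0) (hw 0)) (Q := Q)
    ⟨.const _, hpath, hpair, fun a => continuous_const.sub (hQφ a),
      fun g => continuous_const.sub (hQu g)⟩ rfl hQ0 rfl hQ1)⟩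

end AsymptoticHomotopy

/-! ### Homotopies produced by a pure isometry -/

section PureIsometries

variable {G A B : Type*} [Group G] [TopologicalSpace G] [NonUnitalCStarAlgebra A]
  [NonUnitalCStarAlgebra B] {α : CStarAction G A} {β : CStarAction G B}

namespace CuntzIsometries

variable (t : CuntzIsometries β)

/-- The first isometry of the pair is pure: the powers of its adjoint tend to zero strictly. -/
def IsPure : Prop := ∀ b : B, Tendsto (fun n : ℕ => (star (t.t₁ ^ n)).fst b) atTop (𝓝 0)

theorem isometry_pow (n : ℕ) : star (t.t₁ ^ n) * t.t₁ ^ n = 1 :=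
  star_pow_mul_pow t.isometry₁ n

theorem fixed_pow (n : ℕ) (g : G) : β.ext g (t.t₁ ^ n) = t.t₁ ^ n := by
  rw [map_pow, t.fixed₁]

/-- A path of isometries from `t₁` to `t₂ t₂* + t₁ t₁ t₁*`. -/
def bend (r : ℝ) : 𝓜(ℂ, B) :=
  (((Real.sin (Real.pi / 2 * r) : ℝ) : ℂ) • t.t₂ +
    ((Real.cos (Real.pi / 2 * r) : ℝ) : ℂ) • (t.t₁ * t.t₂)) * star t.t₂ +
    t.t₁ * t.t₁ * star t.t₁

theorem continuous_bend : Continuous t.bend := by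
  unfold bend
  fun_prop

theorem fixed_bend (r : ℝ) (g : G) : β.ext g (t.bend r) = t.bend r := by
  simp only [bend, map_add, map_mul, map_smul, map_star, t.fixed₁, t.fixed₂]

theorem bend_zero : t.bend 0 = t.t₁ := by
  have h : t.bend 0 = t.t₁ * (t.t₁ * star t.t₁ + t.t₂ * star t.t₂) := by
    simp [bend, mul_add, mul_assoc, add_comm]
  rw [h, t.sum_eq_one, mul_one]

/-- The path ends at its own starting point pushed into the corner of `t₁`. It can therefore be
repeated inside that corner indefinitely. -/
theorem bend_one : t.bend 1 = corner t.t₁ t.t₁ := by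
  have h : corner t.t₁ t.t₁ = t.t₁ * t.t₁ * star t.t₁ + t.t₂ * star t.t₂ := by
    rw [corner, ← t.sum_eq_one, add_sub_cancel_left]
  rw [h]
  simp [bend, add_comm]

/-- The combination `a` of `t₂` and `t₁ t₂` is an isometry, as these two have orthogonal ranges and
`sin² + cos² = 1`; its range is orthogonal to that of `t₁ t₁`. So `a t₂* + t₁ t₁ t₁*` maps the
orthogonal ranges of `t₂` and `t₁` isometrically onto orthogonal ranges. -/
theorem isometry_bend (r : ℝ) : star (t.bend r) * t.bend r = 1 := by
  set a : 𝓜(ℂ, B) := ((Real.sin (Real.pi / 2 * r) : ℝ) : ℂ) • t.t₂ +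
    ((Real.cos (Real.pi / 2 * r) : ℝ) : ℂ) • (t.t₁ * t.t₂) with ha
  have e1 : star t.t₂ * star t.t₁ * (t.t₁ * t.t₂) = 1 := by
    rw [mul_assoc, ← mul_assoc (star t.t₁), t.isometry₁, one_mul, t.isometry₂]
  have e2 : star t.t₂ * (t.t₁ * t.t₂) = 0 := by rw [← mul_assoc, t.orth₂₁, zero_mul]
  have e3 : star t.t₂ * star t.t₁ * t.t₂ = 0 := by rw [mul_assoc, t.orth₁₂, mul_zero]
  have haa : star a * a = 1 := by
    simp only [ha, star_add, star_smul, star_mul, add_mul, mul_add, smul_mul_smul_comm, e1, e2, e3,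
      t.isometry₂, smul_zero, add_zero, zero_add, ← add_smul]
    have : (star ((Real.sin (Real.pi / 2 * r) : ℝ) : ℂ) * ((Real.sin (Real.pi / 2 * r) : ℝ) : ℂ) +
        star ((Real.cos (Real.pi / 2 * r) : ℝ) : ℂ) * ((Real.cos (Real.pi / 2 * r) : ℝ) : ℂ)) =
        1 := by
      simp only [Complex.star_def, Complex.conj_ofReal]
      norm_cast
      linarith [Real.sin_sq_add_cos_sq (Real.pi / 2 * r)]
    rw [this, one_smul]
  have hat : star a * (t.t₁ * t.t₁) = 0 := by
    have e4 : star t.t₂ * star t.t₁ * (t.t₁ * t.t₁) = 0 := by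
      rw [mul_assoc, ← mul_assoc (star t.t₁), t.isometry₁, one_mul, t.orth₂₁]
    have e5 : star t.t₂ * (t.t₁ * t.t₁) = 0 := by rw [← mul_assoc, t.orth₂₁, zero_mul]
    simp only [ha, star_add, star_smul, star_mul, add_mul, smul_mul_assoc, e4, e5, smul_zero,
      add_zero]
  have hta : star t.t₁ * star t.t₁ * a = 0 := by
    have := congrArg star hat
    simpa only [star_mul, star_star, star_zero] using this
  have htt : star t.t₁ * star t.t₁ * (t.t₁ * t.t₁) = 1 := by
    rw [mul_assoc, ← mul_assoc (star t.t₁) t.t₁, t.isometry₁, one_mul, t.isometry₁]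
  have h : star (t.bend r) * t.bend r = t.t₂ * (star a * a) * star t.t₂ +
      t.t₂ * (star a * (t.t₁ * t.t₁)) * star t.t₁ +
      t.t₁ * (star t.t₁ * star t.t₁ * a) * star t.t₂ +
      t.t₁ * (star t.t₁ * star t.t₁ * (t.t₁ * t.t₁)) * star t.t₁ := by
    change star (a * star t.t₂ + t.t₁ * t.t₁ * star t.t₁) *
      (a * star t.t₂ + t.t₁ * t.t₁ * star t.t₁) = _
    simp only [star_add, star_mul, star_star]
    noncomm_ring
  rw [h, haa, hat, hta, htt, mul_one, mul_one, mul_zero, mul_zero, zero_mul, zero_mul, add_zero,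
    add_zero, add_comm, t.sum_eq_one]

theorem corner_corner (X Y m : 𝓜(ℂ, B)) : corner X (corner Y m) = corner (X * Y) m := by
  simp only [corner, star_mul]
  noncomm_ring

/-- The path of isometries from `t₁` at time `0` to `1` at infinity. -/
def unbend (r : ℝ) : 𝓜(ℂ, B) := corner (t.t₁ ^ ⌊r⌋₊) (t.bend (r - ⌊r⌋₊))

theorem continuous_corner_right (X : 𝓜(ℂ, B)) : Continuous (corner X) := by
  change Continuous fun m => X * m * star X + (1 - X * star X)
  fun_prop

theorem continuous_unbend : Continuous t.unbend :=
  continuous_floor_concat (F := fun n r => corner (t.t₁ ^ n) (t.bend r))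
    (fun n => (continuous_corner_right _).comp t.continuous_bend) fun n => by
      rw [bend_one, bend_zero, corner_corner, pow_succ]

theorem fixed_unbend (r : ℝ) (g : G) : β.ext g (t.unbend r) = t.unbend r := by
  rw [unbend, ext_corner (t.fixed_pow _ g), t.fixed_bend]

theorem isometry_unbend (r : ℝ) : star (t.unbend r) * t.unbend r = 1 := by
  rw [unbend, star_corner, corner_mul_corner (Or.inl (t.isometry_pow _)), t.isometry_bend,
    corner_one_right]

theorem unbend_zero : t.unbend 0 = t.t₁ := by
  simp [unbend, bend_zero, corner_one_left]

variable {t}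

/-- The difference from `1` is `t₁ⁿ (m - 1) (t₁ⁿ)*`, whose last factor sends `b` to `0` in the limit
by purity, whatever the contractions `m` are. -/
theorem IsPure.tendsto_corner (ht : t.IsPure) {m : ℝ → 𝓜(ℂ, B)} (hm : ∀ r, ‖m r‖ ≤ 1) (b : B) :
    Tendsto (fun r : ℝ => (corner (t.t₁ ^ ⌊r⌋₊) (m r)).fst b) atTop (𝓝 b) := by
  rw [tendsto_iff_norm_sub_tendsto_zero]
  have h1 : Tendsto (fun r : ℝ => 2 * ‖(star (t.t₁ ^ ⌊r⌋₊)).fst b‖) atTop (𝓝 0) := by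
    simpa using ((ht b).comp tendsto_nat_floor_atTop).norm.const_mul 2
  refine squeeze_zero (fun _ => norm_nonneg _) (fun r => ?_) h1
  have h2 : (corner (t.t₁ ^ ⌊r⌋₊) (m r)).fst b - b =
      (t.t₁ ^ ⌊r⌋₊ * (m r - 1)).fst ((star (t.t₁ ^ ⌊r⌋₊)).fst b) := by
    have h3 : corner (t.t₁ ^ ⌊r⌋₊) (m r) - 1 =
        t.t₁ ^ ⌊r⌋₊ * (m r - 1) * star (t.t₁ ^ ⌊r⌋₊) := by
      rw [← corner_sub_corner, corner_one_right]
    exact congrArg (fun x : 𝓜(ℂ, B) => x.fst b) h3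
  rw [h2]
  refine (norm_fst_apply_le _ _).trans (mul_le_mul_of_nonneg_right ?_ (norm_nonneg _))
  have h4 := norm_le_one_of_isometry (t.isometry_pow ⌊r⌋₊)
  have h5 : ‖m r - 1‖ ≤ 2 := (norm_sub_le _ _).trans (by linarith [hm r, norm_one_le (B := B)])
  exact (norm_mul_le _ _).trans (by nlinarith [norm_nonneg (m r - 1), norm_nonneg (t.t₁ ^ ⌊r⌋₊)])

theorem IsPure.strictlyContinuous_unbend (ht : t.IsPure) :
    StrictlyContinuous (reparam 1 t.unbend) := by
  constructor
  · intro b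
    refine (continuous_reparam (l := b) (f := fun r => (t.unbend r).fst b) ?_ ?_).congr fun s =>
      (apply_reparam (fun m : 𝓜(ℂ, B) => m.fst b) 1 t.unbend s).symm
    · exact (strictlyContinuous_iff.2 fun r => .of_continuousAt t.continuous_unbend.continuousAt).1 b
    · exact ht.tendsto_corner (fun r => norm_le_one_of_isometry (t.isometry_bend _)) b
  · intro b
    refine (continuous_reparam (l := b) (f := fun r => (t.unbend r).snd b) ?_ ?_).congr fun s =>
      (apply_reparam (fun m : 𝓜(ℂ, B) => m.snd b) 1 t.unbend s).symm
    · exact (strictlyContinuous_iff.2 fun r => .of_continuousAt t.continuous_unbend.continuousAt).2 b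
    · have h := (ht.tendsto_corner (m := fun r : ℝ => star (t.bend (r - ⌊r⌋₊)))
        (fun r => by rw [norm_star]; exact norm_le_one_of_isometry (t.isometry_bend _))
        (star b)).star
      simp only [← star_corner, ← snd_eq_star, star_star] at h
      exact h

/-- The path of isometries from `1` to a pure isometry. -/
def IsPure.unbendPath (ht : t.IsPure) : IsometryPath β where
  toFun := reparam 1 t.unbend
  fixed s g := by
    by_cases hs : s = 0
    · rw [hs, reparam_zero, map_one]
    · rw [reparam_of_ne _ _ hs, fixed_unbend]
  isometry_or_zero s := Or.inl (by
    by_cases hs : s = 0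
    · rw [hs, reparam_zero, star_one, mul_one]
    · rw [reparam_of_ne _ _ hs, isometry_unbend])
  continuous_star s b := (ht.strictlyContinuous_unbend.at s).star.1 b
  continuousAt_of_ne s _ := ht.strictlyContinuous_unbend.at s

theorem IsPure.homotopic_sum_zero (ht : t.IsPure) (x : CuntzPair α β) :
    Homotopic x (CuntzPair.sum t x (CuntzPair.zero α β)) :=
  ht.unbendPath.homotopic_sum_zero (reparam_zero _ _) t
    ((reparam_one _ _).trans t.unbend_zero) ht.strictlyContinuous_unbend.at x

theorem IsPure.isometry_unbendPath (ht : t.IsPure) (s : I) :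
    star (ht.unbendPath.toFun s) * ht.unbendPath.toFun s = 1 := by
  change star (reparam 1 t.unbend s) * reparam 1 t.unbend s = 1
  by_cases hs : s = 0
  · rw [hs, reparam_zero, star_one, mul_one]
  · rw [reparam_of_ne _ _ hs, isometry_unbend]

/-- The path of isometries from `1` at time `0` to `0` at infinity. -/
def IsPure.vanish (ht : t.IsPure) (r : ℝ) : 𝓜(ℂ, B) :=
  t.t₁ ^ ⌊r⌋₊ * ht.unbendPath.toFun (Set.projIcc 0 1 zero_le_one (r - ⌊r⌋₊))

theorem IsPure.isometry_vanish (ht : t.IsPure) (r : ℝ) :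
    star (ht.vanish r) * ht.vanish r = 1 := by
  set Y := ht.unbendPath.toFun (Set.projIcc 0 1 zero_le_one (r - ⌊r⌋₊)) with hY
  have h : star (ht.vanish r) * ht.vanish r =
      star Y * (star (t.t₁ ^ ⌊r⌋₊) * t.t₁ ^ ⌊r⌋₊) * Y := by
    change star (t.t₁ ^ ⌊r⌋₊ * Y) * (t.t₁ ^ ⌊r⌋₊ * Y) = _
    rw [star_mul]; noncomm_ring
  rw [h, isometry_pow, mul_one, hY, ht.isometry_unbendPath]

/-- On `[n, n + 1]` the path is `t₁ⁿ` times the path from `1` to `t₁`; consecutive pieces meet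
because `t₁ⁿ t₁ = t₁ⁿ⁺¹ · 1`. -/
theorem IsPure.strictlyContinuous_vanish (ht : t.IsPure) : StrictlyContinuous ht.vanish := by
  have hc : StrictlyContinuous fun r : ℝ => ht.unbendPath.toFun (Set.projIcc 0 1 zero_le_one r) :=
    ht.strictlyContinuous_unbend.comp continuous_projIcc
  have hF : ∀ n : ℕ, StrictlyContinuous fun r : ℝ =>
      t.t₁ ^ n * ht.unbendPath.toFun (Set.projIcc 0 1 zero_le_one r) := fun n =>
    strictlyContinuous_iff.2 fun r => (StrictlyContinuousAt.const _).mul (hc.at r)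
      (fun _ => le_rfl) fun r => ht.unbendPath.norm_le _
  have h : ∀ n : ℕ, t.t₁ ^ n * ht.unbendPath.toFun (Set.projIcc 0 1 zero_le_one 1) =
      t.t₁ ^ (n + 1) * ht.unbendPath.toFun (Set.projIcc 0 1 zero_le_one 0) := by
    intro n
    have h0 : ht.unbendPath.toFun 0 = 1 := reparam_zero _ _
    have h1 : ht.unbendPath.toFun 1 = t.t₁ := (reparam_one _ _).trans t.unbend_zero
    rw [Set.projIcc_left, Set.projIcc_right]
    change _ * ht.unbendPath.toFun 1 = _ * ht.unbendPath.toFun 0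
    rw [h0, h1, pow_succ, mul_one]
  constructor
  · exact fun b => continuous_floor_concat (F := fun n r =>
      (t.t₁ ^ n * ht.unbendPath.toFun (Set.projIcc 0 1 zero_le_one r)).fst b)
      (fun n => (hF n).1 b) fun n => by rw [h]
  · exact fun b => continuous_floor_concat (F := fun n r =>
      (t.t₁ ^ n * ht.unbendPath.toFun (Set.projIcc 0 1 zero_le_one r)).snd b)
      (fun n => (hF n).2 b) fun n => by rw [h]

theorem IsPure.tendsto_vanish (ht : t.IsPure) (b : B) :
    Tendsto (fun r => (star (ht.vanish r)).fst b) atTop (𝓝 0) := by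
  have h1 := ((ht b).comp (tendsto_nat_floor_atTop (α := ℝ))).norm
  rw [norm_zero] at h1
  refine squeeze_zero_norm (fun r => ?_) h1
  rw [IsPure.vanish, star_mul]
  refine (norm_fst_apply_le (star (ht.unbendPath.toFun _)) _).trans ?_
  exact mul_le_of_le_one_left (norm_nonneg _) ((norm_star _).trans_le (ht.unbendPath.norm_le _))

/-- The path of isometries from `0` to `1` defined by a pure isometry. -/
def IsPure.vanishPath (ht : t.IsPure) : IsometryPath β where
  toFun := reparam 0 ht.vanish
  fixed s g := by
    by_cases hs : s = 0
    · rw [hs, reparam_zero, map_zero]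
    · rw [reparam_of_ne _ _ hs, IsPure.vanish, map_mul, fixed_pow, ht.unbendPath.fixed]
  isometry_or_zero s := by
    by_cases hs : s = 0
    · exact Or.inr (by rw [hs, reparam_zero])
    · exact Or.inl (by rw [reparam_of_ne _ _ hs, ht.isometry_vanish])
  continuous_star s b := by
    refine ((continuous_reparam (l := 0) (f := fun r => (star (ht.vanish r)).fst b) ?_
      (ht.tendsto_vanish b)).congr fun s => ?_).continuousAt
    · exact (strictlyContinuous_iff.2 fun r => (ht.strictlyContinuous_vanish.at r).star).1 b
    · have h := apply_reparam (fun m : 𝓜(ℂ, B) => (star m).fst b) 0 ht.vanish s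
      rw [h, star_zero]
      rfl
  continuousAt_of_ne s h := by
    have hs : s ≠ 0 := fun h0 => h (by rw [h0, reparam_zero])
    exact ((ht.strictlyContinuous_vanish.at _).comp (continuousAt_reparam_arg hs)).congr
      (reparam_eventuallyEq _ _ hs)

theorem IsPure.homotopic_zero (ht : t.IsPure) (x : CocycleRep α β) (h : IsCuntzPair x x) :
    Homotopic ⟨x, x, h⟩ (CuntzPair.zero α β) :=
  ht.vanishPath.homotopic_zero (reparam_zero _ _) ((reparam_one _ _).trans (by
    simp [IsPure.vanish, IsPure.unbendPath]; exact reparam_zero _ _)) x h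

theorem IsPure.homotopic_conj [IsTopologicalGroup G] (ht : t.IsPure) (x : CuntzPair α β)
    {w : 𝓜(ℂ, B)} (hw : w ∈ unitary 𝓜(ℂ, B)) :
    Homotopic x ⟨x.fst.conj w hw, x.snd.conj w hw, x.isCuntzPair.conj hw⟩ :=
  ht.vanishPath.homotopic_conj (reparam_zero _ _) ((reparam_one _ _).trans (by
    simp [IsPure.vanish, IsPure.unbendPath]; exact reparam_zero _ _)) x hw

end CuntzIsometries

end PureIsometries

/-! ### Rotations, anchoring and absorption -/

section Main

variable {G A B : Type*} [Group G] [TopologicalSpace G]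
  [NonUnitalCStarAlgebra A] [NonUnitalCStarAlgebra B] {α : CStarAction G A} {β : CStarAction G B}

namespace CuntzIsometries

variable (t : CuntzIsometries β)

theorem sum_add_sum (a b c d : 𝓜(ℂ, B)) : t.sum a b + t.sum c d = t.sum (a + c) (b + d) := by
  unfold sum; noncomm_ring

/-- The rotation by the angle `π r / 2` in the coordinates given by `t`. -/
def rotation (r : ℝ) : 𝓜(ℂ, B) :=
  ((Real.cos (Real.pi / 2 * r) : ℝ) : ℂ) • 1 +
    ((Real.sin (Real.pi / 2 * r) : ℝ) : ℂ) • (t.t₂ * star t.t₁ - t.t₁ * star t.t₂)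

theorem continuous_rotation : Continuous t.rotation := by
  unfold rotation
  fun_prop

theorem ext_rotation (r : ℝ) (g : G) : β.ext g (t.rotation r) = t.rotation r := by
  simp only [rotation, map_add, map_sub, map_mul, map_smul, map_star, map_one, t.fixed₁, t.fixed₂]

theorem rotation_zero : t.rotation 0 = 1 := by simp [rotation]

theorem quarterTurn_mul_sum (a b : 𝓜(ℂ, B)) :
    (t.t₂ * star t.t₁ - t.t₁ * star t.t₂) * t.sum a b =
      t.t₂ * a * star t.t₁ - t.t₁ * b * star t.t₂ := by
  have h : (t.t₂ * star t.t₁ - t.t₁ * star t.t₂) * t.sum a b =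
      t.t₂ * (star t.t₁ * t.t₁) * a * star t.t₁ + t.t₂ * (star t.t₁ * t.t₂) * b * star t.t₂ -
      t.t₁ * (star t.t₂ * t.t₁) * a * star t.t₁ - t.t₁ * (star t.t₂ * t.t₂) * b * star t.t₂ := by
    unfold sum; noncomm_ring
  rw [h, t.isometry₁, t.isometry₂, t.orth₁₂, t.orth₂₁]
  noncomm_ring

theorem star_quarterTurn :
    star (t.t₂ * star t.t₁ - t.t₁ * star t.t₂) = -(t.t₂ * star t.t₁ - t.t₁ * star t.t₂) := by
  simp

theorem sum_mul_quarterTurn (a b : 𝓜(ℂ, B)) :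
    t.sum a b * (t.t₂ * star t.t₁ - t.t₁ * star t.t₂) =
      t.t₂ * b * star t.t₁ - t.t₁ * a * star t.t₂ := by
  have h := congrArg star (t.quarterTurn_mul_sum (star a) (star b))
  rw [star_mul, star_quarterTurn, star_sum, star_star, star_star, mul_neg] at h
  rw [neg_eq_iff_eq_neg.1 h]
  simp [mul_assoc]

theorem quarterTurn_mul_self :
    (t.t₂ * star t.t₁ - t.t₁ * star t.t₂) * (t.t₂ * star t.t₁ - t.t₁ * star t.t₂) = -1 := by
  have h : (t.t₂ * star t.t₁ - t.t₁ * star t.t₂) * (t.t₂ * star t.t₁ - t.t₁ * star t.t₂) =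
      t.t₂ * (star t.t₁ * t.t₂) * star t.t₁ - t.t₂ * (star t.t₁ * t.t₁) * star t.t₂ -
      t.t₁ * (star t.t₂ * t.t₂) * star t.t₁ + t.t₁ * (star t.t₂ * t.t₁) * star t.t₂ := by
    noncomm_ring
  have h1 : (-1 : 𝓜(ℂ, B)) = -(t.t₁ * star t.t₁ + t.t₂ * star t.t₂) := by rw [t.sum_eq_one]
  rw [h, t.isometry₁, t.isometry₂, t.orth₁₂, t.orth₂₁, h1]
  noncomm_ring

theorem star_rotation (r : ℝ) : star (t.rotation r) = t.rotation (-r) := by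
  rw [rotation, rotation, star_add, star_smul, star_smul, star_quarterTurn, star_one]
  simp only [Complex.star_def, Complex.conj_ofReal, mul_neg, Real.cos_neg, Real.sin_neg,
    Complex.ofReal_neg, smul_neg, neg_smul]

theorem rotation_mul_rotation_neg (r : ℝ) : t.rotation r * t.rotation (-r) = 1 := by
  have h : ∀ (c s : ℂ) (J : 𝓜(ℂ, B)), J * J = -1 → c * c + s * s = 1 →
      (c • 1 + s • J) * (c • 1 + (-s) • J) = 1 := by
    intro c s J hJ hcs
    simp only [add_mul, mul_add, smul_mul_smul_comm, hJ, mul_one, one_mul]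
    have : (c * c) • (1 : 𝓜(ℂ, B)) + (c * -s) • J + ((s * c) • J + (s * -s) • (-1 : 𝓜(ℂ, B))) =
        (c * c + s * s) • (1 : 𝓜(ℂ, B)) := by module
    rw [hcs, one_smul] at this
    refine Eq.trans ?_ this
    abel
  have h2 := h (Real.cos (Real.pi / 2 * r) : ℝ) (Real.sin (Real.pi / 2 * r) : ℝ) _
    t.quarterTurn_mul_self (by
      norm_cast
      linarith [Real.sin_sq_add_cos_sq (Real.pi / 2 * r)])
  simpa [rotation] using h2

theorem rotation_mem_unitary (r : ℝ) : t.rotation r ∈ unitary 𝓜(ℂ, B) := by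
  have h := t.rotation_mul_rotation_neg (-r)
  rw [neg_neg] at h
  rw [Unitary.mem_iff, star_rotation]
  exact ⟨h, t.rotation_mul_rotation_neg r⟩

theorem rotation_conj_diagonal (r : ℝ) (a : 𝓜(ℂ, B)) :
    t.rotation r * t.sum a a * star (t.rotation r) = t.sum a a := by
  have h : t.rotation r * t.sum a a = t.sum a a * t.rotation r := by
    simp only [rotation, add_mul, mul_add, smul_mul_assoc, mul_smul_comm, one_mul, mul_one,
      quarterTurn_mul_sum, sum_mul_quarterTurn]
  rw [h, mul_assoc, (Unitary.mem_iff.1 (t.rotation_mem_unitary r)).2, mul_one]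

theorem rotation_one_conj (a b : 𝓜(ℂ, B)) :
    t.rotation 1 * t.sum b a * star (t.rotation 1) = t.sum a b := by
  have h1 : t.rotation 1 = t.t₂ * star t.t₁ - t.t₁ * star t.t₂ := by simp [rotation]
  have h : (t.t₂ * b * star t.t₁ - t.t₁ * a * star t.t₂) *
      (t.t₂ * star t.t₁ - t.t₁ * star t.t₂) =
      t.t₂ * b * (star t.t₁ * t.t₂) * star t.t₁ - t.t₂ * b * (star t.t₁ * t.t₁) * star t.t₂ -
      t.t₁ * a * (star t.t₂ * t.t₂) * star t.t₁ + t.t₁ * a * (star t.t₂ * t.t₁) * star t.t₂ := by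
    noncomm_ring
  rw [h1, star_quarterTurn, quarterTurn_mul_sum, mul_neg, h, t.isometry₁, t.isometry₂, t.orth₁₂,
    t.orth₂₁, sum]
  noncomm_ring

/-- Subtracting the diagonal `b ⊕ b`, which commutes with rotations, leaves only terms in `a - b`.
Hence rotating one side of `(x ⊕ y, y ⊕ x)` keeps a Cuntz pair when `(x, y)` is one. -/
theorem sum_sub_rotation_conj (r : ℝ) (a b : 𝓜(ℂ, B)) :
    t.sum a b - t.rotation r * t.sum b a * star (t.rotation r) =
      t.sum (a - b) 0 - t.rotation r * t.sum 0 (a - b) * star (t.rotation r) := by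
  have h1 : t.sum a b = t.sum b b + t.sum (a - b) 0 := by rw [sum_add_sum]; simp
  have h2 : t.sum b a = t.sum b b + t.sum 0 (a - b) := by rw [sum_add_sum]; simp
  rw [h2, mul_add, add_mul, rotation_conj_diagonal, h1]
  abel

theorem isCuntzPair_sumRep_comm {x y : CocycleRep α β} (h : IsCuntzPair x y) :
    IsCuntzPair (t.sumRep x y) (t.sumRep y x) := by
  refine ⟨fun a => ?_, fun g => ?_⟩
  · rw [sumRep_φ, sumRep_φ, sum_sub_sum]
    exact t.inIdeal_sum (h.1 a) (by simpa using (h.1 a).neg)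
  · rw [sumRep_u, sumRep_u, sum_sub_sum]
    exact t.inIdeal_sum (h.2 g) (by simpa using (h.2 g).neg)

theorem homotopic_rotation [IsTopologicalGroup G] {x y : CocycleRep α β} (h : IsCuntzPair x y)
    (h' : IsCuntzPair (t.sumRep x y) (t.sumRep x y)) :
    Homotopic ⟨t.sumRep x y, t.sumRep y x, t.isCuntzPair_sumRep_comm h⟩
      ⟨t.sumRep x y, t.sumRep x y, h'⟩ := by
  have hc : Continuous fun s : I => t.rotation s := t.continuous_rotation.comp (by fun_prop)
  have hu : ∀ s : I, t.rotation s ∈ unitary 𝓜(ℂ, B) := fun s => t.rotation_mem_unitary _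
  have hid : ∀ (s : I) (m : 𝓜(ℂ, B)), InIdeal m →
      InIdeal (t.sum m 0 - t.rotation s * t.sum 0 m * star (t.rotation s)) := fun s m hm =>
    (t.inIdeal_sum hm InIdeal.zero).sub ((t.inIdeal_sum InIdeal.zero hm).mul_mul _ _)
  refine IsHomotopy.homotopic (P := fun _ => t.sumRep x y)
    (Q := fun s => (t.sumRep y x).conj (t.rotation s) (hu s))
    ⟨.const _, isRepPath_conj _ (strictlyContinuous_iff.2 fun s =>
      .of_continuousAt hc.continuousAt) hu, fun s => ⟨fun a => ?_, fun g => ?_⟩, fun a => ?_,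
      fun g => ?_⟩ rfl ?_ rfl ?_
  · rw [CocycleRep.conj_φ, sumRep_φ, sumRep_φ, sum_sub_rotation_conj]
    exact hid s _ (h.1 a)
  · rw [CocycleRep.conj_u, sumRep_u, sumRep_u, ext_rotation, sum_sub_rotation_conj]
    exact hid s _ (h.2 g)
  · simp only [CocycleRep.conj_φ]
    fun_prop
  · simp only [CocycleRep.conj_u, ext_rotation]
    fun_prop
  · refine CocycleRep.ext_iff'.2 ⟨fun a => ?_, fun g => ?_⟩
    · simp [CocycleRep.conj_φ, rotation_zero]
    · simp [CocycleRep.conj_u, rotation_zero]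
  · refine CocycleRep.ext_iff'.2 ⟨fun a => ?_, fun g => ?_⟩
    · rw [CocycleRep.conj_φ, sumRep_φ]
      exact t.rotation_one_conj _ _
    · rw [CocycleRep.conj_u, sumRep_u, ext_rotation]
      exact t.rotation_one_conj _ _

end CuntzIsometries

theorem IsCuntzPair.refl (x : CocycleRep α β) : IsCuntzPair x x :=
  ⟨fun a => by rw [sub_self]; exact InIdeal.zero, fun g => by rw [sub_self]; exact InIdeal.zero⟩

theorem IsCuntzPair.symm {x y : CocycleRep α β} (h : IsCuntzPair x y) : IsCuntzPair y x :=
  ⟨fun a => by simpa using (h.1 a).neg, fun g => by simpa using (h.2 g).neg⟩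

/-- The pair `((0, v), (0, u))`, which is inverse to the cocycle pair of `((φ, u), (ψ, v))`. -/
def CuntzPair.inverseCocyclePair (x : CuntzPair α β) : CuntzPair α β where
  fst := x.snd.zeroPart
  snd := x.fst.zeroPart
  isCuntzPair := x.cocyclePair.isCuntzPair.symm

variable {t : CuntzIsometries β}

/-- The cocycle pair of the sum is `(u ⊕ v, v ⊕ u)`. A rotation makes its two entries equal, and
pairs with equal entries are null-homotopic. -/
theorem CuntzIsometries.IsPure.isAnchored_sum [IsTopologicalGroup G] (ht : t.IsPure) (x : CuntzPair α β) :
    IsAnchored (CuntzPair.sum t x x.inverseCocyclePair) := by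
  have h1 := t.homotopic_rotation x.cocyclePair.isCuntzPair (IsCuntzPair.refl _)
  have h2 := h1.trans (ht.homotopic_zero _ _)
  have hz : ∀ p q : CocycleRep α β,
      (t.sumRep p q.zeroPart).zeroPart = t.sumRep p.zeroPart q.zeroPart := fun p q =>
    CocycleRep.ext_iff'.2 ⟨fun a => by
      change (0 : 𝓜(ℂ, B)) = t.sum 0 0
      simp [CuntzIsometries.sum], fun g => rfl⟩
  have he : (CuntzPair.sum t x x.inverseCocyclePair).cocyclePair =
      ⟨t.sumRep x.cocyclePair.fst x.cocyclePair.snd, t.sumRep x.cocyclePair.snd x.cocyclePair.fst,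
        t.isCuntzPair_sumRep_comm x.cocyclePair.isCuntzPair⟩ := by
    have e1 := hz x.fst x.snd
    have e2 := hz x.snd x.fst
    unfold CuntzPair.cocyclePair
    congr 1
  rw [IsAnchored, he]
  exact h2

theorem CuntzPair.isCocyclePair_zero : (CuntzPair.zero α β).IsCocyclePair := ⟨rfl, rfl⟩

theorem Homotopic.kkClass_eq (t : CuntzIsometries β) {x y : CuntzPair α β} (h : Homotopic x y) :
    x.kkClass = y.kkClass :=
  Quot.sound ⟨t, CuntzPair.zero α β, CuntzPair.zero α β, CuntzPair.isCocyclePair_zero,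
    CuntzPair.isCocyclePair_zero, h.sum t (Homotopic.refl _)⟩

/-- Stabilise `x` by `d` and `x ⊕ d` by `0`: the results `x ⊕ d` and `(x ⊕ d) ⊕ 0` are homotopic. -/
theorem CuntzIsometries.IsPure.kkClass_sum (ht : t.IsPure) (x d : CuntzPair α β)
    (hd : d.IsCocyclePair) : (CuntzPair.sum t x d).kkClass = x.kkClass :=
  (Quot.sound ⟨t, d, CuntzPair.zero α β, hd, CuntzPair.isCocyclePair_zero,
    ht.homotopic_sum_zero _⟩ : x.kkClass = _).symm

theorem CuntzIsometries.IsPure.exists_absorbing_homotopic [IsTopologicalGroup G]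
    [LocallyCompactSpace G] (ht : t.IsPure) {θ : CocycleRep α β} (hθ : IsAbsorbing θ) (x : CuntzPair α β) :
    ∃ φ : CocycleRep α β, IsAbsorbing φ ∧ ∃ h : IsCuntzPair φ θ, Homotopic x ⟨φ, θ, h⟩ := by
  set d : CuntzPair α β := ⟨θ, θ, IsCuntzPair.refl θ⟩ with hd
  have h1 : Homotopic x (CuntzPair.sum t x d) := (ht.homotopic_sum_zero x).trans
    ((Homotopic.refl x).sum t (ht.homotopic_zero θ _).symm)
  have habs : ∀ y : CocycleRep α β, AsymptoticEquiv (t.sumRep y θ) θ := fun y => by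
    -- Absorption chooses its own isometries `s` and puts `θ` first; the swap passes to `t` and to
    -- `θ` in second place.
    obtain ⟨s, hs⟩ := hθ y
    exact (CuntzIsometries.asymptoticEquiv_sumRep_comm s t y θ).trans hs
  obtain ⟨w, hw, hp, h2⟩ := (habs x.snd).exists_homotopic (CuntzPair.sum t x d).isCuntzPair
  refine ⟨_, ?_, hp, (h1.trans (ht.homotopic_conj _ hw)).trans h2⟩
  -- The chain is `θ ∼ φ ⊕ θ ∼ w (φ ⊕ θ) w*`, with `φ` the first component of `x`.
  exact hθ.of_asymptoticEquiv ((habs x.fst).symm.trans (CocycleRep.asymptoticEquiv_conj _ hw))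

end Main

/-! ### Shifts of the standard basis of `ℓ²(ℕ)` -/

section SequenceSpace

/-- The standard orthonormal basis of `ℓ²(ℕ)`. -/
def stdBasis (k : ℕ) : Hil := lp.single 2 k 1

theorem inner_stdBasis (k : ℕ) (ξ : Hil) : inner ℂ (stdBasis k) ξ = ξ k := by
  rw [stdBasis, lp.inner_single_left]
  simp

theorem orthonormal_stdBasis : Orthonormal ℂ stdBasis := by
  rw [orthonormal_iff_ite]
  intro i j
  rw [inner_stdBasis, stdBasis, lp.single_apply, Pi.single_apply]

/-- The isometry of `ℓ²(ℕ)` that maps `e_k` to `e_{f k}`. -/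
def basisShift (f : ℕ → ℕ) (hf : Function.Injective f) : Hil →L[ℂ] Hil :=
  ((orthonormal_stdBasis.comp f hf).orthogonalFamily.linearIsometry).toContinuousLinearMap

variable {f h : ℕ → ℕ} (hf : Function.Injective f) (hh : Function.Injective h)

theorem basisShift_stdBasis (k : ℕ) : basisShift f hf (stdBasis k) = stdBasis (f k) := by
  refine (OrthogonalFamily.linearIsometry_apply_single
    (orthonormal_stdBasis.comp f hf).orthogonalFamily (1 : ℂ)).trans ?_
  rw [LinearIsometry.toSpanSingleton_apply, one_smul]
  rfl

theorem isometry_basisShift : star (basisShift f hf) * basisShift f hf = 1 :=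
  (ContinuousLinearMap.norm_map_iff_adjoint_comp_self (basisShift f hf)).1 fun x =>
    LinearIsometry.norm_map _ x

theorem star_basisShift_apply (ξ : Hil) (k : ℕ) : (star (basisShift f hf) ξ : Hil) k = ξ (f k) := by
  rw [← inner_stdBasis, ContinuousLinearMap.star_eq_adjoint,
    ContinuousLinearMap.adjoint_inner_right, basisShift_stdBasis, inner_stdBasis]

theorem star_basisShift_mul (hfh : ∀ j k, f j ≠ h k) :
    star (basisShift f hf) * basisShift h hh = 0 := by
  have h0 : ∀ j, (star (basisShift h hh)) (stdBasis (f j)) = 0 := fun j => by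
    refine lp.ext (funext fun k => ?_)
    rw [star_basisShift_apply, stdBasis, lp.single_apply, Pi.single_apply,
      if_neg (hfh j k).symm]
    rfl
  refine ContinuousLinearMap.ext fun ξ => lp.ext (funext fun j => ?_)
  change (star (basisShift f hf) (basisShift h hh ξ) : Hil) j = 0
  rw [star_basisShift_apply, ← inner_stdBasis, ← ContinuousLinearMap.adjoint_inner_left,
    ← ContinuousLinearMap.star_eq_adjoint, h0, inner_zero_left]

theorem injective_even : Function.Injective fun k : ℕ => 2 * k := fun a b h => by
  dsimp only at h; omega

theorem injective_odd : Function.Injective fun k : ℕ => 2 * k + 1 := fun a b h => by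
  dsimp only at h; omega

theorem basisShift_even_add_odd :
    basisShift _ injective_odd * star (basisShift _ injective_odd) +
      basisShift _ injective_even * star (basisShift _ injective_even) = 1 := by
  refine ContinuousLinearMap.ext fun ξ => ext_inner_left ℂ fun η => ?_
  change inner ℂ η (basisShift _ injective_odd (star (basisShift _ injective_odd) ξ) +
    basisShift _ injective_even (star (basisShift _ injective_even) ξ)) = inner ℂ η ξ
  have h0 : ∀ T : Hil →L[ℂ] Hil, inner ℂ η (T (star T ξ)) = inner ℂ (star T η) (star T ξ) :=
    fun T => by rw [ContinuousLinearMap.star_eq_adjoint, ContinuousLinearMap.adjoint_inner_left]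
  rw [inner_add_right, h0, h0, add_comm]
  have h1 := lp.hasSum_inner (𝕜 := ℂ) (star (basisShift _ injective_even) η)
    (star (basisShift _ injective_even) ξ)
  have h2 := lp.hasSum_inner (𝕜 := ℂ) (star (basisShift _ injective_odd) η)
    (star (basisShift _ injective_odd) ξ)
  simp only [star_basisShift_apply] at h1 h2
  exact (HasSum.even_add_odd (f := fun k => inner ℂ (η k) (ξ k)) h1 h2).unique
    (lp.hasSum_inner (𝕜 := ℂ) η ξ)

theorem norm_star_clm (T : Hil →L[ℂ] Hil) : ‖star T‖ = ‖T‖ :=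
  LinearIsometryEquiv.norm_map ContinuousLinearMap.adjoint T

theorem norm_le_one_of_star_mul_self {T : Hil →L[ℂ] Hil} (hT : star T * T = 1) : ‖T‖ ≤ 1 := by
  have h := CStarRing.norm_star_mul_self (x := T)
  have h1 : ‖(1 : Hil →L[ℂ] Hil)‖ ≤ 1 := ContinuousLinearMap.norm_id_le
  rw [hT] at h
  nlinarith [norm_nonneg T]

/-- Each application of `k ↦ 2k + 1` raises the index by at least one, so the `n`-th power of the
adjoint annihilates the first `n` coordinates. The map `k ↦ 2k` fixes `0` and would not do. -/
theorem star_odd_pow_apply (n : ℕ) (ξ : Hil) (k : ℕ) :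
    ∃ m, n ≤ m ∧ (star (basisShift _ injective_odd ^ n) ξ : Hil) k = ξ m := by
  induction n generalizing ξ with
  | zero => exact ⟨k, Nat.zero_le _, by simp⟩
  | succ n ih =>
    obtain ⟨m, hm, he⟩ := ih (star (basisShift _ injective_odd) ξ)
    refine ⟨2 * m + 1, by omega, ?_⟩
    rw [pow_succ', star_mul]
    exact he.trans (star_basisShift_apply _ _ _)

theorem tendsto_star_odd_pow (ξ : Hil) :
    Tendsto (fun n : ℕ => star (basisShift _ injective_odd ^ n) ξ) atTop (𝓝 0) := by
  have h1 := (lp.hasSum_single (p := 2) (by norm_num) ξ).tendsto_sum_nat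
  have h2 : Tendsto (fun n => ‖ξ - ∑ i ∈ Finset.range n, lp.single 2 i (ξ i)‖) atTop (𝓝 0) := by
    have := (tendsto_const_nhds (x := ξ)).sub h1
    rw [sub_self] at this
    simpa using this.norm
  refine squeeze_zero_norm (fun n => ?_) h2
  have h3 : ∀ i ∈ Finset.range n,
      star (basisShift _ injective_odd ^ n) (lp.single 2 i (ξ i) : Hil) = 0 := by
    intro i hi
    refine lp.ext (funext fun k => ?_)
    obtain ⟨m, hm, he⟩ := star_odd_pow_apply n (lp.single 2 i (ξ i)) k
    rw [he, lp.single_apply, Pi.single_apply, if_neg]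
    · rfl
    · rw [Finset.mem_range] at hi
      omega
  have h4 : star (basisShift _ injective_odd ^ n) ξ = star (basisShift _ injective_odd ^ n)
      (ξ - ∑ i ∈ Finset.range n, lp.single 2 i (ξ i)) := by
    rw [map_sub, map_sum, Finset.sum_eq_zero h3, sub_zero]
  rw [h4]
  refine (ContinuousLinearMap.le_opNorm _ _).trans (mul_le_of_le_one_left (norm_nonneg _) ?_)
  rw [norm_star_clm]
  exact norm_le_one_of_star_mul_self (star_pow_mul_pow (isometry_basisShift _) n)

/-- A strongly null sequence of contractions is uniformly null on the totally bounded image of the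
unit ball. -/
theorem tendsto_norm_mul_compact {T : ℕ → Hil →L[ℂ] Hil} (hT : ∀ n, ‖T n‖ ≤ 1)
    (hT0 : ∀ ξ, Tendsto (fun n => T n ξ) atTop (𝓝 0)) {k : Hil →L[ℂ] Hil}
    (hk : IsCompactOperator k) : Tendsto (fun n => T n * k) atTop (𝓝 0) := by
  have hK := (isCompactOperator_iff_isCompact_closure_image_closedBall
    (k : Hil →ₗ[ℂ] Hil) one_pos).1 hk
  refine Metric.tendsto_nhds.2 fun ε hε => ?_
  obtain ⟨u, hu, hcov⟩ := Metric.totallyBounded_iff.1 hK.totallyBounded (ε / 4) (by positivity)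
  have h1 : ∀ᶠ n in atTop, ∀ y ∈ u, ‖T n y‖ < ε / 4 :=
    (hu.eventually_all).2 fun y _ => by
      have := (hT0 y).norm
      rw [norm_zero] at this
      exact this.eventually (Iio_mem_nhds (by positivity))
  filter_upwards [h1] with n hn
  rw [dist_zero_right]
  refine lt_of_le_of_lt (ContinuousLinearMap.opNorm_le_of_unit_norm (C := ε / 2) (by positivity)
    fun x hx => ?_) (by linarith)
  have hx' : k x ∈ closure ((k : Hil →ₗ[ℂ] Hil) '' Metric.closedBall 0 1) :=
    subset_closure ⟨x, by simp [hx], rfl⟩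
  obtain ⟨y, hy, hxy⟩ := Set.mem_iUnion₂.1 (hcov hx')
  rw [Metric.mem_ball, dist_eq_norm] at hxy
  have h2 : (T n * k) x = T n (k x - y) + T n y := by rw [map_sub, sub_add_cancel]; rfl
  have h3 : ‖T n (k x - y)‖ ≤ ‖k x - y‖ :=
    ((T n).le_opNorm _).trans (mul_le_of_le_one_left (norm_nonneg _) (hT n))
  rw [h2]
  have h4 := hn y hy
  exact (norm_add_le _ _).trans (by linarith)

end SequenceSpace

/-! ### Amplified operators as multipliers under strong stability -/

section Amplification

variable {G B : Type*} [Group G] [TopologicalSpace G] [NonUnitalCStarAlgebra B]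

instance : NonUnitalNonAssocSemiring (B ⊗[ℂ] compacts) := inferInstance

instance : Distrib (B ⊗[ℂ] compacts) := inferInstance

instance : MulZeroClass (B ⊗[ℂ] compacts) := inferInstance

/-- Left multiplication of compact operators by a bounded operator. -/
def leftMulCompacts (T : Hil →L[ℂ] Hil) : compacts →ₗ[ℂ] compacts where
  toFun k := ⟨T * k, IsCompactOperator.clm_comp k.2 T⟩
  map_add' k l := Subtype.ext (mul_add T k l)
  map_smul' c k := Subtype.ext (mul_smul_comm c T k)

/-- Right multiplication of compact operators by a bounded operator. -/
def rightMulCompacts (T : Hil →L[ℂ] Hil) : compacts →ₗ[ℂ] compacts where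
  toFun k := ⟨k * T, IsCompactOperator.comp_clm k.2 T⟩
  map_add' k l := Subtype.ext (add_mul (k : Hil →L[ℂ] Hil) l T)
  map_smul' c k := Subtype.ext (smul_mul_assoc c (k : Hil →L[ℂ] Hil) T)

/-- Left multiplication by `1 ⊗ T` on the algebraic tensor product `B ⊗ 𝒦`. -/
def leftAmplify (T : Hil →L[ℂ] Hil) : (B ⊗[ℂ] compacts) →ₗ[ℂ] (B ⊗[ℂ] compacts) :=
  (leftMulCompacts T).lTensor B

/-- Right multiplication by `1 ⊗ T` on the algebraic tensor product `B ⊗ 𝒦`. -/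
def rightAmplify (T : Hil →L[ℂ] Hil) : (B ⊗[ℂ] compacts) →ₗ[ℂ] (B ⊗[ℂ] compacts) :=
  (rightMulCompacts T).lTensor B

theorem leftAmplify_tmul (T : Hil →L[ℂ] Hil) (b : B) (k : compacts) :
    leftAmplify T (b ⊗ₜ[ℂ] k) = b ⊗ₜ[ℂ] leftMulCompacts T k := rfl

theorem rightAmplify_tmul (T : Hil →L[ℂ] Hil) (b : B) (k : compacts) :
    rightAmplify T (b ⊗ₜ[ℂ] k) = b ⊗ₜ[ℂ] rightMulCompacts T k := rfl

theorem star_rightAmplify (T : Hil →L[ℂ] Hil) (x : B ⊗[ℂ] compacts) :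
    star (rightAmplify T x) = leftAmplify (star T) (star x) := by
  induction x with
  | zero => simp
  | tmul b k =>
    rw [rightAmplify_tmul, TensorProduct.star_tmul, TensorProduct.star_tmul, leftAmplify_tmul]
    congr 1
    exact Subtype.ext (star_mul (k : Hil →L[ℂ] Hil) T)
  | add x y hx hy => rw [map_add, star_add, hx, hy, star_add, map_add]

theorem rightAmplify_mul (T : Hil →L[ℂ] Hil) (x y : B ⊗[ℂ] compacts) :
    rightAmplify T x * y = x * leftAmplify T y := by
  induction x with
  | zero => simp
  | add x x' hx hx' => rw [map_add, add_mul, add_mul, hx, hx']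
  | tmul b k =>
    induction y with
    | zero => simp
    | add y y' hy hy' => rw [map_add, mul_add, mul_add, hy, hy']
    | tmul c l =>
      rw [rightAmplify_tmul, leftAmplify_tmul, Algebra.TensorProduct.tmul_mul_tmul,
        Algebra.TensorProduct.tmul_mul_tmul]
      exact congrArg (_ ⊗ₜ[ℂ] ·) (Subtype.ext (mul_assoc (k : Hil →L[ℂ] Hil) T l))

theorem leftAmplify_mul_apply (S T : Hil →L[ℂ] Hil) (x : B ⊗[ℂ] compacts) :
    leftAmplify (S * T) x = leftAmplify S (leftAmplify T x) := by
  induction x with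
  | zero => simp
  | add x y hx hy => simp only [map_add, hx, hy]
  | tmul b k => rfl

theorem leftAmplify_one (x : B ⊗[ℂ] compacts) : leftAmplify 1 x = x := by
  induction x with
  | zero => simp
  | add x y hx hy => simp only [map_add, hx, hy]
  | tmul b k => rfl

theorem leftAmplify_sum_smul {ι : Type*} (s : Finset ι) (c : ι → ℂ) (T : ι → Hil →L[ℂ] Hil)
    (x : B ⊗[ℂ] compacts) :
    leftAmplify (∑ i ∈ s, c i • T i) x = ∑ i ∈ s, c i • leftAmplify (T i) x := by
  induction x with
  | zero => simp
  | add x y hx hy => simp only [map_add, hx, hy, smul_add, Finset.sum_add_distrib]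
  | tmul b k =>
    simp only [leftAmplify_tmul, ← TensorProduct.tmul_smul, ← TensorProduct.tmul_sum]
    congr 1
    refine Subtype.ext ?_
    have h : ((∑ i ∈ s, c i • leftMulCompacts (T i) k : compacts) : Hil →L[ℂ] Hil) =
        ∑ i ∈ s, c i • (T i * (k : Hil →L[ℂ] Hil)) := by
      rw [AddSubmonoidClass.coe_finsetSum]
      rfl
    rw [h]
    change (∑ i ∈ s, c i • T i) * (k : Hil →L[ℂ] Hil) = _
    simp only [Finset.sum_mul, smul_mul_assoc]

variable {ι : (B ⊗[ℂ] compacts) →⋆ₙₐ[ℂ] B}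

/-- Since `((1 ⊗ T) x)* ((1 ⊗ T) x) = x* x`, the C*-identity in `B` decides, and nothing needs to be
known about the norm on the tensor product. -/
theorem norm_map_leftAmplify {T : Hil →L[ℂ] Hil} (hT : star T * T = 1) (x : B ⊗[ℂ] compacts) :
    ‖ι (leftAmplify T x)‖ = ‖ι x‖ := by
  have h : star (leftAmplify T x) * leftAmplify T x = star x * x := by
    have h1 : star (leftAmplify T x) = rightAmplify (star T) (star x) := by
      rw [← star_star (rightAmplify _ _), star_rightAmplify, star_star, star_star]
    rw [h1, rightAmplify_mul, ← leftAmplify_mul_apply, hT, leftAmplify_one]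
  have h2 : ‖ι (leftAmplify T x)‖ * ‖ι (leftAmplify T x)‖ = ‖ι x‖ * ‖ι x‖ := by
    rw [← CStarRing.norm_star_mul_self, ← CStarRing.norm_star_mul_self, ← map_star ι, ← map_star ι,
      ← map_mul ι, ← map_mul ι, h]
  exact (mul_self_inj (norm_nonneg _) (norm_nonneg _)).1 h2

/-- Every bounded operator is a linear combination of four unitaries, which reduces the bound to the
isometric case. -/
theorem exists_norm_leftAmplify_le (T : Hil →L[ℂ] Hil) :
    ∃ C, ∀ x, ‖ι (leftAmplify T x)‖ ≤ C * ‖ι x‖ := by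
  obtain ⟨u, c, hT, -⟩ := CStarAlgebra.exists_sum_four_unitary T
  refine ⟨∑ i, ‖c i‖, fun x => ?_⟩
  rw [hT, leftAmplify_sum_smul, map_sum, Finset.sum_mul]
  refine (norm_sum_le _ _).trans (Finset.sum_le_sum fun i _ => ?_)
  rw [map_smul, norm_smul, norm_map_leftAmplify (Unitary.mem_iff.1 (u i).2).1]

theorem exists_norm_rightAmplify_le (T : Hil →L[ℂ] Hil) :
    ∃ C, ∀ x, ‖ι (rightAmplify T x)‖ ≤ C * ‖ι x‖ := by
  obtain ⟨C, hC⟩ := exists_norm_leftAmplify_le (ι := ι) (star T)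
  refine ⟨C, fun x => ?_⟩
  rw [← norm_star, ← map_star ι, star_rightAmplify, ← norm_star (ι x), ← map_star ι]
  exact hC _

/-- The linear map underlying `ι`. -/
def tensorLinearMap (ι : (B ⊗[ℂ] compacts) →⋆ₙₐ[ℂ] B) : (B ⊗[ℂ] compacts) →ₗ[ℂ] B where
  toFun := ι
  map_add' := map_add ι
  map_smul' := map_smul ι

/-- The multiplier `1 ⊗ T` of `B ≅ B ⊗ 𝒦`. -/
def amplify (hι : DenseRange ι) (T : Hil →L[ℂ] Hil) : 𝓜(ℂ, B) where
  fst := (tensorLinearMap ι ∘ₗ leftAmplify T).extendOfNorm (tensorLinearMap ι)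
  snd := (tensorLinearMap ι ∘ₗ rightAmplify T).extendOfNorm (tensorLinearMap ι)
  central := by
    have hl := fun y => LinearMap.extendOfNorm_eq (f := tensorLinearMap ι ∘ₗ leftAmplify T)
      (e := tensorLinearMap ι) hι (exists_norm_leftAmplify_le T) y
    have hr := fun y => LinearMap.extendOfNorm_eq (f := tensorLinearMap ι ∘ₗ rightAmplify T)
      (e := tensorLinearMap ι) hι (exists_norm_rightAmplify_le T) y
    intro x y
    refine hι.induction_on₂
      (p := fun x y => ((tensorLinearMap ι ∘ₗ rightAmplify T).extendOfNorm (tensorLinearMap ι)) x * y =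
        x * ((tensorLinearMap ι ∘ₗ leftAmplify T).extendOfNorm (tensorLinearMap ι)) y)
      (isClosed_eq (((ContinuousLinearMap.continuous _).comp continuous_fst).mul continuous_snd)
        (continuous_fst.mul ((ContinuousLinearMap.continuous _).comp continuous_snd)))
      (fun x y => ?_) x y
    refine (congrArg (· * ι y) (hr x)).trans (Eq.trans ?_ (congrArg (ι x * ·) (hl y)).symm)
    change ι (rightAmplify T x) * ι y = ι x * ι (leftAmplify T y)
    rw [← map_mul ι, rightAmplify_mul, map_mul ι]

theorem amplify_fst (hι : DenseRange ι) (T : Hil →L[ℂ] Hil) (x : B ⊗[ℂ] compacts) :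
    (amplify hι T).fst (ι x) = ι (leftAmplify T x) :=
  LinearMap.extendOfNorm_eq (f := tensorLinearMap ι ∘ₗ leftAmplify T)
    (e := tensorLinearMap ι) hι (exists_norm_leftAmplify_le T) x

theorem amplify_snd (hι : DenseRange ι) (T : Hil →L[ℂ] Hil) (x : B ⊗[ℂ] compacts) :
    (amplify hι T).snd (ι x) = ι (rightAmplify T x) :=
  LinearMap.extendOfNorm_eq (f := tensorLinearMap ι ∘ₗ rightAmplify T)
    (e := tensorLinearMap ι) hι (exists_norm_rightAmplify_le T) x

theorem multiplier_ext_dense (hι : DenseRange ι) {m n : 𝓜(ℂ, B)}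
    (h : ∀ x, m.fst (ι x) = n.fst (ι x)) : m = n :=
  multiplier_ext fun b => congrFun (hι.equalizer m.fst.continuous n.fst.continuous (funext h)) b

theorem amplify_mul (hι : DenseRange ι) (S T : Hil →L[ℂ] Hil) :
    amplify hι (S * T) = amplify hι S * amplify hι T :=
  multiplier_ext_dense hι fun x => by
    change _ = (amplify hι S).fst ((amplify hι T).fst (ι x))
    rw [amplify_fst, amplify_fst, amplify_fst, leftAmplify_mul_apply]

theorem amplify_one (hι : DenseRange ι) : amplify hι 1 = 1 :=
  multiplier_ext_dense hι fun x => by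
    rw [amplify_fst, leftAmplify_one]
    rfl

theorem amplify_add (hι : DenseRange ι) (S T : Hil →L[ℂ] Hil) :
    amplify hι (S + T) = amplify hι S + amplify hι T :=
  multiplier_ext_dense hι fun x => by
    change _ = (amplify hι S).fst (ι x) + (amplify hι T).fst (ι x)
    rw [amplify_fst, amplify_fst, amplify_fst, ← map_add]
    congr 1
    simpa using leftAmplify_sum_smul Finset.univ (fun _ : Fin 2 => 1) ![S, T] x

theorem star_amplify (hι : DenseRange ι) (T : Hil →L[ℂ] Hil) :
    star (amplify hι T) = amplify hι (star T) :=
  multiplier_ext_dense hι fun x => by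
    rw [DoubleCentralizer.star_fst, amplify_fst, ← map_star ι, amplify_snd, ← map_star ι,
      star_rightAmplify, star_star]

theorem ext_amplify (hι : DenseRange ι) {β : CStarAction G B}
    (hβ : ∀ (g : G) (b : B) (k : compacts), β.toHom g (ι (b ⊗ₜ[ℂ] k)) = ι (β.toHom g b ⊗ₜ[ℂ] k))
    (g : G) (T : Hil →L[ℂ] Hil) : β.ext g (amplify hι T) = amplify hι T := by
  refine multiplier_ext_dense hι fun x => ?_
  induction x with
  | zero => simp
  | add x y hx hy => simp only [map_add, hx, hy]
  | tmul b k =>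
    rw [ext_fst_apply, hβ, amplify_fst, leftAmplify_tmul, hβ, amplify_fst, leftAmplify_tmul,
      map_inv]
    congr 2
    exact (β.toHom g).apply_symm_apply b

theorem injective_pair (n : ℕ) : Function.Injective (Nat.pair n) := fun _ _ h =>
  (Nat.pair_eq_pair.1 h).2

/-- A summable sequence of compact operators can be stored in a single compact operator, from which
each of them is recovered by the adjoint of an isometry. -/
theorem exists_compact_of_norm_le (k : ℕ → compacts)
    (hk : ∀ n, ‖(k n : Hil →L[ℂ] Hil)‖ ≤ (1 / 2) ^ n) :
    ∃ (V : ℕ → Hil →L[ℂ] Hil) (K : compacts), (∀ n, star (V n) * V n = 1) ∧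
      ∀ n, leftMulCompacts (star (V n)) K = k n := by
  obtain ⟨V, hV, hV0⟩ : ∃ V : ℕ → Hil →L[ℂ] Hil, (∀ n, star (V n) * V n = 1) ∧
      ∀ m n, m ≠ n → star (V m) * V n = 0 :=
    -- The pairing function splits `ℕ` into infinitely many disjoint infinite sets, giving
    -- isometries with pairwise orthogonal ranges.
    ⟨fun n => basisShift _ (injective_pair n), fun n => isometry_basisShift _,
      fun m n hmn => star_basisShift_mul _ _ fun i j hij => hmn (Nat.pair_eq_pair.1 hij).1⟩
  have hF : ∀ n, ‖V n * (k n : Hil →L[ℂ] Hil)‖ ≤ (1 / 2) ^ n := fun n =>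
    ((norm_mul_le _ _).trans (mul_le_of_le_one_left (norm_nonneg _)
      (norm_le_one_of_star_mul_self (hV n)))).trans (hk n)
  have hsum : Summable fun n => V n * (k n : Hil →L[ℂ] Hil) :=
    .of_norm_bounded summable_geometric_two hF
  have hcomp : IsCompactOperator (∑' n, V n * (k n : Hil →L[ℂ] Hil) : Hil →L[ℂ] Hil) := by
    have hcl : IsClosed {f : Hil →L[ℂ] Hil | IsCompactOperator f} :=
      isClosed_setOfPred_isCompactOperator
    refine hcl.mem_of_tendsto hsum.hasSum (Eventually.of_forall fun s => ?_)
    rw [Set.mem_ofPred_eq]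
    induction s using Finset.induction_on with
    | empty => exact isCompactOperator_zero
    | insert n s hn ih =>
      rw [Finset.sum_insert hn]
      exact IsCompactOperator.add (leftMulCompacts (V n) (k n)).2 ih
  refine ⟨V, ⟨_, hcomp⟩, hV, fun m => Subtype.ext ?_⟩
  change star (V m) * (∑' n, V n * (k n : Hil →L[ℂ] Hil)) = k m
  rw [← hsum.tsum_mul_left, tsum_eq_single m fun n hn => by
    rw [← mul_assoc, hV0 m n hn.symm, zero_mul], ← mul_assoc, hV, one_mul]

theorem norm_amplify_star_le_one (hι : DenseRange ι) {V : Hil →L[ℂ] Hil} (hV : star V * V = 1) :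
    ‖amplify hι (star V)‖ ≤ 1 := by
  rw [← star_amplify, norm_star]
  refine norm_le_one_of_isometry ?_
  rw [star_amplify, ← amplify_mul, hV, amplify_one]

/-- A gliding-hump argument takes the place of a cross-norm estimate. If no bound exists, choose `k
n` violating the constant `n 2ⁿ` and rescale them to norm `2⁻ⁿ`. All of them are stored in one
compact `K` and recovered by contractive multipliers, so the norms of their images, each exceeding
`n`, are bounded by `‖ι (b ⊗ K)‖`. -/
theorem exists_norm_tmul_le (hι : DenseRange ι) (b : B) :
    ∃ C, ∀ k : compacts, ‖ι (b ⊗ₜ[ℂ] k)‖ ≤ C * ‖(k : Hil →L[ℂ] Hil)‖ := by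
  by_contra hcon
  have hcon' : ∀ n : ℕ, ∃ k : compacts, n * 2 ^ n * ‖(k : Hil →L[ℂ] Hil)‖ < ‖ι (b ⊗ₜ[ℂ] k)‖ :=
    fun n => by
      by_contra h
      exact hcon ⟨n * 2 ^ n, fun k => not_lt.1 fun hk => h ⟨k, hk⟩⟩
  choose k hk using hcon'
  have hpos : ∀ n, 0 < 2 ^ n * ‖(k n : Hil →L[ℂ] Hil)‖ := fun n => by
    refine mul_pos (by positivity) (norm_pos_iff.2 fun h0 => ?_)
    have h2 := hk n
    rw [show k n = 0 from Subtype.ext h0, TensorProduct.tmul_zero, map_zero, norm_zero] at h2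
    exact (lt_irrefl _ (h2.trans_eq' (by rw [ZeroMemClass.coe_zero, norm_zero, mul_zero])))
  have hcn : ∀ n, ‖(((2 ^ n * ‖(k n : Hil →L[ℂ] Hil)‖)⁻¹ : ℝ) : ℂ)‖ =
      (2 ^ n * ‖(k n : Hil →L[ℂ] Hil)‖)⁻¹ := fun n => by
    rw [Complex.norm_real, Real.norm_of_nonneg (inv_nonneg.2 (hpos n).le)]
  obtain ⟨V, K, hV, hVK⟩ := exists_compact_of_norm_le
    (fun n => (((2 ^ n * ‖(k n : Hil →L[ℂ] Hil)‖)⁻¹ : ℝ) : ℂ) • k n) fun n => by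
      have h1 : 0 < ‖(k n : Hil →L[ℂ] Hil)‖ := pos_of_mul_pos_right (hpos n) (by positivity)
      change ‖_ • (k n : Hil →L[ℂ] Hil)‖ ≤ _
      rw [norm_smul, hcn, mul_inv, mul_assoc, inv_mul_cancel₀ h1.ne', mul_one, one_div, inv_pow]
  obtain ⟨m, hm⟩ := exists_nat_gt ‖ι (b ⊗ₜ[ℂ] K)‖
  have h3 : ‖ι (b ⊗ₜ[ℂ] leftMulCompacts (star (V m)) K)‖ < m := by
    rw [← leftAmplify_tmul, ← amplify_fst hι]
    exact ((norm_fst_apply_le _ _).trans (mul_le_of_le_one_left (norm_nonneg _)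
      (norm_amplify_star_le_one hι (hV m)))).trans_lt hm
  rw [hVK, TensorProduct.tmul_smul, map_smul, norm_smul, hcn, inv_mul_lt_iff₀ (hpos m)] at h3
  exact lt_irrefl _ (((hk m).trans h3).trans_eq (by ring))

/-- The pair of isometries `1 ⊗ S₁, 1 ⊗ S₂` of `M(B)` for a pair of isometries on `ℓ²(ℕ)`. -/
def amplifiedIsometries (hι : DenseRange ι) {β : CStarAction G B}
    (hβ : ∀ (g : G) (b : B) (k : compacts), β.toHom g (ι (b ⊗ₜ[ℂ] k)) = ι (β.toHom g b ⊗ₜ[ℂ] k)) :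
    CuntzIsometries β where
  -- The odd shift must come first: purity is demanded of `t₁`, and the even shift fixes a basis
  -- vector.
  t₁ := amplify hι (basisShift _ injective_odd)
  t₂ := amplify hι (basisShift _ injective_even)
  fixed₁ g := ext_amplify hι hβ g _
  fixed₂ g := ext_amplify hι hβ g _
  isometry₁ := by rw [star_amplify, ← amplify_mul, isometry_basisShift, amplify_one]
  isometry₂ := by rw [star_amplify, ← amplify_mul, isometry_basisShift, amplify_one]
  sum_eq_one := by
    rw [star_amplify, star_amplify, ← amplify_mul, ← amplify_mul, ← amplify_add,
      basisShift_even_add_odd, amplify_one]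

theorem amplify_pow (hι : DenseRange ι) (T : Hil →L[ℂ] Hil) (n : ℕ) :
    amplify hι (T ^ n) = amplify hι T ^ n := by
  induction n with
  | zero => rw [pow_zero, pow_zero, amplify_one]
  | succ n ih => rw [pow_succ, pow_succ, amplify_mul, ih]

/-- On elementary tensors `b ⊗ k` the powers act through `(S*)ⁿ k`, which tends to `0` in norm
because `k` is compact. Linearity, density and the uniform bound `1` extend this to all of `B`. -/
theorem isPure_amplifiedIsometries (hι : DenseRange ι) {β : CStarAction G B}
    (hβ : ∀ (g : G) (b : B) (k : compacts), β.toHom g (ι (b ⊗ₜ[ℂ] k)) = ι (β.toHom g b ⊗ₜ[ℂ] k)) :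
    (amplifiedIsometries hι hβ).IsPure := by
  set t := amplifiedIsometries hι hβ with ht
  set S := basisShift _ injective_odd with hS
  have hpow : ∀ n : ℕ, star (t.t₁ ^ n) = amplify hι (star (S ^ n)) := fun n => by
    rw [← star_amplify, amplify_pow]
    rfl
  have hn : ∀ n : ℕ, ‖star (t.t₁ ^ n)‖ ≤ 1 := fun n => by
    rw [norm_star]
    exact norm_le_one_of_isometry (t.isometry_pow n)
  have hx : ∀ x, Tendsto (fun n : ℕ => (star (t.t₁ ^ n)).fst (ι x)) atTop (𝓝 0) := by
    intro x
    induction x with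
    | zero => simp
    | add x y hx hy =>
      simp only [map_add]
      simpa using hx.add hy
    | tmul b k =>
      obtain ⟨C, hC⟩ := exists_norm_tmul_le hι b
      have h1 := tendsto_norm_mul_compact (T := fun n => star (S ^ n)) (fun n => by
        rw [norm_star_clm]
        exact norm_le_one_of_star_mul_self (star_pow_mul_pow (isometry_basisShift _) n))
        tendsto_star_odd_pow k.2
      have h2 := h1.norm.const_mul C
      rw [norm_zero, mul_zero] at h2
      refine squeeze_zero_norm (fun n => ?_) h2
      rw [hpow, amplify_fst, leftAmplify_tmul]
      exact hC _
  intro b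
  refine Metric.tendsto_nhds.2 fun ε hε => ?_
  obtain ⟨x, hxb⟩ := hι.exists_dist_lt b (half_pos hε)
  filter_upwards [Metric.tendsto_nhds.1 (hx x) _ (half_pos hε)] with n h1
  rw [dist_zero_right] at *
  rw [dist_eq_norm] at hxb
  have h2 : (star (t.t₁ ^ n)).fst b =
      (star (t.t₁ ^ n)).fst (b - ι x) + (star (t.t₁ ^ n)).fst (ι x) := by
    rw [map_sub, sub_add_cancel]
  have h3 : ‖(star (t.t₁ ^ n)).fst (b - ι x)‖ ≤ ‖b - ι x‖ :=
    (norm_fst_apply_le _ _).trans (mul_le_of_le_one_left (norm_nonneg _) (hn n))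
  rw [h2]
  exact (norm_add_le _ _).trans_lt (by linarith)

theorem StronglyStable.exists_isPure {β : CStarAction G B} (hβ : StronglyStable β) :
    ∃ t : CuntzIsometries β, t.IsPure := by
  obtain ⟨ι, -, hι, h⟩ := hβ
  exact ⟨amplifiedIsometries hι h, isPure_amplifiedIsometries hι h⟩

end Amplification

end CuntzThomsen

end

theorem corollary3p13 {G A B : Type*}
    [Group G] [TopologicalSpace G] [IsTopologicalGroup G] [T2Space G] [LocallyCompactSpace G]
    [SecondCountableTopology G]
    [NonUnitalCStarAlgebra A] [TopologicalSpace.SeparableSpace A]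
    [NonUnitalCStarAlgebra B] [TopologicalSpace.SeparableSpace B]
    (α : CuntzThomsen.CStarAction G A) (β : CuntzThomsen.CStarAction G B)
    (hβ : CuntzThomsen.StronglyStable β)
    (θ : CuntzThomsen.CocycleRep α β) (hθ : CuntzThomsen.IsAbsorbing θ) :
    (∀ x : CuntzThomsen.HomotopyClasses α β,
      ∃ φ : CuntzThomsen.CocycleRep α β, CuntzThomsen.IsAbsorbing φ ∧
        ∃ h : CuntzThomsen.IsCuntzPair φ θ,
          CuntzThomsen.CuntzPair.homotopyClass ⟨φ, θ, h⟩ = x) ∧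
    (∀ z : CuntzThomsen.KKG α β,
      ∃ φ : CuntzThomsen.CocycleRep α β, CuntzThomsen.IsAbsorbing φ ∧
        ∃ h : CuntzThomsen.IsCuntzPair φ θ,
          CuntzThomsen.IsAnchored ⟨φ, θ, h⟩ ∧
          CuntzThomsen.CuntzPair.kkClass ⟨φ, θ, h⟩ = z) := by
  obtain ⟨t, ht⟩ := hβ.exists_isPure
  refine ⟨fun x => ?_, fun z => ?_⟩
  · obtain ⟨x, rfl⟩ := Quot.exists_rep x
    obtain ⟨φ, hφ, h, hh⟩ := ht.exists_absorbing_homotopic hθ x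
    exact ⟨φ, hφ, h, (Quot.sound hh).symm⟩
  · obtain ⟨x, rfl⟩ := Quot.exists_rep z
    -- The representative is corrected by the inverse cocycle pair before absorbing; the class in
    -- `KK^G` is unchanged, and anchoredness passes along the homotopy.
    obtain ⟨φ, hφ, h, hh⟩ := ht.exists_absorbing_homotopic hθ
      (CuntzThomsen.CuntzPair.sum t x x.inverseCocyclePair)
    exact ⟨φ, hφ, h, hh.symm.cocyclePair.trans (ht.isAnchored_sum x),
      (hh.kkClass_eq t).symm.trans (ht.kkClass_sum x _ ⟨rfl, rfl⟩)⟩
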